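/- Write functions on $\mathbb{S}^1$ as $2\pi$-periodic functions, $\int=\int_{-\pi}^{\pi}$, $\gamma(s)=(\cos s,\sin s)$ and $|f|_{W^{1,\infty}}=|f|_{L^\infty}+|f'|_{L^\infty}$. The N-Peskin problem for $h=h(s,t)$ is the equation (with $t$ suppressed, and $'=\partial_s$) $$ \begin{aligned} \partial_t h(s)+\gamma(s)\cdot\frac{\mathrm dM}{\mathrm dt} ={}&-\frac1{8\pi}\int \log\big(D(s,\alpha)\big)\,\partial_\alpha^2\big[\cos\alpha\,(1+h(s-\alpha))\big]\,\mathrm d\alpha\\ &+\frac1{4\pi}\int\frac{\big[1+h(s)-(1+h(s-\alpha))\cos\alpha\big]\big[(1+h(s))\cos\alpha-(1+h(s-\alpha))\big]}{D(s,\alpha)}\,\big(h''(s-\alpha)-1-h(s-\alpha)\big)\,\mathrm d\alpha\\ &+\frac{1+h(s)}{2\pi}\int\frac{\big[1+h(s)-(1+h(s-\alpha))\cos\alpha\big]\sin\alpha}{D(s,\alpha)}\,h'(s-\alpha)\,\mathrm d\alpha, \end{aligned} $$ where $$ D(s,\alpha)=(1+h(s))^2+(1+h(s-\alpha))^2-2(1+h(s))(1+h(s-\alpha))\cos\alpha,\qquad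 \frac{\mathrm dM}{\mathrm dt}=\frac14\,\frac1{2\pi}\int h(s,t)\,(\cos s,\sin s)\,\mathrm ds . $$ **Proposition.** There exist a universal constant $c_0>0$ and a function $T\mapsto C(T)\in(0,\infty)$, depending on $T$ only, such that the following holds. Let $T^\star\in(0,\infty]$ and let $h\in C([0,T^\star];C^2(\mathbb{S}^1))$ (on $[0,\infty)$ if $T^\star=\infty$) be a solution of the N-Peskin problem, the equation holding pointwise for all $s$ and all $0<t<T^\star$, with $h|_{t=0}=h_0$ and $|h_0|_{W^{1,\infty}}<c_0$. Then for every finite $T\in(0,T^\star]$, $$ h\in L^2\big([0,T];H^{3/2}(\mathbb{S}^1)\big)\qquad\text{and}\qquad \|h\|_{L^2([0,T];H^{3/2}(\mathbb{S}^1))}\le C(T), $$ where $\|f\|_{H^{3/2}}^2=\sum_{k\in\mathbb{Z}}(1+k^2)^{3/2}|\hat f(k)|^2$ and $\hat f(k)=\frac1{2\pi}\int f(s)e^{-iks}\,\mathrm ds$. -/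

import Mathlib

open Real Set Filter Topology MeasureTheory
open scoped ENNReal

noncomputable section

namespace NPeskin

/-- Functions on the circle are `2π`-periodic functions on `ℝ`; `∫_{𝕊¹}` is the integral over
one period. -/
def circleMeasure : Measure ℝ := volume.restrict (Ioc (-π) π)

/-- `|X(s) - X(s - α)|²` for the curve `X(s) = (1 + f(s)) (cos s, sin s)`. -/
def chordSq (f : ℝ → ℝ) (s α : ℝ) : ℝ :=
  (1 + f s) ^ 2 + (1 + f (s - α)) ^ 2 - 2 * (1 + f s) * (1 + f (s - α)) * cos α

/-- The velocity `dM/dt = (1/4) (1/2π) ∫ f(s) (cos s, sin s) ds` of the centre. -/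
def centerVelocity (f : ℝ → ℝ) : ℝ × ℝ :=
  (1 / 4 * (1 / (2 * π)) * ∫ s, f s * cos s ∂circleMeasure,
   1 / 4 * (1 / (2 * π)) * ∫ s, f s * sin s ∂circleMeasure)

/-- The contribution of the logarithmic part of the Stokeslet. -/
def logTerm (f : ℝ → ℝ) (s : ℝ) : ℝ :=
  -(1 / (8 * π)) * ∫ α, log (chordSq f s α) *
    iteratedDeriv 2 (fun β => cos β * (1 + f (s - β))) α ∂circleMeasure

/-- The contribution of `z ⊗ z / |z|²` against the normal part of the elastic force. -/
def normalTerm (f : ℝ → ℝ) (s : ℝ) : ℝ :=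
  1 / (4 * π) * ∫ α,
    ((1 + f s - (1 + f (s - α)) * cos α) * ((1 + f s) * cos α - (1 + f (s - α)))
      / chordSq f s α) * (iteratedDeriv 2 f (s - α) - 1 - f (s - α)) ∂circleMeasure

/-- The contribution of `z ⊗ z / |z|²` against the tangential part of the elastic force. -/
def tangentialTerm (f : ℝ → ℝ) (s : ℝ) : ℝ :=
  1 / (2 * π) * (1 + f s) * ∫ α,
    ((1 + f s - (1 + f (s - α)) * cos α) * sin α / chordSq f s α) * deriv f (s - α)
      ∂circleMeasure

/-- The time interval `[0, T⋆]`, which is `[0, ∞)` if `T⋆ = ∞`. -/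
def timeInterval (Tstar : EReal) : Set ℝ := {t : ℝ | 0 ≤ t ∧ (t : EReal) ≤ Tstar}

/-- `h ∈ C(I; C²(𝕊¹))`: every `h(t)` is a `2π`-periodic `C²` function, and `t ↦ h(t)` is continuous
for the norm `‖f‖_∞ + ‖f'‖_∞ + ‖f''‖_∞`. -/
structure IsContinuousC2 (I : Set ℝ) (h : ℝ → ℝ → ℝ) : Prop where
  periodic : ∀ t ∈ I, Function.Periodic (h t) (2 * π)
  contDiff : ∀ t ∈ I, ContDiff ℝ 2 (h t)
  tendsto : ∀ k ≤ 2, ∀ t₀ ∈ I, TendstoUniformly (fun t => iteratedDeriv k (h t))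
    (iteratedDeriv k (h t₀)) (𝓝[I] t₀)

/-- `h` (first argument time, second argument space) is a `C([0, T⋆]; C²)` solution of the
N-Peskin problem with initial datum `h₀`. -/
structure IsC2Solution (Tstar : EReal) (h₀ : ℝ → ℝ) (h : ℝ → ℝ → ℝ) : Prop where
  regular : IsContinuousC2 (timeInterval Tstar) h
  initial : h 0 = h₀
  equation : ∀ t : ℝ, 0 < t → (t : EReal) < Tstar → ∀ s : ℝ,
    ∃ v : ℝ, HasDerivAt (fun τ => h τ s) v t ∧
      v + (cos s * (centerVelocity (h t)).1 + sin s * (centerVelocity (h t)).2) =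
        logTerm (h t) s + normalTerm (h t) s + tangentialTerm (h t) s

/-- The norm `‖f‖_{L^∞} + ‖f'‖_{L^∞}` of `W^{1,∞}(𝕊¹)`. -/
def lipschitzNorm (f : ℝ → ℝ) : ℝ≥0∞ :=
  eLpNorm f ∞ circleMeasure + eLpNorm (deriv f) ∞ circleMeasure

/-- The weighted Fourier coefficient `(1 + k²)^{σ/2} f̂(k)`, where
`f̂(k) = (1/2π) ∫ f(s) e^{-iks} ds`. -/
def besselCoeff (σ : ℝ) (f : ℝ → ℝ) (k : ℤ) : ℂ :=
  (((1 + (k : ℝ) ^ 2) ^ (σ / 2) : ℝ) : ℂ) *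
    fourierCoeffOn (neg_lt_self Real.pi_pos) (fun s => (f s : ℂ)) k

/-- `f ∈ H^σ(𝕊¹)`, for `σ ≥ 0`. -/
def MemSobolev (σ : ℝ) (f : ℝ → ℝ) : Prop :=
  MemLp f 2 circleMeasure ∧ Memℓp (besselCoeff σ f) 2

/-- The norm `(∑ₖ (1 + k²)^σ |f̂(k)|²)^{1/2}` of `H^σ(𝕊¹)`. -/
def sobolevNorm (σ : ℝ) (f : ℝ → ℝ) : ℝ≥0∞ :=
  (∑' k : ℤ, ‖besselCoeff σ f k‖ₑ ^ 2) ^ (1 / 2 : ℝ)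

/-- `u ∈ L²([0, T]; H^σ(𝕊¹))`, the Bochner space; `H^σ(𝕊¹)` is identified, through the isometry
`f ↦ ((1 + k²)^{σ/2} f̂(k))ₖ`, with a closed subspace of `ℓ²(ℤ; ℂ)`. -/
def MemL2Sobolev (σ T : ℝ) (u : ℝ → ℝ → ℝ) : Prop :=
  (∀ᵐ t ∂volume.restrict (Icc 0 T), MemSobolev σ (u t)) ∧
  ∃ F : ℝ → lp (fun _ : ℤ => ℂ) 2, MemLp F 2 (volume.restrict (Icc 0 T)) ∧
    ∀ᵐ t ∂volume.restrict (Icc 0 T), ∀ k : ℤ, F t k = besselCoeff σ (u t) k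

/-- The norm of `L²([0, T]; H^σ(𝕊¹))`. -/
def l2SobolevNorm (σ T : ℝ) (u : ℝ → ℝ → ℝ) : ℝ≥0∞ :=
  (∫⁻ t in Icc 0 T, sobolevNorm σ (u t) ^ 2) ^ (1 / 2 : ℝ)

end NPeskin

end

noncomputable section

namespace NPeskin

/-! The substitution u = log (1 + h) turns the problem into a scalar nonlocal parabolic equation.
With δ = u(s) - u(s - α) and w = δ + iα, the squared chord is 2 e^{u(s) + u(s - α)} (cosh δ - cos
α), so all kernels are built from coth (w/2). An integration by parts in α removes u'' and yields
the contour equation 4π ∂ₜu(s) = -p.v. ∫ `contour` δ α (u'(s - α)) dα. The algebra is in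
`velDensity_identity`, and `abs_logVelocity_add_contourInt_le` gives the truncation error O(√κ). If
|u'| ≤ 1/100, the kernel is a small perturbation of δ / (2 (1 - cos α)), so the equation is a
perturbation of ∂ₜu = -|D|u / 4, with |D| the multiplier |k|.

Three estimates follow from this ellipticity. At a spatial extremum of u the singular part has a
sign, so |u| grows at most linearly in time (`abs_log_le`). The slope bound is propagated by a
comparison principle between u and its translate by ε: at a maximum of u(· + ε) - u, a total
α-derivative can be removed from the difference of integrands, leaving something nonnegative
(`le_of_tendsto_contourInt`). Thus sup |u'| does not exceed its initial bound (`abs_slope_le`), and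
the continuity argument of `isSolutionPath_of_small_slope` closes the smallness assumption on the
whole interval. Finally, testing the equation against u'' gives an energy inequality for ∫ u'², in
which the symmetrized kernel controls ∬ (u'(s) - u'(s - α))² / (1 - cos α), an H^{1/2} seminorm of
u' (`integral_mul_contourInt_le`, `integral_dissipation_le`).

All singular integrals are truncated to κ < |α| < π. Error terms may depend on the C² norm of the
solution, but they vanish as κ → 0, whereas the retained bounds depend on T only. The dissipation
truncated at π/(2n) controls the frequencies |k| ≤ n (`sum_abs_mul_norm_coeff_sq_le`), which bounds
the partial sums of the H^{3/2} norm uniformly in n. -/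

/-! ### The kernels of the contour equation and their derivatives. -/

/-- `cosh δ - cos α`, which is `|e^w - 1|² / (2 e^δ)` for `w = δ + iα`. -/
def den (δ α : ℝ) : ℝ := cosh δ - cos α

/-- The real part of `coth (w / 2)`, `w = δ + iα`. -/
def cothRe (δ α : ℝ) : ℝ := sinh δ / den δ α

/-- Minus the imaginary part of `coth (w / 2)`, `w = δ + iα`. -/
def cothIm (δ α : ℝ) : ℝ := sin α / den δ α

/-- Half the `δ`-derivative of `cothRe`. -/
def cothDer (δ α : ℝ) : ℝ := (1 + cothIm δ α ^ 2 - cothRe δ α ^ 2) / 4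

def kerV (δ α : ℝ) : ℝ := exp (-δ) * sinh δ * cothDer δ α

def kerW (δ α : ℝ) : ℝ := exp (-δ) * sinh δ * (cothRe δ α * cothIm δ α)

def kerZ (δ α : ℝ) : ℝ := kerV δ α + exp (-δ) * cos α / 2

/-- The integrand of the contour equation for `u = log (1 + h)`: here `δ = u(s) - u(s - α)` and
`p = u'(s - α)`. -/
def contour (δ α p : ℝ) : ℝ := kerV δ α + p * kerW δ α - p ^ 2 * kerZ δ α

/-- Subscripts δ and α denote partial derivatives, as `hasDerivAt_kerV` and its analogues confirm.
They are written as polynomials in `cothRe`, `cothIm`, `cothDer` and functions of δ, so that the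
bounds of `kernel_bounds` can be inserted factor by factor. -/
def kerVδ (δ α : ℝ) : ℝ :=
  exp (-δ) * ((cosh δ - sinh δ) * cothDer δ α
    - sinh δ * cothRe δ α * (cothIm δ α ^ 2 + 2 * cothDer δ α) / 2)

def kerVα (δ α : ℝ) : ℝ :=
  exp (-δ) * sinh δ * cothIm δ α * (cothRe δ α ^ 2 / 2 - cothDer δ α)

def kerWδ (δ α : ℝ) : ℝ :=
  exp (-δ) * ((cosh δ - sinh δ) * (cothRe δ α * cothIm δ α)
    + sinh δ * cothIm δ α * (2 * cothDer δ α - cothRe δ α ^ 2))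

def kerWα (δ α : ℝ) : ℝ :=
  -(exp (-δ) * (sinh δ * cothRe δ α) * (cothIm δ α ^ 2 + 2 * cothDer δ α))

def kerZδ (δ α : ℝ) : ℝ := kerVδ δ α - exp (-δ) * cos α / 2

def kerZα (δ α : ℝ) : ℝ := kerVα δ α - exp (-δ) * sin α / 2

/-- The kernel of the linearized equation for `u'`, with `p = u'(s - α)` and `q = u'(s)`. -/
def linKer (δ α p q : ℝ) : ℝ :=
  kerVδ δ α - kerWα δ α + p * q * kerZδ δ α + (p + q) * kerZα δ α

section chain

variable {d a : ℝ → ℝ} {d' a' τ : ℝ}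

/-- The function y = coth (w/2) satisfies y' = (1 - y²)/2. This identity and the next are its
real-variable form; they turn the quotient rule into polynomial derivative formulas. -/
lemma cothDer_eq {δ α : ℝ} (h : den δ α ≠ 0) :
    cosh δ / den δ α - cothRe δ α ^ 2 = 2 * cothDer δ α := by
  unfold cothDer cothIm cothRe
  field_simp
  unfold den
  linear_combination 2 * cosh_sq δ - 2 * sin_sq_add_cos_sq α

lemma cothIm_eq {δ α : ℝ} (h : den δ α ≠ 0) :
    cos α / den δ α - cothIm δ α ^ 2 = -(2 * cothDer δ α) := by
  unfold cothDer cothIm cothRe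
  field_simp
  unfold den
  linear_combination 2 * cosh_sq δ - 2 * sin_sq_add_cos_sq α

/-- The chain rule is stated along a curve (d, a), so that one set of lemmas serves for
differentiation in δ, in α and in s. -/
lemma hasDerivAt_den (hd : HasDerivAt d d' τ) (ha : HasDerivAt a a' τ) :
    HasDerivAt (fun t => den (d t) (a t)) (sinh (d τ) * d' + sin (a τ) * a') τ := by
  have := hd.cosh.sub ha.cos
  refine HasDerivAt.congr_deriv this ?_
  ring

lemma hasDerivAt_cothRe (hd : HasDerivAt d d' τ) (ha : HasDerivAt a a' τ)
    (h : den (d τ) (a τ) ≠ 0) :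
    HasDerivAt (fun t => cothRe (d t) (a t))
      (2 * cothDer (d τ) (a τ) * d' - cothRe (d τ) (a τ) * cothIm (d τ) (a τ) * a') τ := by
  have := hd.sinh.div (hasDerivAt_den hd ha) h
  refine HasDerivAt.congr_deriv this ?_
  rw [← cothDer_eq h]
  unfold cothRe cothIm
  field_simp
  ring

lemma hasDerivAt_cothIm (hd : HasDerivAt d d' τ) (ha : HasDerivAt a a' τ)
    (h : den (d τ) (a τ) ≠ 0) :
    HasDerivAt (fun t => cothIm (d t) (a t))
      (-(cothRe (d τ) (a τ) * cothIm (d τ) (a τ) * d') - 2 * cothDer (d τ) (a τ) * a') τ := by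
  have := ha.sin.div (hasDerivAt_den hd ha) h
  refine HasDerivAt.congr_deriv this ?_
  have e := cothIm_eq h
  rw [show 2 * cothDer (d τ) (a τ) = -(cos (a τ) / den (d τ) (a τ) - cothIm (d τ) (a τ) ^ 2) by
    rw [e]; ring]
  unfold cothRe cothIm
  field_simp
  ring

lemma hasDerivAt_cothDer (hd : HasDerivAt d d' τ) (ha : HasDerivAt a a' τ)
    (h : den (d τ) (a τ) ≠ 0) :
    HasDerivAt (fun t => cothDer (d t) (a t))
      (-(cothRe (d τ) (a τ) * (cothIm (d τ) (a τ) ^ 2 + 2 * cothDer (d τ) (a τ)) / 2) * d'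
        + cothIm (d τ) (a τ) * (cothRe (d τ) (a τ) ^ 2 / 2 - cothDer (d τ) (a τ)) * a') τ := by
  have h1 := hasDerivAt_cothRe hd ha h
  have h2 := hasDerivAt_cothIm hd ha h
  have := (((h2.pow 2).const_add 1).sub (h1.pow 2)).div_const 4
  refine HasDerivAt.congr_deriv this ?_
  push_cast
  ring

lemma hasDerivAt_expNeg (hd : HasDerivAt d d' τ) :
    HasDerivAt (fun t => exp (-(d t))) (-(exp (-(d τ)) * d')) τ := by
  have := hd.neg.exp
  refine HasDerivAt.congr_deriv this ?_
  simp only [Pi.neg_apply]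
  ring

lemma hasDerivAt_kerV (hd : HasDerivAt d d' τ) (ha : HasDerivAt a a' τ)
    (h : den (d τ) (a τ) ≠ 0) :
    HasDerivAt (fun t => kerV (d t) (a t))
      (kerVδ (d τ) (a τ) * d' + kerVα (d τ) (a τ) * a') τ := by
  have := ((hasDerivAt_expNeg hd).mul hd.sinh).mul (hasDerivAt_cothDer hd ha h)
  refine HasDerivAt.congr_deriv this ?_
  unfold kerVδ kerVα
  simp only [Pi.mul_apply]
  ring

lemma hasDerivAt_kerW (hd : HasDerivAt d d' τ) (ha : HasDerivAt a a' τ)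
    (h : den (d τ) (a τ) ≠ 0) :
    HasDerivAt (fun t => kerW (d t) (a t))
      (kerWδ (d τ) (a τ) * d' + kerWα (d τ) (a τ) * a') τ := by
  have := ((hasDerivAt_expNeg hd).mul hd.sinh).mul
    ((hasDerivAt_cothRe hd ha h).mul (hasDerivAt_cothIm hd ha h))
  refine HasDerivAt.congr_deriv this ?_
  unfold kerWδ kerWα
  simp only [Pi.mul_apply]
  ring

lemma hasDerivAt_kerZ (hd : HasDerivAt d d' τ) (ha : HasDerivAt a a' τ)
    (h : den (d τ) (a τ) ≠ 0) :
    HasDerivAt (fun t => kerZ (d t) (a t))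
      (kerZδ (d τ) (a τ) * d' + kerZα (d τ) (a τ) * a') τ := by
  have := (hasDerivAt_kerV hd ha h).add (((hasDerivAt_expNeg hd).mul ha.cos).div_const 2)
  refine HasDerivAt.congr_deriv this ?_
  unfold kerZδ kerZα
  ring

end chain

/-! ### Kernel bounds in the regime of small slopes. -/

lemma sq_le_five_mul_one_sub_cos {α : ℝ} (h : |α| ≤ π) : α ^ 2 ≤ 5 * (1 - cos α) := by
  have h1 := Real.cos_le_one_sub_mul_cos_sq h
  have h2 : π ^ 2 ≤ 10 := by nlinarith [pi_lt_d2, pi_pos]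
  have h3 : 2 / π ^ 2 ≥ 1 / 5 := by
    rw [ge_iff_le, div_le_div_iff₀ (by norm_num) (by positivity)]
    linarith
  nlinarith [sq_nonneg α]

lemma one_sub_cos_pos {α : ℝ} (h : |α| ≤ π) (h0 : α ≠ 0) : 0 < 1 - cos α := by
  have := sq_le_five_mul_one_sub_cos h
  have : 0 < α ^ 2 := by positivity
  linarith

lemma den_pos (δ : ℝ) {α : ℝ} (h : |α| ≤ π) (h0 : α ≠ 0) : 0 < den δ α := by
  have := one_sub_cos_pos h h0
  have := one_le_cosh δ
  unfold den
  linarith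

/-- Write L = 1 - cos α. From |δ| ≤ |α|/100 and α² ≤ 5L one gets δ² ≤ L/2000, hence cosh δ - 1 and
sinh² δ are small multiples of L and the denominator is L up to a factor 1.0003. Everything else is
algebra: `cothDer` is close to 1/(2L), `cothIm` has size L^{-1/2}, and `cothRe` is a small multiple
of L^{-1/2}. -/
lemma kernel_bounds {δ α : ℝ} (h : |α| ≤ π) (h0 : α ≠ 0) (hδ : |δ| ≤ |α| / 100) :
    (1 ≤ cosh δ ∧ cosh δ ≤ 1.001) ∧ |sinh δ| ≤ 0.04 ∧ (0.95 ≤ exp (-δ) ∧ exp (-δ) ≤ 1.05) ∧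
    |sinh δ * α| ≤ 0.06 * (1 - cos α) ∧
    (0.49 ≤ cothDer δ α * (1 - cos α) ∧ cothDer δ α * (1 - cos α) ≤ 0.51) ∧
    cothRe δ α ^ 2 * (1 - cos α) ≤ 0.001 ∧
    cothIm δ α ^ 2 * (1 - cos α) ≤ 2 ∧
    (0 ≤ sinh δ * cothRe δ α ∧ sinh δ * cothRe δ α ≤ 0.001) ∧
    |sinh δ * cothIm δ α| ≤ 0.04 ∧
    |cothRe δ α * cothIm δ α * (1 - cos α)| ≤ 0.04 := by
  have hL := one_sub_cos_pos h h0
  have hL2 : 1 - cos α ≤ 2 := by linarith [neg_one_le_cos α]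
  have hα := sq_le_five_mul_one_sub_cos h
  have hQ : den δ α = cosh δ - cos α := rfl
  have hQ0 := den_pos δ h h0
  set L := 1 - cos α with hLdef
  have hδ2 : δ ^ 2 ≤ L / 2000 := by
    have : δ ^ 2 ≤ (|α| / 100) ^ 2 := sq_le_sq' (by linarith [neg_abs_le δ]) (le_trans (le_abs_self _) hδ)
    rw [div_pow, sq_abs] at this
    linarith
  have hC1 := one_le_cosh δ
  have hC : cosh δ - 1 ≤ 0.0003 * L := by
    have h1 := Real.cosh_le_exp_half_sq δ
    have h2 : exp (δ ^ 2 / 2) ≤ 1 / (1 - δ ^ 2 / 2) := by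
      rw [le_div_iff₀ (by linarith)]
      have := Real.add_one_le_exp (-(δ ^ 2 / 2))
      calc exp (δ ^ 2 / 2) * (1 - δ ^ 2 / 2) ≤ exp (δ ^ 2 / 2) * exp (-(δ ^ 2 / 2)) := by
            gcongr; linarith
        _ = 1 := by rw [← exp_add]; simp
    have h3 : 1 / (1 - δ ^ 2 / 2) ≤ 1 + 0.6 * δ ^ 2 := by
      rw [div_le_iff₀ (by linarith)]
      nlinarith [sq_nonneg δ]
    linarith
  have hCC : cosh δ ≤ 1.0006 := by linarith
  have hS2 : sinh δ ^ 2 ≤ 0.00061 * L := by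
    have := cosh_sq δ
    nlinarith
  have hS : |sinh δ| ≤ 0.04 := abs_le_of_sq_le_sq (by nlinarith) (by norm_num)
  have hE : exp (-δ) = cosh δ - sinh δ := by rw [cosh_sub_sinh]
  have hSa : |sinh δ * α| ≤ 0.06 * L := by
    refine abs_le_of_sq_le_sq ?_ (by positivity)
    rw [mul_pow]
    nlinarith [sq_nonneg α, sq_nonneg (sinh δ)]
  have hQL : L ≤ den δ α := by rw [hQ]; linarith
  have hQU : den δ α ≤ 1.0003 * L := by rw [hQ]; linarith
  have hx : cothRe δ α * den δ α = sinh δ := div_mul_cancel₀ _ hQ0.ne'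
  have hy : cothIm δ α * den δ α = sin α := div_mul_cancel₀ _ hQ0.ne'
  -- This closed form makes the positivity and size of `cothDer` visible, which its definition as a
  -- difference of squares hides.
  have hk : 2 * den δ α ^ 2 * cothDer δ α = 1 - cos α * cosh δ := by
    have e1 := cosh_sq δ
    have e2 := sin_sq_add_cos_sq α
    have : 4 * cothDer δ α = 1 + cothIm δ α ^ 2 - cothRe δ α ^ 2 := by unfold cothDer; ring
    have : 4 * (den δ α ^ 2 * cothDer δ α) =
      den δ α ^ 2 + (cothIm δ α * den δ α) ^ 2 - (cothRe δ α * den δ α) ^ 2 := by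
      rw [mul_pow, mul_pow]; linear_combination den δ α ^ 2 * this
    rw [hx, hy, hQ] at this
    rw [hQ]
    nlinarith
  have hkl : 0.9997 * L ≤ 1 - cos α * cosh δ := by
    nlinarith [neg_one_le_cos α, cos_le_one α]
  have hku : 1 - cos α * cosh δ ≤ 1.0003 * L := by
    nlinarith [neg_one_le_cos α, cos_le_one α]
  have hs2 : sin α ^ 2 ≤ 2 * L := by
    have e2 := sin_sq_add_cos_sq α
    nlinarith
  have hxL : cothRe δ α ^ 2 * L ≤ 0.00061 := by
    have : cothRe δ α ^ 2 * L ^ 2 ≤ cothRe δ α ^ 2 * den δ α ^ 2 := by gcongr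
    rw [← mul_pow _ (den δ α), hx] at this
    exact le_of_mul_le_mul_right (by linarith) hL
  have hyL : cothIm δ α ^ 2 * L ≤ 2 := by
    have : cothIm δ α ^ 2 * L ^ 2 ≤ cothIm δ α ^ 2 * den δ α ^ 2 := by gcongr
    rw [← mul_pow _ (den δ α), hy] at this
    exact le_of_mul_le_mul_right (by linarith) hL
  have hSx0 : 0 ≤ sinh δ * cothRe δ α := by
    unfold cothRe
    rw [← mul_div_assoc]
    exact div_nonneg (mul_self_nonneg _) hQ0.le
  have hS' := abs_le.1 hS
  have hk0 : 0 ≤ cothDer δ α := by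
    by_contra! hh
    have : 2 * den δ α ^ 2 * cothDer δ α < 0 := mul_neg_of_pos_of_neg (by positivity) hh
    linarith
  refine ⟨⟨hC1, by linarith⟩, hS, ⟨by rw [hE]; linarith, by rw [hE]; linarith⟩, hSa, ⟨?_, ?_⟩, by linarith, hyL,
    ⟨hSx0, ?_⟩, ?_, ?_⟩
  · have h1 : 2 * den δ α ^ 2 ≤ 2 * (1.0003 * L) ^ 2 := by gcongr
    have h2 : 2 * den δ α ^ 2 * cothDer δ α ≤ 2 * (1.0003 * L) ^ 2 * cothDer δ α := by gcongr
    refine le_of_mul_le_mul_right (a := L) ?_ hL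
    linarith
  · have : 2 * L ^ 2 * cothDer δ α ≤ 2 * den δ α ^ 2 * cothDer δ α := by gcongr
    refine le_of_mul_le_mul_right (a := L) ?_ hL
    linarith
  · have : sinh δ * cothRe δ α * L ≤ sinh δ * cothRe δ α * den δ α := by gcongr
    rw [mul_assoc, mul_assoc, hx] at this
    refine le_of_mul_le_mul_right (a := L) ?_ hL
    linarith
  · refine abs_le_of_sq_le_sq ?_ (by norm_num)
    rw [mul_pow]
    have : sinh δ ^ 2 * cothIm δ α ^ 2 ≤ (0.00061 * L) * cothIm δ α ^ 2 := by gcongr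
    linarith
  · refine abs_le_of_sq_le_sq ?_ (by norm_num)
    have : (cothRe δ α ^ 2 * L) * (cothIm δ α ^ 2 * L) ≤ 0.00061 * 2 := by gcongr
    linarith

lemma one_sub_cos_le_two (α : ℝ) : 1 - cos α ≤ 2 := by linarith [neg_one_le_cos α]

lemma abs_mul_le_of_le {a b A B : ℝ} (ha : |a| ≤ A) (hb : |b| ≤ B) : |a * b| ≤ A * B := by
  rw [abs_mul]
  exact mul_le_mul ha hb (abs_nonneg _) ((abs_nonneg _).trans ha)

lemma kerVδ_bounds {δ α : ℝ} (h : |α| ≤ π) (h0 : α ≠ 0) (hδ : |δ| ≤ |α| / 100) :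
    0.4 ≤ kerVδ δ α * (1 - cos α) ∧ kerVδ δ α * (1 - cos α) ≤ 0.6 := by
  obtain ⟨⟨hC1, hC2⟩, hS, ⟨hE1, hE2⟩, hSa, ⟨hk1, hk2⟩, hx, hy, ⟨hSx1, hSx2⟩, hSy, hxy⟩ :=
    kernel_bounds h h0 hδ
  have hL := one_sub_cos_pos h h0
  have e : kerVδ δ α * (1 - cos α) = exp (-δ) * ((cosh δ - sinh δ) * (cothDer δ α * (1 - cos α))
    - sinh δ * cothRe δ α * (cothIm δ α ^ 2 * (1 - cos α) + 2 * (cothDer δ α * (1 - cos α))) / 2) := by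
    unfold kerVδ; ring
  rw [e, cosh_sub_sinh]
  have hy0 : 0 ≤ cothIm δ α ^ 2 * (1 - cos α) := by positivity
  set K := cothDer δ α * (1 - cos α)
  set Y := cothIm δ α ^ 2 * (1 - cos α)
  set a := sinh δ * cothRe δ α
  set E := exp (-δ)
  have h1 : 0 ≤ a * (Y + 2 * K) := by positivity
  have h2 : a * (Y + 2 * K) ≤ 0.001 * 4 := by
    apply mul_le_mul hSx2 (by linarith) (by linarith) (by norm_num)
  have h3 : 0.95 * 0.49 ≤ E * K := mul_le_mul hE1 hk1 (by norm_num) (by linarith)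
  have h4 : E * K ≤ 1.05 * 0.51 := mul_le_mul hE2 hk2 (by linarith) (by norm_num)
  constructor
  · calc (0.4 : ℝ) ≤ 0.95 * 0.46 := by norm_num
      _ ≤ _ := mul_le_mul hE1 (by linarith) (by norm_num) (by linarith)
  · calc _ ≤ 1.05 * 0.54 := mul_le_mul hE2 (by linarith) (by linarith) (by norm_num)
      _ ≤ (0.6 : ℝ) := by norm_num

lemma abs_kerWδ_le {δ α : ℝ} (h : |α| ≤ π) (h0 : α ≠ 0) (hδ : |δ| ≤ |α| / 100) :
    |kerWδ δ α * (1 - cos α)| ≤ 0.1 := by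
  obtain ⟨⟨hC1, hC2⟩, hS, ⟨hE1, hE2⟩, hSa, ⟨hk1, hk2⟩, hx, hy, ⟨hSx1, hSx2⟩, hSy, hxy⟩ :=
    kernel_bounds h h0 hδ
  have hL := one_sub_cos_pos h h0
  have e : kerWδ δ α * (1 - cos α) = exp (-δ) * (exp (-δ) * (cothRe δ α * cothIm δ α * (1 - cos α))
    + sinh δ * cothIm δ α * (2 * (cothDer δ α * (1 - cos α)) - cothRe δ α ^ 2 * (1 - cos α))) := by
    unfold kerWδ; rw [cosh_sub_sinh]; ring
  rw [e]
  have hE : |exp (-δ)| ≤ 1.05 := by rw [abs_of_pos (exp_pos _)]; exact hE2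
  have hx0 : 0 ≤ cothRe δ α ^ 2 * (1 - cos α) := by positivity
  have h1 := abs_mul_le_of_le hE hxy
  have h2 : |2 * (cothDer δ α * (1 - cos α)) - cothRe δ α ^ 2 * (1 - cos α)| ≤ 1.03 := by
    rw [abs_le]; constructor <;> linarith
  have h3 := abs_mul_le_of_le hSy h2
  refine (abs_mul_le_of_le hE ((abs_add_le _ _).trans (add_le_add h1 h3))).trans (by norm_num)

lemma abs_kerWα_le {δ α : ℝ} (h : |α| ≤ π) (h0 : α ≠ 0) (hδ : |δ| ≤ |α| / 100) :
    |kerWα δ α * (1 - cos α)| ≤ 0.01 := by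
  obtain ⟨⟨hC1, hC2⟩, hS, ⟨hE1, hE2⟩, hSa, ⟨hk1, hk2⟩, hx, hy, ⟨hSx1, hSx2⟩, hSy, hxy⟩ :=
    kernel_bounds h h0 hδ
  have hL := one_sub_cos_pos h h0
  have e : kerWα δ α * (1 - cos α) = -(exp (-δ) * (sinh δ * cothRe δ α) *
      (cothIm δ α ^ 2 * (1 - cos α) + 2 * (cothDer δ α * (1 - cos α)))) := by
    unfold kerWα; ring
  rw [e, abs_neg]
  have hE : |exp (-δ)| ≤ 1.05 := by rw [abs_of_pos (exp_pos _)]; exact hE2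
  have hy0 : 0 ≤ cothIm δ α ^ 2 * (1 - cos α) := by positivity
  refine (abs_mul_le_of_le (abs_mul_le_of_le hE (B := 0.001) ?_) (B := 4) ?_).trans (by norm_num)
  · rw [abs_le]; constructor <;> linarith
  · rw [abs_le]; constructor <;> linarith

lemma abs_kerZδ_le {δ α : ℝ} (h : |α| ≤ π) (h0 : α ≠ 0) (hδ : |δ| ≤ |α| / 100) :
    |kerZδ δ α * (1 - cos α)| ≤ 2 := by
  obtain ⟨⟨hC1, hC2⟩, hS, ⟨hE1, hE2⟩, hSa, ⟨hk1, hk2⟩, hx, hy, ⟨hSx1, hSx2⟩, hSy, hxy⟩ :=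
    kernel_bounds h h0 hδ
  obtain ⟨hV1, hV2⟩ := kerVδ_bounds h h0 hδ
  have hL := one_sub_cos_pos h h0
  have e : kerZδ δ α * (1 - cos α) = kerVδ δ α * (1 - cos α)
      - exp (-δ) * (cos α * ((1 - cos α) / 2)) := by
    unfold kerZδ; ring
  rw [e]
  have hE : |exp (-δ)| ≤ 1.05 := by rw [abs_of_pos (exp_pos _)]; exact hE2
  have h1 : |kerVδ δ α * (1 - cos α)| ≤ 0.6 := by rw [abs_le]; constructor <;> linarith
  have h2 : |(1 - cos α) / 2| ≤ 1 := by
    rw [abs_le]; constructor <;> linarith [one_sub_cos_le_two α]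
  have h3 := abs_mul_le_of_le hE (abs_mul_le_of_le (abs_cos_le_one α) h2)
  refine (abs_sub _ _).trans ((add_le_add h1 h3).trans (by norm_num))

lemma abs_kerZα_le {δ α : ℝ} (h : |α| ≤ π) (h0 : α ≠ 0) (hδ : |δ| ≤ |α| / 100) :
    |kerZα δ α * (1 - cos α)| ≤ 1.2 := by
  obtain ⟨⟨hC1, hC2⟩, hS, ⟨hE1, hE2⟩, hSa, ⟨hk1, hk2⟩, hx, hy, ⟨hSx1, hSx2⟩, hSy, hxy⟩ :=
    kernel_bounds h h0 hδ
  have hL := one_sub_cos_pos h h0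
  have e : kerZα δ α * (1 - cos α) = exp (-δ) * (sinh δ * cothIm δ α * (cothRe δ α ^ 2 * (1 - cos α) / 2
      - cothDer δ α * (1 - cos α)) - sin α * ((1 - cos α) / 2)) := by
    unfold kerZα kerVα; ring
  rw [e]
  have hE : |exp (-δ)| ≤ 1.05 := by rw [abs_of_pos (exp_pos _)]; exact hE2
  have hx0 : 0 ≤ cothRe δ α ^ 2 * (1 - cos α) := by positivity
  have h2 : |(1 - cos α) / 2| ≤ 1 := by
    rw [abs_le]; constructor <;> linarith [one_sub_cos_le_two α]
  have h3 := abs_mul_le_of_le (abs_sin_le_one α) h2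
  have h4 : |cothRe δ α ^ 2 * (1 - cos α) / 2 - cothDer δ α * (1 - cos α)| ≤ 0.52 := by
    rw [abs_le]; constructor <;> linarith
  have h5 := abs_mul_le_of_le hSy h4
  refine (abs_mul_le_of_le hE ((abs_sub _ _).trans (add_le_add h5 h3))).trans (by norm_num)

lemma abs_kerW_mul_le {δ α : ℝ} (h : |α| ≤ π) (h0 : α ≠ 0) (hδ : |δ| ≤ |α| / 100) :
    |kerW δ α * α| ≤ 1 := by
  obtain ⟨⟨hC1, hC2⟩, hS, ⟨hE1, hE2⟩, hSa, ⟨hk1, hk2⟩, hx, hy, ⟨hSx1, hSx2⟩, hSy, hxy⟩ :=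
    kernel_bounds h h0 hδ
  have hL := one_sub_cos_pos h h0
  have hα := sq_le_five_mul_one_sub_cos h
  have e : kerW δ α * α = exp (-δ) * (sinh δ * cothRe δ α) * (cothIm δ α * α) := by
    unfold kerW; ring
  rw [e]
  have hE : |exp (-δ)| ≤ 1.05 := by rw [abs_of_pos (exp_pos _)]; exact hE2
  refine (abs_mul_le_of_le (abs_mul_le_of_le hE (B := 0.001) ?_) (B := 4) ?_).trans (by norm_num)
  · rw [abs_le]; constructor <;> linarith
  · refine abs_le_of_sq_le_sq ?_ (by norm_num)
    rw [mul_pow]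
    nlinarith [sq_nonneg (cothIm δ α)]

lemma abs_kerZ_mul_le {δ α : ℝ} (h : |α| ≤ π) (h0 : α ≠ 0) (hδ : |δ| ≤ |α| / 100) :
    |kerZ δ α * α| ≤ 2 := by
  obtain ⟨⟨hC1, hC2⟩, hS, ⟨hE1, hE2⟩, hSa, ⟨hk1, hk2⟩, hx, hy, ⟨hSx1, hSx2⟩, hSy, hxy⟩ :=
    kernel_bounds h h0 hδ
  have hL := one_sub_cos_pos h h0
  have e : kerZ δ α * α = exp (-δ) * ((sinh δ * α) * cothDer δ α + cos α * (α / 2)) := by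
    unfold kerZ kerV; ring
  rw [e]
  have hE : |exp (-δ)| ≤ 1.05 := by rw [abs_of_pos (exp_pos _)]; exact hE2
  have hk0 : 0 ≤ cothDer δ α := by
    by_contra! hh
    have := mul_neg_of_neg_of_pos hh hL
    linarith
  have h1 : |(sinh δ * α) * cothDer δ α| ≤ 0.06 * 0.51 := by
    rw [abs_mul, abs_of_nonneg hk0]
    calc _ ≤ (0.06 * (1 - cos α)) * cothDer δ α := by gcongr
      _ ≤ 0.06 * 0.51 := by linarith
  have h2 : |cos α * (α / 2)| ≤ 1 * 1.6 := by
    refine abs_mul_le_of_le (abs_cos_le_one α) ?_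
    rw [abs_div, abs_two]
    linarith [pi_lt_d2]
  refine (abs_mul_le_of_le hE ((abs_add_le _ _).trans (add_le_add h1 h2))).trans (by norm_num)

lemma den_neg (δ α : ℝ) : den (-δ) (-α) = den δ α := by simp [den]
lemma cothRe_neg (δ α : ℝ) : cothRe (-δ) (-α) = -cothRe δ α := by simp [cothRe, den_neg, neg_div]
lemma cothIm_neg (δ α : ℝ) : cothIm (-δ) (-α) = -cothIm δ α := by simp [cothIm, den_neg, neg_div]
lemma cothDer_neg (δ α : ℝ) : cothDer (-δ) (-α) = cothDer δ α := by
  simp [cothDer, cothRe_neg, cothIm_neg]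

/-- The term `kerVδ` is about 1/(2L), with L = 1 - cos α. All others are O(1/L) with a small
constant: `kerWα` through sinh δ · `cothRe`, the `kerZ` terms through p and q. -/
lemma le_linKer {δ α p q : ℝ} (h : |α| ≤ π) (h0 : α ≠ 0) (hδ : |δ| ≤ |α| / 100)
    (hp : |p| ≤ 1 / 100) (hq : |q| ≤ 1 / 100) : 0.3 ≤ linKer δ α p q * (1 - cos α) := by
  have e : linKer δ α p q * (1 - cos α) = kerVδ δ α * (1 - cos α) - kerWα δ α * (1 - cos α)
    + p * q * (kerZδ δ α * (1 - cos α)) + (p + q) * (kerZα δ α * (1 - cos α)) := by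
    unfold linKer; ring
  have h1 := (kerVδ_bounds h h0 hδ).1
  have h2 := abs_le.1 (abs_kerWα_le h h0 hδ)
  have h3 := abs_le.1 (abs_mul_le_of_le (abs_mul_le_of_le hp hq) (abs_kerZδ_le h h0 hδ))
  have h4 := abs_le.1 (abs_mul_le_of_le ((abs_add_le _ _).trans (add_le_add hp hq))
    (abs_kerZα_le h h0 hδ))
  rw [e]
  linarith [h1, h2.2, h3.1, h4.1]

/-- The leading singularity of `linKer` is even under (δ, α, p, q) ↦ (-δ, -α, q, p). Hence the odd
part gains one power of α and is O(1/α) instead of O(1/α²). -/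
lemma abs_linKer_sub_neg_le {δ α p q : ℝ} (h : |α| ≤ π) (h0 : α ≠ 0) (hδ : |δ| ≤ |α| / 100)
    (hp : |p| ≤ 1 / 100) (hq : |q| ≤ 1 / 100) :
    |(linKer δ α p q - linKer (-δ) (-α) q p) * α| ≤ 1 := by
  obtain ⟨⟨hC1, hC2⟩, hS, ⟨hE1, hE2⟩, hSa, ⟨hk1, hk2⟩, hx, hy, ⟨hSx1, hSx2⟩, hSy, hxy⟩ :=
    kernel_bounds h h0 hδ
  have hL := one_sub_cos_pos h h0
  set T := sinh δ * cothRe δ α * (cothIm δ α ^ 2 + 2 * cothDer δ α) with hT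
  set R := sinh δ * cothIm δ α * (cothRe δ α ^ 2 / 2 - cothDer δ α) with hR
  -- After the even parts cancel, each remaining term has a factor sinh δ · α, which is O(1 - cos
  -- α), or the harmless factor sin α · α.
  have e : (linKer δ α p q - linKer (-δ) (-α) q p) * α =
      (1 + p * q) * (-4 * cosh δ * ((sinh δ * α) * cothDer δ α))
      + (p * q - 1) * ((sinh δ * α) * T) + p * q * ((sinh δ * α) * cos α)
      + (p + q) * (-2 * ((sinh δ * α) * R) - cosh δ * (sin α * α)) := by
    unfold linKer kerZδ kerZα kerVδ kerWα kerVα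
    simp only [cothRe_neg, cothIm_neg, cothDer_neg, sinh_neg, cosh_neg, neg_neg, sin_neg, cos_neg]
    rw [show exp δ = cosh δ + sinh δ by rw [cosh_add_sinh],
      show exp (-δ) = cosh δ - sinh δ by rw [cosh_sub_sinh], hT, hR]
    ring
  rw [e]
  have hX0 : 0 ≤ cothRe δ α ^ 2 * (1 - cos α) := by positivity
  have hY0 : 0 ≤ cothIm δ α ^ 2 * (1 - cos α) := by positivity
  have key : ∀ {w B : ℝ}, |w * (1 - cos α)| ≤ B → |(sinh δ * α) * w| ≤ 0.06 * B := by
    intro w B hw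
    rw [abs_mul]
    rw [abs_mul, abs_of_pos hL] at hw
    calc _ ≤ (0.06 * (1 - cos α)) * |w| := by gcongr
      _ ≤ 0.06 * B := by linarith
  have b1 : |(sinh δ * α) * cothDer δ α| ≤ 0.06 * 0.51 :=
    key (by rw [abs_le]; constructor <;> linarith)
  have b2 : |(sinh δ * α) * T| ≤ 0.06 * (0.001 * 4) := by
    apply key
    rw [hT, mul_assoc]
    apply abs_mul_le_of_le
    · rw [abs_le]; constructor <;> linarith
    · rw [abs_le]; constructor <;> linarith
  have b3 : |(sinh δ * α) * cos α| ≤ 0.06 * 2 := by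
    apply key
    have := abs_mul_le_of_le (abs_cos_le_one α) (b := 1 - cos α) (B := 2)
      (by rw [abs_of_pos hL]; exact one_sub_cos_le_two α)
    linarith
  have b4 : |(sinh δ * α) * R| ≤ 0.06 * (0.04 * 0.52) := by
    apply key
    rw [hR, mul_assoc]
    apply abs_mul_le_of_le hSy
    rw [abs_le]; constructor <;> linarith
  have b5 : |sin α * α| ≤ 1 * 3.15 := abs_mul_le_of_le (abs_sin_le_one α) (by linarith [pi_lt_d2])
  have hC : |cosh δ| ≤ 1.001 := by rw [abs_of_pos (cosh_pos _)]; exact hC2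
  have hpq := abs_mul_le_of_le hp hq
  have hpq' := abs_le.1 hpq
  have c1 : |1 + p * q| ≤ 1.01 := by rw [abs_le]; constructor <;> linarith
  have c2 : |p * q - 1| ≤ 1.01 := by rw [abs_le]; constructor <;> linarith
  have c3 := (abs_add_le p q).trans (add_le_add hp hq)
  have d0 : |-4 * cosh δ| ≤ 4 * 1.001 := abs_mul_le_of_le (by norm_num) hC
  have d1 := abs_mul_le_of_le c1 (abs_mul_le_of_le d0 b1)
  have d2 := abs_mul_le_of_le c2 b2
  have d3 := abs_mul_le_of_le hpq b3
  have d4 := abs_mul_le_of_le c3 ((abs_sub (-2 * ((sinh δ * α) * R)) (cosh δ * (sin α * α))).trans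
    (add_le_add (abs_mul_le_of_le (show |(-2 : ℝ)| ≤ 2 by norm_num) b4) (abs_mul_le_of_le hC b5)))
  have d1' := abs_le.1 d1
  have d2' := abs_le.1 d2
  have d3' := abs_le.1 d3
  have d4' := abs_le.1 d4
  rw [abs_le]
  constructor <;> linarith [d1'.1, d1'.2, d2'.1, d2'.2, d3'.1, d3'.2, d4'.1, d4'.2]

/-! ### Periodic profiles and the contour form of the velocity. -/

/-- A `2π`-periodic `C²` function together with its first two derivatives. -/
structure IsC2Profile (f f1 f2 : ℝ → ℝ) : Prop where
  per : Function.Periodic f (2 * π)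
  d1 : ∀ s, HasDerivAt f (f1 s) s
  d2 : ∀ s, HasDerivAt f1 (f2 s) s
  cont2 : Continuous f2

namespace IsC2Profile

variable {f f1 f2 : ℝ → ℝ}

lemma cont (h : IsC2Profile f f1 f2) : Continuous f :=
  continuous_iff_continuousAt.2 fun s => (h.d1 s).continuousAt

lemma cont1 (h : IsC2Profile f f1 f2) : Continuous f1 :=
  continuous_iff_continuousAt.2 fun s => (h.d2 s).continuousAt

lemma per1 (h : IsC2Profile f f1 f2) : Function.Periodic f1 (2 * π) := fun s => by
  have := (h.d1 (s + 2 * π)).comp_add_const s (2 * π)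
  rw [show (fun x => f (x + 2 * π)) = f from funext h.per] at this
  exact this.unique (h.d1 s)

lemma per2 (h : IsC2Profile f f1 f2) : Function.Periodic f2 (2 * π) := fun s => by
  have := (h.d2 (s + 2 * π)).comp_add_const s (2 * π)
  rw [show (fun x => f1 (x + 2 * π)) = f1 from funext h.per1] at this
  exact this.unique (h.d2 s)

lemma translate (h : IsC2Profile f f1 f2) (a : ℝ) :
    IsC2Profile (fun s => f (s + a)) (fun s => f1 (s + a)) (fun s => f2 (s + a)) where
  per s := by
    change f (s + 2 * π + a) = f (s + a)
    rw [add_right_comm]; exact h.per _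
  d1 s := (h.d1 (s + a)).comp_add_const s a
  d2 s := (h.d2 (s + a)).comp_add_const s a
  cont2 := h.cont2.comp (continuous_add_const a)

lemma hasDerivAt_sub (h : IsC2Profile f f1 f2) (s α : ℝ) :
    HasDerivAt (fun β => f (s - β)) (-f1 (s - α)) α :=
  (h.d1 (s - α)).comp_const_sub s α

lemma hasDerivAt_sub1 (h : IsC2Profile f f1 f2) (s α : ℝ) :
    HasDerivAt (fun β => f1 (s - β)) (-f2 (s - α)) α :=
  (h.d2 (s - α)).comp_const_sub s α

lemma abs_sub_le (h : IsC2Profile f f1 f2) {M : ℝ} (hM : ∀ s, |f1 s| ≤ M) (a b : ℝ) :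
    |f a - f b| ≤ M * |a - b| := by
  have := Convex.norm_image_sub_le_of_norm_hasDerivWithin_le (s := univ) (f := f) (f' := f1) (C := M)
    (fun x _ => (h.d1 x).hasDerivWithinAt) (fun x _ => hM x) convex_univ (mem_univ b) (mem_univ a)
  simpa using this

lemma abs_sub_le1 (h : IsC2Profile f f1 f2) {M : ℝ} (hM : ∀ s, |f2 s| ≤ M) (a b : ℝ) :
    |f1 a - f1 b| ≤ M * |a - b| := by
  have := Convex.norm_image_sub_le_of_norm_hasDerivWithin_le (s := univ) (f := f1) (f' := f2) (C := M)
    (fun x _ => (h.d2 x).hasDerivWithinAt) (fun x _ => hM x) convex_univ (mem_univ b) (mem_univ a)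
  simpa using this

lemma abs_second_difference_le (h : IsC2Profile f f1 f2) {M : ℝ} (hM : ∀ s, |f2 s| ≤ M) (s : ℝ)
    {κ : ℝ} (hκ : 0 ≤ κ) : |f (s - κ) + f (s - -κ) - 2 * f s| ≤ 2 * M * κ ^ 2 := by
  have h1 : ∀ x, HasDerivAt (fun x => f (s - x) + f (s - -x)) (-f1 (s - x) + f1 (s - -x)) x := by
    intro x
    refine (h.hasDerivAt_sub s x).add ?_
    have := (h.d1 (s - -x)).comp x ((hasDerivAt_neg x).const_sub s)
    exact this.congr_deriv (by ring)
  have h2 := Convex.norm_image_sub_le_of_norm_hasDerivWithin_le (s := Icc 0 κ)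
    (f := fun x => f (s - x) + f (s - -x)) (f' := fun x => -f1 (s - x) + f1 (s - -x)) (C := 2 * M * κ)
    (fun x _ => (h1 x).hasDerivWithinAt) ?_ (convex_Icc 0 κ) (left_mem_Icc.2 hκ) (right_mem_Icc.2 hκ)
  · simp only [norm_eq_abs, sub_zero, neg_zero, abs_of_nonneg hκ] at h2
    rw [show f (s - κ) + f (s - -κ) - 2 * f s = f (s - κ) + f (s - -κ) - (f s + f s) by ring]
    linarith
  · intro x hx
    have := h.abs_sub_le1 hM (s - -x) (s - x)
    rw [show s - -x - (s - x) = 2 * x by ring, abs_of_nonneg (a := 2 * x) (by linarith [hx.1])] at this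
    rw [norm_eq_abs, neg_add_eq_sub]
    have hM0 : 0 ≤ M := (abs_nonneg _).trans (hM 0)
    nlinarith [hx.2]

end IsC2Profile

/-- The integrand of the contour equation for the profile `u`. -/
def contourFun (u u1 : ℝ → ℝ) (s α : ℝ) : ℝ := contour (u s - u (s - α)) α (u1 (s - α))

/-- The integral of the contour equation, truncated to `κ < |α| < π`. -/
def contourInt (u u1 : ℝ → ℝ) (κ s : ℝ) : ℝ :=
  ∫ α in κ..π, (contourFun u u1 s α + contourFun u u1 s (-α))

/-- The velocity of the interface relative to its centre, divided by the radius. -/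
def logVelocity (f : ℝ → ℝ) (s : ℝ) : ℝ :=
  (logTerm f s + normalTerm f s + tangentialTerm f s
    - (cos s * (centerVelocity f).1 + sin s * (centerVelocity f).2)) / (1 + f s)

section pointwise

variable {r ρ ρ1 ρ2 c s D : ℝ}

/-- The integrand of the velocity, in terms of the values of the profile. -/
def velDensity (r ρ ρ1 ρ2 c s : ℝ) : ℝ :=
  (-(log (r ^ 2 + ρ ^ 2 - 2 * r * ρ * c) * (-(c * ρ) + 2 * s * ρ1 + c * ρ2) / 2)
    + (r - ρ * c) * (r * c - ρ) / (r ^ 2 + ρ ^ 2 - 2 * r * ρ * c) * (ρ2 - ρ)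
    + 2 * r * ((r - ρ * c) * s / (r ^ 2 + ρ ^ 2 - 2 * r * ρ * c) * ρ1)) / r - ρ * c / (2 * r)

/-- The boundary term produced by the integration by parts that removes `ρ2`. -/
def velBoundary (r ρ ρ1 c s : ℝ) : ℝ :=
  (log (r ^ 2 + ρ ^ 2 - 2 * r * ρ * c) / 2 * (s * ρ + c * ρ1)
    - (r - ρ * c) * (ρ1 * (r * c - ρ) + ρ * r * s) / (r ^ 2 + ρ ^ 2 - 2 * r * ρ * c)) / r - ρ * s / r

/-- The logarithm is an independent variable ℓ here, and the trigonometric functions enter only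
through s² = 1 - c². Differentiating `velBoundary` thus becomes an identity of rational functions.
-/
lemma velDensity_identity (ℓ : ℝ) (hr : 0 < r) (hρ : 0 < ρ) (hs : s ^ 2 = 1 - c ^ 2)
    (hD : D = r ^ 2 + ρ ^ 2 - 2 * r * ρ * c) (hD0 : D ≠ 0) :
    ((-2 * ρ * ρ1 + 2 * r * ρ1 * c + 2 * r * ρ * s) / D / 2 * (s * ρ + c * ρ1)
     + ℓ / 2 * (c * ρ - s * ρ1 - s * ρ1 - c * ρ2)
     - (((ρ1 * c + ρ * s) * (ρ1 * (r * c - ρ) + ρ * r * s)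
         + (r - ρ * c) * (-ρ2 * (r * c - ρ) + ρ1 * (-(r * s) + ρ1) - ρ1 * r * s + ρ * r * c)) * D
        - (r - ρ * c) * (ρ1 * (r * c - ρ) + ρ * r * s)
          * (-2 * ρ * ρ1 + 2 * r * ρ1 * c + 2 * r * ρ * s)) / D ^ 2) / r
     - (-ρ1 * s + ρ * c) / r =
    (-(ℓ * (-(c * ρ) + 2 * s * ρ1 + c * ρ2) / 2) + (r - ρ * c) * (r * c - ρ) / D * (ρ2 - ρ)
       + 2 * r * ((r - ρ * c) * s / D * ρ1)) / r - ρ * c / (2 * r) +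
    ρ / r * ((r ^ 2 - ρ ^ 2) / (2 * r * ρ) *
      ((1 + (2 * r * ρ * s / D) ^ 2 - ((r ^ 2 - ρ ^ 2) / D) ^ 2) / 4 * (1 - (ρ1 / ρ) ^ 2)
      + (r ^ 2 - ρ ^ 2) / D * (2 * r * ρ * s / D) * (ρ1 / ρ)) - c / 2 * (ρ1 / ρ) ^ 2) := by
  rw [← sub_eq_zero]
  field_simp
  rw [hD]
  ring_nf
  simp only [hs]
  ring

/-- For δ = log r - log ρ one has cosh δ - cos α = D / (2rρ), so the hyperbolic kernels become
rational functions of the two radii. -/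
lemma contour_log (hr : 0 < r) (hρ : 0 < ρ) (α p : ℝ)
    (hD : D = r ^ 2 + ρ ^ 2 - 2 * r * ρ * cos α) (hD0 : D ≠ 0) :
    contour (log r - log ρ) α p =
    ρ / r * ((r ^ 2 - ρ ^ 2) / (2 * r * ρ) *
      ((1 + (2 * r * ρ * sin α / D) ^ 2 - ((r ^ 2 - ρ ^ 2) / D) ^ 2) / 4 * (1 - p ^ 2)
      + (r ^ 2 - ρ ^ 2) / D * (2 * r * ρ * sin α / D) * p) - cos α / 2 * p ^ 2) := by
  have e0 : exp (log r - log ρ) = r / ρ := by rw [exp_sub, exp_log hr, exp_log hρ]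
  have e1 : exp (-(log r - log ρ)) = ρ / r := by rw [exp_neg, e0, inv_div]
  have e2 : sinh (log r - log ρ) = (r ^ 2 - ρ ^ 2) / (2 * r * ρ) := by
    rw [sinh_eq, e0, e1]; field_simp
  have e3 : den (log r - log ρ) α = D / (2 * r * ρ) := by
    rw [den, cosh_eq, e0, e1, hD]; field_simp
  have e4 : cothRe (log r - log ρ) α = (r ^ 2 - ρ ^ 2) / D := by
    rw [cothRe, e2, e3]; field_simp
  have e5 : cothIm (log r - log ρ) α = 2 * r * ρ * sin α / D := by
    rw [cothIm, e3]; field_simp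
  unfold contour kerZ kerW kerV cothDer
  rw [e1, e2, e4, e5]
  ring

end pointwise

section derivative

variable {f f1 f2 : ℝ → ℝ}

/-- The velocity integrand is minus the contour integrand up to a total α-derivative. The contour
integrand contains no second derivative of the profile. -/
lemma hasDerivAt_velBoundary (h : IsC2Profile f f1 f2) (hpos : ∀ s, 0 < 1 + f s) (s : ℝ) {α : ℝ}
    (hD0 : chordSq f s α ≠ 0) :
    HasDerivAt (fun α => velBoundary (1 + f s) (1 + f (s - α)) (f1 (s - α)) (cos α) (sin α))
      (velDensity (1 + f s) (1 + f (s - α)) (f1 (s - α)) (f2 (s - α)) (cos α) (sin α)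
        + contourFun (fun s => log (1 + f s)) (fun s => f1 s / (1 + f s)) s α) α := by
  have hρ := (h.hasDerivAt_sub s α).const_add 1
  have hρ1 := h.hasDerivAt_sub1 s α
  have hc := hasDerivAt_cos α
  have hs := hasDerivAt_sin α
  have hD : HasDerivAt (fun α => (1 + f s) ^ 2 + (1 + f (s - α)) ^ 2
      - 2 * (1 + f s) * (1 + f (s - α)) * cos α)
      (-2 * (1 + f (s - α)) * f1 (s - α) + 2 * (1 + f s) * f1 (s - α) * cos α
        + 2 * (1 + f s) * (1 + f (s - α)) * sin α) α := by
    refine (((hρ.pow 2).const_add _).sub ((hρ.const_mul (2 * (1 + f s))).mul hc)).congr_deriv ?_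
    push_cast
    ring
  have hlog := hD.log hD0
  have hY := (hs.mul hρ).add (hc.mul hρ1)
  have hP := (hρ.mul hc).const_sub (1 + f s)
  have hT := (hρ1.mul ((hc.const_mul (1 + f s)).sub hρ)).add ((hρ.mul_const (1 + f s)).mul hs)
  have hB := ((((hlog.div_const 2).mul hY).sub ((hP.mul hT).div hD hD0)).div_const (1 + f s)).sub
    ((hρ.mul hs).div_const (1 + f s))
  refine hB.congr_deriv ?_
  have id := velDensity_identity (ρ1 := f1 (s - α)) (ρ2 := f2 (s - α)) (c := cos α) (s := sin α)
    (log (chordSq f s α)) (hpos s) (hpos (s - α)) (by linarith [sin_sq_add_cos_sq α]) rfl hD0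
  have hcon := contour_log (hpos s) (hpos (s - α)) α (f1 (s - α) / (1 + f (s - α))) rfl hD0
  unfold contourFun velDensity
  rw [hcon]
  unfold chordSq at id
  rw [← id]
  simp only [Pi.mul_apply, Pi.add_apply, Pi.sub_apply]
  congr 1
  congr 1
  congr 1
  · ring
  · congr 1
    ring

end derivative

/-! ### Size of the integrand and of the boundary term near the diagonal. -/

section estimates

variable {M r a b a1 b1 a2 κ c s : ℝ}

lemma abs_log_le_of_mem {x K : ℝ} (hK : 0 < K) (h1 : 1 / K ≤ x) (h2 : x ≤ K) : |log x| ≤ K := by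
  have hx : 0 < x := lt_of_lt_of_le (by positivity) h1
  rw [abs_le]
  constructor
  · have := log_le_sub_one_of_pos (inv_pos.2 hx)
    rw [log_inv] at this
    have h3 : x⁻¹ ≤ K := by
      rw [inv_le_comm₀ hx hK, ← one_div]; exact h1
    linarith
  · linarith [log_le_sub_one_of_pos hx]

lemma one_le_two_div_sqrt (h0 : 0 < κ) (hπ : κ ≤ π) : 1 ≤ 2 * (√κ)⁻¹ := by
  have h : √κ ≤ 2 := by
    rw [sqrt_le_left (by norm_num)]; linarith [pi_lt_d2]
  have := sqrt_pos.2 h0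
  rw [← div_eq_mul_inv, le_div_iff₀ this]
  linarith

/-- The exponent -1/2 is a convenience: one explicit integrable weight dominates both the logarithm
and bounded terms, and it produces the rate √κ. -/
lemma abs_log_le_div_sqrt (h0 : 0 < κ) (hπ : κ ≤ π) : |log κ| ≤ 5 * (√κ)⁻¹ := by
  have h1 := one_le_two_div_sqrt h0 hπ
  rw [abs_le]
  constructor
  · have := log_le_sub_one_of_pos (inv_pos.2 (sqrt_pos.2 h0))
    rw [log_inv, log_sqrt h0.le] at this
    linarith
  · have := log_le_sub_one_of_pos h0
    linarith [pi_lt_d2]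

/-- The position of two nearby points of a curve of class `C¹`. -/
structure NearBounds (M κ r a c s : ℝ) : Prop where
  one_le : 1 ≤ M
  pos : 0 < κ
  le_pi : κ ≤ π
  r_lower : 1 ≤ M * r
  r_upper : r ≤ M
  a_lower : 1 ≤ M * a
  a_upper : a ≤ M
  near : |a - r| ≤ M * κ
  cos_lower : κ ^ 2 ≤ 5 * (1 - c)
  cos_upper : 1 - c ≤ κ ^ 2 / 2
  cos_le : |c| ≤ 1
  sin_le : |s| ≤ κ

namespace NearBounds

lemma M_pos (h : NearBounds M κ r a c s) : 0 < M := by linarith [h.one_le]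
lemma r_pos (h : NearBounds M κ r a c s) : 0 < r := by
  by_contra! hh; nlinarith [h.r_lower, h.M_pos]
lemma a_pos (h : NearBounds M κ r a c s) : 0 < a := by
  by_contra! hh; nlinarith [h.a_lower, h.M_pos]

/-- The chord satisfies D = (r - a)² + 2ra(1 - c), where ra ≥ M⁻² and 1 - c ≥ κ²/5. -/
lemma chord_lower (h : NearBounds M κ r a c s) :
    κ ^ 2 / (3 * M ^ 2) ≤ r ^ 2 + a ^ 2 - 2 * r * a * c := by
  have hM := h.M_pos
  have h1 : 1 * 1 ≤ (M * r) * (M * a) :=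
    mul_le_mul h.r_lower h.a_lower (by norm_num) (mul_pos hM h.r_pos).le
  rw [div_le_iff₀ (by positivity)]
  have h2 : 0 ≤ 1 - c := by nlinarith [h.cos_lower, sq_nonneg κ]
  have h3 : 1 * (1 - c) ≤ (M * r) * (M * a) * (1 - c) := by gcongr; linarith
  have h4 : 0 ≤ (r - a) ^ 2 * M ^ 2 := by positivity
  nlinarith [h.cos_lower]

lemma chord_pos (h : NearBounds M κ r a c s) : 0 < r ^ 2 + a ^ 2 - 2 * r * a * c :=
  lt_of_lt_of_le (div_pos (pow_pos h.pos 2) (by have := h.M_pos; positivity)) h.chord_lower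

lemma chord_upper (h : NearBounds M κ r a c s) :
    r ^ 2 + a ^ 2 - 2 * r * a * c ≤ 2 * M ^ 2 * κ ^ 2 := by
  have hM := h.M_pos
  have h1 : (a - r) ^ 2 ≤ (M * κ) ^ 2 := sq_le_sq.2 (by
    rw [abs_of_pos (mul_pos hM h.pos)]; exact h.near)
  have h2 : 0 ≤ 1 - c := by nlinarith [h.cos_lower, sq_nonneg κ]
  have h3 : r * a * (1 - c) ≤ M * M * (κ ^ 2 / 2) := by
    have := h.r_pos; have := h.a_pos
    gcongr
    · exact h.r_upper
    · exact h.a_upper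
    · exact h.cos_upper
  nlinarith

lemma abs_log_chord (h : NearBounds M κ r a c s) :
    |log (r ^ 2 + a ^ 2 - 2 * r * a * c)| ≤ 16 * M ^ 2 * (√κ)⁻¹ := by
  have hM := h.M_pos
  have hκ := h.pos
  set D := r ^ 2 + a ^ 2 - 2 * r * a * c with hD
  have hl := h.chord_lower
  have hu := h.chord_upper
  rw [← hD] at hl hu
  have h1 : |log (D / κ ^ 2)| ≤ 3 * M ^ 2 := by
    apply abs_log_le_of_mem (by positivity)
    · rw [le_div_iff₀ (by positivity)]
      calc _ = κ ^ 2 / (3 * M ^ 2) := by ring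
        _ ≤ D := hl
    · rw [div_le_iff₀ (by positivity)]
      nlinarith [sq_nonneg (M * κ)]
  have h2 : log D = log (D / κ ^ 2) + 2 * log κ := by
    rw [log_div h.chord_pos.ne' (by positivity), log_pow]; push_cast; ring
  have h3 := abs_log_le_div_sqrt hκ h.le_pi
  have h4 := one_le_two_div_sqrt hκ h.le_pi
  have hM2 : 1 ≤ M ^ 2 := one_le_pow₀ h.one_le
  have h5 : 0 < (√κ)⁻¹ := inv_pos.2 (sqrt_pos.2 hκ)
  rw [h2]
  refine (abs_add_le _ _).trans ?_
  rw [abs_mul, abs_two]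
  have h6 : 3 * M ^ 2 * 1 ≤ 3 * M ^ 2 * (2 * (√κ)⁻¹) := by gcongr
  have h7 : 1 * (√κ)⁻¹ ≤ M ^ 2 * (√κ)⁻¹ := by gcongr
  nlinarith

lemma one_sub_cos_le (h : NearBounds M κ r a c s) : 1 - c ≤ 2 * κ := by
  nlinarith [h.cos_upper, h.le_pi, h.pos, pi_lt_d2]

lemma abs_first (h : NearBounds M κ r a c s) : |r - a * c| ≤ 3 * M * κ := by
  have h2 : 0 ≤ 1 - c := by nlinarith [h.cos_lower, sq_nonneg κ]
  have h1 := abs_le.1 h.near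
  have h3 : a * (1 - c) ≤ M * (2 * κ) :=
    mul_le_mul h.a_upper h.one_sub_cos_le h2 h.M_pos.le
  have h4 : 0 ≤ a * (1 - c) := mul_nonneg h.a_pos.le h2
  rw [abs_le]
  constructor <;> nlinarith [h1.1, h1.2, mul_pos h.M_pos h.pos]

lemma abs_second (h : NearBounds M κ r a c s) : |r * c - a| ≤ 3 * M * κ := by
  have h2 : 0 ≤ 1 - c := by nlinarith [h.cos_lower, sq_nonneg κ]
  have h1 := abs_le.1 h.near
  have h3 : r * (1 - c) ≤ M * (2 * κ) :=
    mul_le_mul h.r_upper h.one_sub_cos_le h2 h.M_pos.le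
  have h4 : 0 ≤ r * (1 - c) := mul_nonneg h.r_pos.le h2
  rw [abs_le]
  constructor <;> nlinarith [h1.1, h1.2, mul_pos h.M_pos h.pos]

lemma abs_r_le (h : NearBounds M κ r a c s) : |r| ≤ M := by
  rw [abs_of_pos h.r_pos]; exact h.r_upper
lemma abs_a_le (h : NearBounds M κ r a c s) : |a| ≤ M := by
  rw [abs_of_pos h.a_pos]; exact h.a_upper
lemma abs_inv_r_le (h : NearBounds M κ r a c s) : |r⁻¹| ≤ M := by
  rw [abs_of_pos (inv_pos.2 h.r_pos), inv_le_iff_one_le_mul₀ h.r_pos]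
  exact h.r_lower
lemma abs_inv_chord_le (h : NearBounds M κ r a c s) :
    |(r ^ 2 + a ^ 2 - 2 * r * a * c)⁻¹| ≤ 3 * M ^ 2 * (κ ^ 2)⁻¹ := by
  have := h.M_pos
  have hκ := h.pos
  rw [abs_of_pos (inv_pos.2 h.chord_pos)]
  refine (inv_anti₀ (by positivity) h.chord_lower).trans (le_of_eq ?_)
  rw [inv_div, div_eq_mul_inv]

/-- In both quotients two numerator factors are O(κ) and cancel D⁻¹ = O(κ⁻²); only the logarithm
remains singular. -/
lemma abs_velDensity (h : NearBounds M κ r a c s) (h1 : |a1| ≤ M) (h2 : |a2| ≤ M) (hs : |s| ≤ 1) :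
    |velDensity r a a1 a2 c s| ≤ 300 * M ^ 7 * (√κ)⁻¹ := by
  have hM := h.M_pos
  have hκ := h.pos
  have hM1 := h.one_le
  have hS : 0 < (√κ)⁻¹ := inv_pos.2 (sqrt_pos.2 hκ)
  have h4 := one_le_two_div_sqrt hκ h.le_pi
  set D := r ^ 2 + a ^ 2 - 2 * r * a * c with hD
  have e : velDensity r a a1 a2 c s = (-(log D * ((-(c * a) + 2 * s * a1 + c * a2) / 2))
    + ((r - a * c) * (r * c - a) * D⁻¹ * (a2 - a)
    + 2 * r * ((r - a * c) * s * D⁻¹ * a1))) * r⁻¹ - a * c * (r⁻¹ * (1 / 2)) := by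
    unfold velDensity
    rw [← hD]
    field_simp
    ring
  have b0 : |(-(c * a) + 2 * s * a1 + c * a2) / 2| ≤ 2 * M := by
    have t1 := abs_le.1 (abs_mul_le_of_le h.cos_le h.abs_a_le)
    have t2 := abs_le.1 (abs_mul_le_of_le hs h1)
    have t3 := abs_le.1 (abs_mul_le_of_le h.cos_le h2)
    rw [abs_le]; constructor <;> linarith [t1.1, t1.2, t2.1, t2.2, t3.1, t3.2]
  have b1 : |-(log D * ((-(c * a) + 2 * s * a1 + c * a2) / 2))| ≤ 16 * M ^ 2 * (√κ)⁻¹ * (2 * M) := by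
    rw [abs_neg]; exact abs_mul_le_of_le h.abs_log_chord b0
  have b2 : |(r - a * c) * (r * c - a) * D⁻¹ * (a2 - a)| ≤ 54 * M ^ 5 := by
    refine (abs_mul_le_of_le (abs_mul_le_of_le (abs_mul_le_of_le h.abs_first h.abs_second)
      h.abs_inv_chord_le) ((abs_sub _ _).trans (add_le_add h2 h.abs_a_le))).trans (le_of_eq ?_)
    field_simp
    ring
  have b3 : |2 * r * ((r - a * c) * s * D⁻¹ * a1)| ≤ 18 * M ^ 5 := by
    refine (abs_mul_le_of_le (abs_mul_le_of_le (abs_two).le h.abs_r_le)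
      (abs_mul_le_of_le (abs_mul_le_of_le (abs_mul_le_of_le h.abs_first h.sin_le)
      h.abs_inv_chord_le) h1)).trans (le_of_eq ?_)
    field_simp
    ring
  have b4 : |a * c * (r⁻¹ * (1 / 2))| ≤ M * 1 * (M * (1 / 2)) :=
    abs_mul_le_of_le (abs_mul_le_of_le h.abs_a_le h.cos_le)
      (abs_mul_le_of_le h.abs_inv_r_le (by norm_num))
  rw [e]
  refine (abs_sub _ _).trans ((add_le_add (abs_mul_le_of_le ((abs_add_le _ _).trans
    (add_le_add b1 ((abs_add_le _ _).trans (add_le_add b2 b3)))) h.abs_inv_r_le) b4).trans ?_)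
  have p1 : M ^ 4 ≤ M ^ 7 := pow_le_pow_right₀ hM1 (by norm_num)
  have p2 : M ^ 6 ≤ M ^ 7 := pow_le_pow_right₀ hM1 (by norm_num)
  have p3 : M ^ 2 ≤ M ^ 7 := pow_le_pow_right₀ hM1 (by norm_num)
  have q1 : M ^ 4 * (√κ)⁻¹ ≤ M ^ 7 * (√κ)⁻¹ := by gcongr
  have q2 : M ^ 7 * 1 ≤ M ^ 7 * (2 * (√κ)⁻¹) := by gcongr
  nlinarith

set_option maxHeartbeats 1000000 in
-- The boundary terms at α = κ and α = -κ are compared; neither is small by itself. The factors P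
-- and T of the quotient are odd to leading order, so P + P' and T + T' are O(κ²), while D - D' =
-- O(κ³) because the second difference of the profile is O(κ²). The slowest part is log D' · (Y -
-- Y'), of order κ^{-1/2} · κ.
lemma abs_velBoundary_sub (h : NearBounds M κ r a c s) (h' : NearBounds M κ r b c s)
    (ha1 : |a1| ≤ M) (hb1 : |b1| ≤ M) (hab : |a + b - 2 * r| ≤ 2 * M * κ ^ 2)
    (hab1 : |a1 - b1| ≤ 2 * M * κ) :
    |velBoundary r a a1 c s - velBoundary r b b1 c (-s)| ≤ 2000 * M ^ 10 * √κ := by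
  have hM := h.M_pos
  have hκ := h.pos
  have hM1 := h.one_le
  have hS : 0 < √κ := sqrt_pos.2 hκ
  have hκS : κ ≤ 2 * √κ := by
    have h4 := one_le_two_div_sqrt hκ h.le_pi
    have : κ = √κ * √κ := (mul_self_sqrt hκ.le).symm
    have h5 : √κ * 1 ≤ √κ * (2 * (√κ)⁻¹) := by gcongr
    have h6 : √κ * (2 * (√κ)⁻¹) = 2 := by field_simp
    nlinarith
  have hc2 : 0 ≤ 1 - c := by nlinarith [h.cos_lower, sq_nonneg κ]
  have hL : |1 - c| ≤ κ ^ 2 / 2 := by rw [abs_of_nonneg hc2]; exact h.cos_upper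
  have hab0 : |a - b| ≤ 2 * M * κ := by
    have t1 := abs_le.1 h.near
    have t2 := abs_le.1 h'.near
    rw [abs_le]; constructor <;> linarith
  set D := r ^ 2 + a ^ 2 - 2 * r * a * c with hD
  set D' := r ^ 2 + b ^ 2 - 2 * r * b * c with hD'
  have hDD : |D - D'| ≤ 6 * M ^ 2 * κ ^ 3 := by
    have : D - D' = (a - b) * (a + b - 2 * r) + 2 * r * (a - b) * (1 - c) := by
      rw [hD, hD']; ring
    rw [this]
    refine (abs_add_le _ _).trans ((add_le_add (abs_mul_le_of_le hab0 hab) (abs_mul_le_of_le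
      (abs_mul_le_of_le (abs_mul_le_of_le abs_two.le h.abs_r_le) hab0) hL)).trans (le_of_eq ?_))
    ring
  have hlog : |log D - log D'| ≤ 18 * M ^ 4 * κ := by
    have key : ∀ x y : ℝ, 0 < x → 0 < y → |y⁻¹| ≤ 3 * M ^ 2 * (κ ^ 2)⁻¹ → |x - y| ≤ 6 * M ^ 2 * κ ^ 3 →
        log x - log y ≤ 18 * M ^ 4 * κ := by
      intro x y hx hy hy' hxy
      rw [← log_div hx.ne' hy.ne']
      refine (log_le_sub_one_of_pos (div_pos hx hy)).trans ?_
      have : x / y - 1 = (x - y) * y⁻¹ := by field_simp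
      rw [this]
      refine (le_abs_self _).trans ((abs_mul_le_of_le hxy hy').trans (le_of_eq ?_))
      field_simp
      ring
    rw [abs_le]
    constructor
    · have := key D' D h'.chord_pos h.chord_pos h.abs_inv_chord_le (by rw [abs_sub_comm]; exact hDD)
      linarith
    · exact key D D' h.chord_pos h'.chord_pos h'.abs_inv_chord_le hDD
  set Y := s * a + c * a1 with hY
  set Y' := -s * b + c * b1 with hY'
  have hY0 : |Y| ≤ 5 * M := by
    refine (abs_add_le _ _).trans ((add_le_add (abs_mul_le_of_le h.sin_le h.abs_a_le)
      (abs_mul_le_of_le h.cos_le ha1)).trans ?_)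
    nlinarith [h.le_pi, pi_lt_d2]
  have hYY : |Y - Y'| ≤ 4 * M * κ := by
    have : Y - Y' = s * (a + b) + c * (a1 - b1) := by rw [hY, hY']; ring
    rw [this]
    refine (abs_add_le _ _).trans ((add_le_add (abs_mul_le_of_le h.sin_le ((abs_add_le _ _).trans
      (add_le_add h.abs_a_le h'.abs_a_le))) (abs_mul_le_of_le h.cos_le hab1)).trans (le_of_eq ?_))
    ring
  set P := r - a * c with hP
  set P' := r - b * c with hP'
  set T := a1 * (r * c - a) + a * r * s with hT
  set T' := b1 * (r * c - b) + b * r * -s with hT'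
  have hPP : |P + P'| ≤ 3 * M * κ ^ 2 := by
    have : P + P' = (a + b) * (1 - c) - (a + b - 2 * r) := by rw [hP, hP']; ring
    rw [this]
    refine (abs_sub _ _).trans ((add_le_add (abs_mul_le_of_le ((abs_add_le _ _).trans
      (add_le_add h.abs_a_le h'.abs_a_le)) hL) hab).trans (le_of_eq ?_))
    ring
  have hT'0 : |T'| ≤ 4 * M ^ 2 * κ := by
    refine (abs_add_le _ _).trans ((add_le_add (abs_mul_le_of_le hb1 h'.abs_second)
      (abs_mul_le_of_le (abs_mul_le_of_le h'.abs_a_le h.abs_r_le) ((abs_neg s).le.trans h.sin_le))).trans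
      (le_of_eq ?_))
    ring
  have hTT : |T + T'| ≤ 11 * M ^ 2 * κ ^ 2 := by
    have : T + T' = (a1 - b1) * (r * c - a) + b1 * (-(2 * r * (1 - c)) - (a + b - 2 * r))
        + r * s * (a - b) := by rw [hT, hT']; ring
    rw [this]
    have t1 : |-(2 * r * (1 - c)) - (a + b - 2 * r)| ≤ 2 * M * (κ ^ 2 / 2) + 2 * M * κ ^ 2 := by
      refine (abs_sub _ _).trans (add_le_add ?_ hab)
      rw [abs_neg]
      exact abs_mul_le_of_le (abs_mul_le_of_le abs_two.le h.abs_r_le) hL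
    refine (abs_add_le _ _).trans ((add_le_add ((abs_add_le _ _).trans (add_le_add
      (abs_mul_le_of_le hab1 h.abs_second) (abs_mul_le_of_le hb1 t1)))
      (abs_mul_le_of_le (abs_mul_le_of_le h.abs_r_le h.sin_le) hab0)).trans (le_of_eq ?_))
    ring
  have e : velBoundary r a a1 c s - velBoundary r b b1 c (-s) =
      ((((log D - log D') * Y + log D' * (Y - Y')) * (1 / 2))
        - ((P * (T + T') - T' * (P + P')) * D⁻¹ + P' * T' * (D' - D) * D⁻¹ * D'⁻¹)
        - s * (a + b)) * r⁻¹ := by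
    have hd := h.chord_pos.ne'
    have hd' := h'.chord_pos.ne'
    have hr := h.r_pos.ne'
    rw [← hD] at hd
    rw [← hD'] at hd'
    unfold velBoundary
    rw [← hD, ← hD', ← hP, ← hP', ← hT, ← hT', ← hY, ← hY']
    field_simp
    ring
  have b1 : |((log D - log D') * Y + log D' * (Y - Y')) * (1 / 2)| ≤
      (18 * M ^ 4 * κ * (5 * M) + 16 * M ^ 2 * (√κ)⁻¹ * (4 * M * κ)) * (1 / 2) :=
    abs_mul_le_of_le ((abs_add_le _ _).trans (add_le_add (abs_mul_le_of_le hlog hY0)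
      (abs_mul_le_of_le h'.abs_log_chord hYY))) (by norm_num)
  have b2 : |(P * (T + T') - T' * (P + P')) * D⁻¹| ≤
      (3 * M * κ * (11 * M ^ 2 * κ ^ 2) + 4 * M ^ 2 * κ * (3 * M * κ ^ 2)) * (3 * M ^ 2 * (κ ^ 2)⁻¹) :=
    abs_mul_le_of_le ((abs_sub _ _).trans (add_le_add (abs_mul_le_of_le h.abs_first hTT)
      (abs_mul_le_of_le hT'0 hPP))) h.abs_inv_chord_le
  have b3 : |P' * T' * (D' - D) * D⁻¹ * D'⁻¹| ≤ 3 * M * κ * (4 * M ^ 2 * κ) * (6 * M ^ 2 * κ ^ 3)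
      * (3 * M ^ 2 * (κ ^ 2)⁻¹) * (3 * M ^ 2 * (κ ^ 2)⁻¹) :=
    abs_mul_le_of_le (abs_mul_le_of_le (abs_mul_le_of_le (abs_mul_le_of_le h'.abs_first hT'0)
      (by rw [abs_sub_comm]; exact hDD)) h.abs_inv_chord_le) h'.abs_inv_chord_le
  have b4 : |s * (a + b)| ≤ κ * (M + M) :=
    abs_mul_le_of_le h.sin_le ((abs_add_le _ _).trans (add_le_add h.abs_a_le h'.abs_a_le))
  rw [e]
  refine (abs_mul_le_of_le ((abs_sub _ _).trans (add_le_add ((abs_sub _ _).trans (add_le_add b1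
    ((abs_add_le _ _).trans (add_le_add b2 b3)))) b4)) h.abs_inv_r_le).trans ?_
  have e2 : (√κ)⁻¹ * κ = √κ := by
    rw [inv_mul_eq_div, div_sqrt]
  have e3 : ((18 * M ^ 4 * κ * (5 * M) + 16 * M ^ 2 * (√κ)⁻¹ * (4 * M * κ)) * (1 / 2) +
      ((3 * M * κ * (11 * M ^ 2 * κ ^ 2) + 4 * M ^ 2 * κ * (3 * M * κ ^ 2)) * (3 * M ^ 2 * (κ ^ 2)⁻¹) +
      3 * M * κ * (4 * M ^ 2 * κ) * (6 * M ^ 2 * κ ^ 3) * (3 * M ^ 2 * (κ ^ 2)⁻¹) * (3 * M ^ 2 * (κ ^ 2)⁻¹))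
      + κ * (M + M)) * M =
      45 * M ^ 6 * κ + 32 * M ^ 4 * √κ + 135 * M ^ 6 * κ + 648 * M ^ 10 * κ + 2 * M ^ 2 * κ := by
    have e5 : κ ^ 2 * (κ ^ 2)⁻¹ = 1 := mul_inv_cancel₀ (by positivity)
    linear_combination 32 * M ^ 4 * e2
      + (135 * M ^ 6 * κ + 648 * M ^ 10 * κ * (κ ^ 2 * (κ ^ 2)⁻¹ + 1)) * e5
  rw [e3]
  have p1 : M ^ 4 * √κ ≤ M ^ 10 * √κ := by
    gcongr ?_ * _; exact pow_le_pow_right₀ hM1 (by norm_num)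
  have p2 : M ^ 6 * κ ≤ M ^ 10 * (2 * √κ) := by
    exact mul_le_mul (pow_le_pow_right₀ hM1 (by norm_num)) hκS hκ.le (by positivity)
  have p3 : M ^ 2 * κ ≤ M ^ 10 * (2 * √κ) := by
    exact mul_le_mul (pow_le_pow_right₀ hM1 (by norm_num)) hκS hκ.le (by positivity)
  have p4 : M ^ 10 * κ ≤ M ^ 10 * (2 * √κ) := by gcongr
  have p5 : 0 ≤ M ^ 10 * √κ := by positivity
  nlinarith

end NearBounds

end estimates

namespace NearBounds

variable {M r a κ c s : ℝ}

lemma abs_normal_quotient (h : NearBounds M κ r a c s) :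
    |(r - a * c) * (r * c - a) / (r ^ 2 + a ^ 2 - 2 * r * a * c)| ≤ 27 * M ^ 4 := by
  have hκ := h.pos
  rw [div_eq_mul_inv]
  refine (abs_mul_le_of_le (abs_mul_le_of_le h.abs_first h.abs_second)
    h.abs_inv_chord_le).trans (le_of_eq ?_)
  field_simp
  ring

lemma abs_tangential_quotient (h : NearBounds M κ r a c s) :
    |(r - a * c) * s / (r ^ 2 + a ^ 2 - 2 * r * a * c)| ≤ 9 * M ^ 3 := by
  have hκ := h.pos
  rw [div_eq_mul_inv]
  refine (abs_mul_le_of_le (abs_mul_le_of_le h.abs_first h.sin_le)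
    h.abs_inv_chord_le).trans (le_of_eq ?_)
  field_simp
  ring

end NearBounds

/-! ### Symmetric and periodic integrals, and continuity of the integrands. -/

section integrals

lemma intervalIntegrable_inv_sqrt (a b : ℝ) (ha : 0 ≤ a) (hb : 0 ≤ b) :
    IntervalIntegrable (fun α : ℝ => (√α)⁻¹) volume a b := by
  refine (intervalIntegral.intervalIntegrable_rpow' (r := -(1 / 2)) (by norm_num)).congr ?_
  intro x hx
  have hx0 : 0 ≤ x := (le_min ha hb).trans (le_of_lt hx.1)
  simp only [sqrt_eq_rpow, rpow_neg hx0]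

lemma integral_inv_sqrt {κ : ℝ} (hκ : 0 ≤ κ) : ∫ α in (0 : ℝ)..κ, (√α)⁻¹ = 2 * √κ := by
  have : ∫ α in (0 : ℝ)..κ, (√α)⁻¹ = ∫ α in (0 : ℝ)..κ, α ^ (-(1 / 2) : ℝ) := by
    apply intervalIntegral.integral_congr
    intro x hx
    rw [uIcc_of_le hκ] at hx
    simp only [sqrt_eq_rpow, rpow_neg hx.1]
  rw [this, integral_rpow (Or.inl (by norm_num)), sqrt_eq_rpow]
  norm_num
  ring

lemma intervalIntegrable_of_abs_le_inv_sqrt {F : ℝ → ℝ} {C b : ℝ} (hb : 0 ≤ b)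
    (hm : Measurable F) (h : ∀ α, 0 < α → α ≤ b → |F α| ≤ C * (√α)⁻¹) :
    IntervalIntegrable F volume 0 b := by
  refine ((intervalIntegrable_inv_sqrt 0 b le_rfl hb).const_mul C).mono_fun' hm.aestronglyMeasurable ?_
  rw [uIoc_of_le hb]
  exact (ae_restrict_iff' measurableSet_Ioc).2 (ae_of_all _ fun x hx => h x hx.1 hx.2)

lemma intervalIntegrable_neg_iff {F : ℝ → ℝ} {b : ℝ} :
    IntervalIntegrable F volume (-b) 0 ↔ IntervalIntegrable (fun α => F (-α)) volume 0 b := by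
  rw [IntervalIntegrable.iff_comp_neg, neg_neg, neg_zero]
  exact ⟨IntervalIntegrable.symm, IntervalIntegrable.symm⟩

lemma integral_symm_interval {F : ℝ → ℝ} {b : ℝ} (h1 : IntervalIntegrable F volume 0 b)
    (h2 : IntervalIntegrable (fun α => F (-α)) volume 0 b) :
    ∫ α in (-b)..b, F α = ∫ α in (0 : ℝ)..b, (F α + F (-α)) := by
  rw [intervalIntegral.integral_add h1 h2, intervalIntegral.integral_comp_neg, neg_zero, add_comm,
    intervalIntegral.integral_add_adjacent_intervals (intervalIntegrable_neg_iff.2 h2) h1]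

lemma integral_circleMeasure (F : ℝ → ℝ) : ∫ α, F α ∂circleMeasure = ∫ α in (-π)..π, F α := by
  rw [circleMeasure, intervalIntegral.integral_of_le (by linarith [pi_pos])]

lemma integral_period_sub {g : ℝ → ℝ} (hg : Function.Periodic g (2 * π)) (s : ℝ) :
    ∫ α in (-π)..π, g (s - α) = ∫ α in (-π)..π, g α := by
  rw [intervalIntegral.integral_comp_sub_left]
  have := hg.intervalIntegral_add_eq (s - π) (-π)
  rw [show s - -π = s - π + 2 * π by ring, this, show -π + 2 * π = π by ring]

end integrals

section continuity

lemma continuousOn_contour {X : Type*} [TopologicalSpace X] {S : Set X} {d a p : X → ℝ}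
    (hd : ContinuousOn d S) (ha : ContinuousOn a S) (hp : ContinuousOn p S)
    (h : ∀ z ∈ S, den (d z) (a z) ≠ 0) :
    ContinuousOn (fun z => contour (d z) (a z) (p z)) S := by
  unfold contour kerZ kerW kerV cothDer cothRe cothIm
  unfold den at *
  fun_prop (disch := assumption)

lemma continuousOn_linKer {X : Type*} [TopologicalSpace X] {S : Set X} {d a p q : X → ℝ}
    (hd : ContinuousOn d S) (ha : ContinuousOn a S) (hp : ContinuousOn p S) (hq : ContinuousOn q S)
    (h : ∀ z ∈ S, den (d z) (a z) ≠ 0) :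
    ContinuousOn (fun z => linKer (d z) (a z) (p z) (q z)) S := by
  unfold linKer kerZδ kerZα kerVδ kerVα kerWα cothDer cothRe cothIm
  unfold den at *
  fun_prop (disch := assumption)

end continuity

/-! ### The contour equation with an explicit truncation error. -/

variable {f f1 f2 : ℝ → ℝ}

lemma IsC2Profile.log_one_add (h : IsC2Profile f f1 f2) (hpos : ∀ s, 0 < 1 + f s) :
    IsC2Profile (fun s => log (1 + f s)) (fun s => f1 s / (1 + f s))
      (fun s => f2 s / (1 + f s) - (f1 s / (1 + f s)) ^ 2) where
  per s := by simp only [h.per s]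
  d1 s := ((h.d1 s).const_add 1).log (hpos s).ne'
  d2 s := by
    refine ((h.d2 s).div ((h.d1 s).const_add 1) (hpos s).ne').congr_deriv ?_
    have := (hpos s).ne'
    field_simp
  cont2 := by
    have h0 := h.cont
    have h1 := h.cont1
    have h2 := h.cont2
    have := fun s => (hpos s).ne'
    fun_prop (disch := assumption)

lemma continuousOn_contourFun (h : IsC2Profile f f1 f2) (s : ℝ) {κ : ℝ} (hκ : 0 < κ) :
    ContinuousOn (fun α => contourFun f f1 s α) (Icc κ π) ∧
    ContinuousOn (fun α => contourFun f f1 s (-α)) (Icc κ π) := by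
  have h0 := h.cont
  have h1 := h.cont1
  constructor
  · refine continuousOn_contour (by fun_prop) (by fun_prop) (by fun_prop) fun α hα => ?_
    have h3 := hκ.trans_le hα.1
    exact (den_pos _ (abs_le.2 ⟨by linarith [pi_pos], hα.2⟩) h3.ne').ne'
  · refine continuousOn_contour (by fun_prop) (by fun_prop) (by fun_prop) fun α hα => ?_
    have h3 := hκ.trans_le hα.1
    exact (den_pos _ (abs_le.2 ⟨by linarith [hα.2], by linarith [pi_pos]⟩) (by linarith)).ne'

lemma intervalIntegrable_contourFun (h : IsC2Profile f f1 f2) (s : ℝ) {κ : ℝ} (hκ : 0 < κ)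
    (hπ : κ ≤ π) :
    IntervalIntegrable (fun α => contourFun f f1 s α + contourFun f f1 s (-α)) volume κ π := by
  have := continuousOn_contourFun h s hκ
  apply ContinuousOn.intervalIntegrable
  rw [uIcc_of_le hπ]
  exact this.1.add this.2

/-- Uniform bounds on a profile `1 + f` and on its first two derivatives. -/
structure ProfileBounds (M : ℝ) (f f1 f2 : ℝ → ℝ) : Prop where
  one_le : 1 ≤ M
  lower : ∀ s, 1 ≤ M * (1 + f s)
  upper : ∀ s, 1 + f s ≤ M
  first : ∀ s, |f1 s| ≤ M
  second : ∀ s, |f2 s| ≤ M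

lemma ProfileBounds.pos {M : ℝ} (h : ProfileBounds M f f1 f2) (s : ℝ) : 0 < 1 + f s := by
  by_contra! hh
  nlinarith [h.lower s, h.one_le]

lemma ProfileBounds.near {M : ℝ} (hb : ProfileBounds M f f1 f2) (h : IsC2Profile f f1 f2) (s : ℝ)
    {α : ℝ} (h0 : α ≠ 0) (hπ : |α| ≤ π) :
    NearBounds M |α| (1 + f s) (1 + f (s - α)) (cos α) (sin α) where
  one_le := hb.one_le
  pos := abs_pos.2 h0
  le_pi := hπ
  r_lower := hb.lower s
  r_upper := hb.upper s
  a_lower := hb.lower _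
  a_upper := hb.upper _
  near := by
    have := h.abs_sub_le hb.first (s - α) s
    rw [show s - α - s = -α by ring, abs_neg] at this
    rwa [add_sub_add_left_eq_sub]
  cos_lower := by rw [sq_abs]; exact sq_le_five_mul_one_sub_cos hπ
  cos_upper := by rw [sq_abs]; linarith [one_sub_sq_div_two_le_cos (x := α)]
  cos_le := abs_cos_le_one α
  sin_le := abs_sin_le_abs

/-- The integrand of the velocity for the profile `f`. -/
def velFun (f f1 f2 : ℝ → ℝ) (s α : ℝ) : ℝ :=
  velDensity (1 + f s) (1 + f (s - α)) (f1 (s - α)) (f2 (s - α)) (cos α) (sin α)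

lemma abs_velFun_le {M : ℝ} (hb : ProfileBounds M f f1 f2) (h : IsC2Profile f f1 f2) (s : ℝ)
    {α : ℝ} (h0 : α ≠ 0) (hπ : |α| ≤ π) : |velFun f f1 f2 s α| ≤ 300 * M ^ 7 * (√|α|)⁻¹ :=
  (hb.near h s h0 hπ).abs_velDensity (hb.first _) (hb.second _) (abs_sin_le_one α)

lemma measurable_velFun (h : IsC2Profile f f1 f2) (s : ℝ) : Measurable (velFun f f1 f2 s) := by
  have m0 : Measurable f := h.cont.measurable
  have m1 : Measurable f1 := h.cont1.measurable
  have m2 : Measurable f2 := h.cont2.measurable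
  unfold velFun velDensity
  fun_prop

lemma intervalIntegrable_velFun {M : ℝ} (hb : ProfileBounds M f f1 f2) (h : IsC2Profile f f1 f2)
    (s : ℝ) : IntervalIntegrable (velFun f f1 f2 s) volume 0 π ∧
      IntervalIntegrable (fun α => velFun f f1 f2 s (-α)) volume 0 π := by
  have hm := measurable_velFun h s
  constructor
  · refine intervalIntegrable_of_abs_le_inv_sqrt (C := 300 * M ^ 7) pi_pos.le hm fun α h0 h1 => ?_
    have := abs_velFun_le hb h s (α := α) h0.ne' (by rwa [abs_of_pos h0])
    rwa [abs_of_pos h0] at this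
  · refine intervalIntegrable_of_abs_le_inv_sqrt (C := 300 * M ^ 7) pi_pos.le (hm.comp measurable_neg)
      fun α h0 h1 => ?_
    have := abs_velFun_le hb h s (α := -α) (by linarith) (by rwa [abs_neg, abs_of_pos h0])
    rwa [abs_neg, abs_of_pos h0] at this

lemma iteratedDeriv_two_cos_mul (h : IsC2Profile f f1 f2) (s α : ℝ) :
    iteratedDeriv 2 (fun β => cos β * (1 + f (s - β))) α =
      -(cos α * (1 + f (s - α))) + 2 * sin α * f1 (s - α) + cos α * f2 (s - α) := by
  have h1 : deriv (fun β => cos β * (1 + f (s - β))) =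
      fun β => -sin β * (1 + f (s - β)) + cos β * -f1 (s - β) := by
    ext β
    exact ((hasDerivAt_cos β).mul ((h.hasDerivAt_sub s β).const_add 1)).deriv
  rw [iteratedDeriv_succ, iteratedDeriv_one, h1]
  have h2 := ((hasDerivAt_sin α).neg.mul ((h.hasDerivAt_sub s α).const_add 1)).add
    ((hasDerivAt_cos α).mul (h.hasDerivAt_sub1 s α).neg)
  refine (HasDerivAt.deriv h2).trans ?_
  simp only [Pi.neg_apply]
  ring

lemma IsC2Profile.deriv_eq (h : IsC2Profile f f1 f2) : deriv f = f1 :=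
  funext fun s => (h.d1 s).deriv

lemma IsC2Profile.iteratedDeriv_two_eq (h : IsC2Profile f f1 f2) : iteratedDeriv 2 f = f2 := by
  rw [iteratedDeriv_succ, iteratedDeriv_one, h.deriv_eq]
  exact funext fun s => (h.d2 s).deriv

lemma integral_cos_circle : ∫ α in (-π)..π, cos α = 0 := by simp

/-- The left side is the convolution of f with the cosine. Since the cosine has mean zero, f may be
replaced by 1 + f, which fits the velocity integrand. -/
lemma centerVelocity_eq (h : IsC2Profile f f1 f2) (s : ℝ) :
    cos s * (centerVelocity f).1 + sin s * (centerVelocity f).2 =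
      1 / (8 * π) * ∫ α in (-π)..π, (1 + f (s - α)) * cos α := by
  have h0 := h.cont
  have e1 : ∫ α in (-π)..π, (1 + f (s - α)) * cos α = ∫ α in (-π)..π, f α * cos (s - α) := by
    have hp : Function.Periodic (fun x => f x * cos (s - x)) (2 * π) := by
      intro x
      simp only [h.per x]
      rw [show s - (x + 2 * π) = s - x - 2 * π by ring, cos_sub_two_pi]
    rw [← integral_period_sub hp s]
    simp only [sub_sub_cancel, add_mul, one_mul]
    rw [intervalIntegral.integral_add (Continuous.intervalIntegrable (by fun_prop) _ _)
      (Continuous.intervalIntegrable (by fun_prop) _ _), integral_cos_circle, zero_add]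
  have e2 : ∫ α in (-π)..π, f α * cos (s - α) =
      cos s * (∫ α in (-π)..π, f α * cos α) + sin s * (∫ α in (-π)..π, f α * sin α) := by
    rw [← intervalIntegral.integral_const_mul, ← intervalIntegral.integral_const_mul,
      ← intervalIntegral.integral_add (Continuous.intervalIntegrable (by fun_prop) _ _)
      (Continuous.intervalIntegrable (by fun_prop) _ _)]
    congr 1 with α
    rw [cos_sub]
    ring
  rw [e1, e2]
  simp only [centerVelocity, integral_circleMeasure]
  have := pi_ne_zero
  field_simp
  ring

lemma intervalIntegrable_circle_of_bound {F : ℝ → ℝ} {C : ℝ} (hm : Measurable F)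
    (h : ∀ α, α ≠ 0 → |α| ≤ π → |F α| ≤ C * (√|α|)⁻¹) : IntervalIntegrable F volume (-π) π := by
  refine IntervalIntegrable.trans (b := 0) (intervalIntegrable_neg_iff.2 ?_) ?_
  · refine intervalIntegrable_of_abs_le_inv_sqrt (C := C) pi_pos.le (hm.comp measurable_neg)
      fun α h0 h1 => ?_
    have := h (-α) (by linarith) (by rwa [abs_neg, abs_of_pos h0])
    rwa [abs_neg, abs_of_pos h0] at this
  · refine intervalIntegrable_of_abs_le_inv_sqrt (C := C) pi_pos.le hm fun α h0 h1 => ?_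
    have := h α h0.ne' (by rwa [abs_of_pos h0])
    rwa [abs_of_pos h0] at this

lemma logVelocity_eq {M : ℝ} (hb : ProfileBounds M f f1 f2) (h : IsC2Profile f f1 f2) (s : ℝ) :
    4 * π * logVelocity f s = ∫ α in (-π)..π, velFun f f1 f2 s α := by
  have c0 := h.cont
  have m0 : Measurable f := h.cont.measurable
  have m1 : Measurable f1 := h.cont1.measurable
  have m2 : Measurable f2 := h.cont2.measurable
  have hM0 : 0 ≤ M := by linarith [hb.one_le]
  set D : ℝ → ℝ := fun α => (1 + f s) ^ 2 + (1 + f (s - α)) ^ 2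
    - 2 * (1 + f s) * (1 + f (s - α)) * cos α with hD
  have hw : ∀ {α : ℝ}, α ≠ 0 → |α| ≤ π → 1 ≤ 2 * (√|α|)⁻¹ := fun h0 hπ =>
    one_le_two_div_sqrt (abs_pos.2 h0) hπ
  -- Bounded integrands are put under the same weight |α|^{-1/2} as the logarithmic one.
  have hle : ∀ {x B w : ℝ}, 1 ≤ 2 * w → |x| ≤ B → |x| ≤ 2 * B * w := by
    intro x B w hw hx
    have : 0 ≤ B := (abs_nonneg x).trans hx
    nlinarith
  have hr0 := (hb.pos s).ne'
  have iA : IntervalIntegrable (fun α => log (D α) *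
      (-(cos α * (1 + f (s - α))) + 2 * sin α * f1 (s - α) + cos α * f2 (s - α))) volume (-π) π := by
    refine intervalIntegrable_circle_of_bound (C := 16 * M ^ 2 * (4 * M)) (by fun_prop) fun α h0 hπ => ?_
    have nb := hb.near h s h0 hπ
    have t1 := abs_le.1 (abs_mul_le_of_le nb.cos_le nb.abs_a_le)
    have t2 := abs_le.1 (abs_mul_le_of_le (abs_sin_le_one α) (hb.first (s - α)))
    have t3 := abs_le.1 (abs_mul_le_of_le nb.cos_le (hb.second (s - α)))
    refine (abs_mul_le_of_le nb.abs_log_chord (B := 4 * M) ?_).trans (le_of_eq (by ring))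
    rw [abs_le]; constructor <;> linarith [t1.1, t1.2, t2.1, t2.2, t3.1, t3.2]
  have iB : IntervalIntegrable (fun α => ((1 + f s - (1 + f (s - α)) * cos α) *
      ((1 + f s) * cos α - (1 + f (s - α))) / D α) * (f2 (s - α) - 1 - f (s - α))) volume (-π) π := by
    refine intervalIntegrable_circle_of_bound (C := 2 * (27 * M ^ 4 * (M + M))) (by fun_prop) fun α h0 hπ => ?_
    have nb := hb.near h s h0 hπ
    refine hle (hw h0 hπ) (abs_mul_le_of_le nb.abs_normal_quotient ?_)
    rw [sub_sub]
    exact (abs_sub _ _).trans (add_le_add (hb.second _) nb.abs_a_le)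
  have iC : IntervalIntegrable (fun α => ((1 + f s - (1 + f (s - α)) * cos α) * sin α / D α)
      * f1 (s - α)) volume (-π) π := by
    refine intervalIntegrable_circle_of_bound (C := 2 * (9 * M ^ 3 * M)) (by fun_prop) fun α h0 hπ => ?_
    exact hle (hw h0 hπ) (abs_mul_le_of_le (hb.near h s h0 hπ).abs_tangential_quotient (hb.first _))
  have iE : IntervalIntegrable (fun α => (1 + f (s - α)) * cos α) volume (-π) π :=
    Continuous.intervalIntegrable (by fun_prop) _ _
  unfold logVelocity
  rw [centerVelocity_eq h]
  unfold logTerm normalTerm tangentialTerm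
  simp only [integral_circleMeasure, h.deriv_eq, h.iteratedDeriv_two_eq, iteratedDeriv_two_cos_mul h,
    chordSq]
  have e : ∀ α, velFun f f1 f2 s α =
      (-(1 / 2) * (1 + f s)⁻¹) * (log (D α) *
        (-(cos α * (1 + f (s - α))) + 2 * sin α * f1 (s - α) + cos α * f2 (s - α)))
      + (1 + f s)⁻¹ * (((1 + f s - (1 + f (s - α)) * cos α) *
        ((1 + f s) * cos α - (1 + f (s - α))) / D α) * (f2 (s - α) - 1 - f (s - α)))
      + 2 * (((1 + f s - (1 + f (s - α)) * cos α) * sin α / D α) * f1 (s - α))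
      - (1 / 2 * (1 + f s)⁻¹) * ((1 + f (s - α)) * cos α) := by
    intro α
    unfold velFun velDensity
    simp only [hD]
    field_simp
    ring
  simp_rw [e]
  rw [intervalIntegral.integral_sub (((iA.const_mul _).add (iB.const_mul _)).add (iC.const_mul _))
    (iE.const_mul _), intervalIntegral.integral_add ((iA.const_mul _).add (iB.const_mul _))
    (iC.const_mul _), intervalIntegral.integral_add (iA.const_mul _) (iB.const_mul _)]
  simp only [intervalIntegral.integral_const_mul]
  have := pi_ne_zero
  simp only [hD]
  field_simp
  ring_nf

/-- The contour equation, with a rate of convergence of the truncated integrals. -/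
theorem abs_logVelocity_add_contourInt_le {M : ℝ} (hb : ProfileBounds M f f1 f2)
    (h : IsC2Profile f f1 f2) (s : ℝ) {κ : ℝ} (h0 : 0 < κ) (hπ : κ ≤ π) :
    |4 * π * logVelocity f s + contourInt (fun s => log (1 + f s)) (fun s => f1 s / (1 + f s)) κ s|
      ≤ 3200 * M ^ 10 * √κ := by
  have hu := h.log_one_add hb.pos
  set u := fun s => log (1 + f s)
  set u1 := fun s => f1 s / (1 + f s)
  obtain ⟨i1, i2⟩ := intervalIntegrable_velFun hb h s
  have i3 := i1.add i2
  have hsub : uIcc κ π ⊆ uIcc 0 π := by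
    rw [uIcc_of_le hπ, uIcc_of_le pi_pos.le]; exact Icc_subset_Icc_left h0.le
  have hsub' : uIcc 0 κ ⊆ uIcc 0 π := by
    rw [uIcc_of_le h0.le, uIcc_of_le pi_pos.le]; exact Icc_subset_Icc_right hπ
  have i4 := i3.mono_set hsub
  have i4' := i3.mono_set hsub'
  have i5 := intervalIntegrable_contourFun hu s h0 hπ
  set B : ℝ → ℝ := fun α => velBoundary (1 + f s) (1 + f (s - α)) (f1 (s - α)) (cos α) (sin α) with hB
  have hd : ∀ α, α ≠ 0 → |α| ≤ π → HasDerivAt B (velFun f f1 f2 s α + contourFun u u1 s α) α :=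
    fun α ha hα => hasDerivAt_velBoundary h hb.pos s (hb.near h s ha hα).chord_pos.ne'
  have key := intervalIntegral.integral_eq_sub_of_hasDerivAt (a := κ) (b := π)
    (f := fun α => B α - B (-α))
    (f' := fun α => (velFun f f1 f2 s α + velFun f f1 f2 s (-α))
      + (contourFun u u1 s α + contourFun u u1 s (-α))) (fun α hα => by
        rw [uIcc_of_le hπ] at hα
        have hα0 : 0 < α := h0.trans_le hα.1
        have e1 := hd α hα0.ne' (by rw [abs_of_pos hα0]; exact hα.2)
        have e2 := hd (-α) (by linarith) (by rw [abs_neg, abs_of_pos hα0]; exact hα.2)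
        exact (e1.sub (e2.comp α (hasDerivAt_neg α))).congr_deriv (by ring)) (i4.add i5)
  rw [intervalIntegral.integral_add i4 i5] at key
  -- By periodicity and sin π = 0 nothing is left at the far end, so only the boundary terms at ±κ
  -- survive.
  have hBπ : B π - B (-π) = 0 := by
    have p0 : f (s - -π) = f (s - π) := by
      rw [← h.per (s - π)]; congr 1; ring
    have p1 : f1 (s - -π) = f1 (s - π) := by
      rw [← h.per1 (s - π)]; congr 1; ring
    simp only [hB, p0, p1, cos_neg, sin_neg, sin_pi, neg_zero, sub_self]
  have split := intervalIntegral.integral_add_adjacent_intervals i4' i4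
  rw [logVelocity_eq hb h, integral_symm_interval i1 i2]
  simp only [hBπ] at key
  have e : (∫ α in (0 : ℝ)..π, (velFun f f1 f2 s α + velFun f f1 f2 s (-α))) + contourInt u u1 κ s =
      (∫ α in (0 : ℝ)..κ, (velFun f f1 f2 s α + velFun f f1 f2 s (-α))) - (B κ - B (-κ)) := by
    unfold contourInt
    linarith
  rw [e]
  have b1 : |B κ - B (-κ)| ≤ 2000 * M ^ 10 * √κ := by
    have n1 := hb.near h s (α := κ) h0.ne' (by rwa [abs_of_pos h0])
    have n2 := hb.near h s (α := -κ) (by linarith) (by rwa [abs_neg, abs_of_pos h0])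
    rw [abs_of_pos h0] at n1
    rw [abs_neg, abs_of_pos h0, cos_neg, sin_neg] at n2
    have n2' : NearBounds M κ (1 + f s) (1 + f (s - -κ)) (cos κ) (sin κ) :=
      { n2 with sin_le := by simpa using n2.sin_le }
    have := n1.abs_velBoundary_sub n2' (hb.first (s - κ)) (hb.first (s - -κ)) ?_ ?_
    · simpa [hB] using this
    · have := h.abs_second_difference_le hb.second s h0.le
      convert this using 2
      ring
    · have := h.abs_sub_le1 hb.second (s - κ) (s - -κ)
      rw [show s - κ - (s - -κ) = -(2 * κ) by ring, abs_neg, abs_of_pos (a := 2 * κ) (by linarith)] at this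
      linarith
  have b2 : |∫ α in (0 : ℝ)..κ, (velFun f f1 f2 s α + velFun f f1 f2 s (-α))| ≤ 1200 * M ^ 7 * √κ := by
    have := intervalIntegral.norm_integral_le_of_norm_le (a := 0) (b := κ) (μ := volume)
      (f := fun α => velFun f f1 f2 s α + velFun f f1 f2 s (-α))
      (g := fun α => 600 * M ^ 7 * (√α)⁻¹) h0.le (ae_of_all _ fun α hα => ?_)
      ((intervalIntegrable_inv_sqrt 0 κ le_rfl h0.le).const_mul _)
    · rw [intervalIntegral.integral_const_mul, integral_inv_sqrt h0.le] at this
      rw [← norm_eq_abs]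
      linarith
    · have hα0 := hα.1
      have t1 := abs_velFun_le hb h s (α := α) hα0.ne' (by rw [abs_of_pos hα0]; exact hα.2.trans hπ)
      have t2 := abs_velFun_le hb h s (α := -α) (by linarith)
        (by rw [abs_neg, abs_of_pos hα0]; exact hα.2.trans hπ)
      rw [abs_neg] at t2
      rw [abs_of_pos hα0] at t1 t2
      refine (norm_add_le _ _).trans ?_
      rw [norm_eq_abs, norm_eq_abs]
      linarith
  have hS : 0 ≤ √κ := sqrt_nonneg _
  have hM : M ^ 7 * √κ ≤ M ^ 10 * √κ := by
    gcongr ?_ * _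
    exact pow_le_pow_right₀ hb.one_le (by norm_num)
  have := abs_sub (∫ α in (0 : ℝ)..κ, (velFun f f1 f2 s α + velFun f f1 f2 s (-α))) (B κ - B (-κ))
  linarith

/-! ### Maximum and comparison principles for the contour operator. -/

variable {u u1 u2 v v1 v2 : ℝ → ℝ}

lemma IsC2Profile.abs_difference_le (hu : IsC2Profile u u1 u2) (hu1 : ∀ s, |u1 s| ≤ 1 / 100)
    (s α : ℝ) : |u s - u (s - α)| ≤ |α| / 100 := by
  have := hu.abs_sub_le hu1 s (s - α)
  rw [sub_sub_cancel] at this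
  linarith

/-- This is the factor multiplying sinh δ in `contour_eq`. Its positivity means that the sign of δ
decides the sign of the integrand, up to the bounded term in p² cos α. -/
lemma abs_sinh_mul_cothDer_nonneg {δ α p : ℝ} (h : |α| ≤ π) (h0 : α ≠ 0) (hδ : |δ| ≤ |α| / 100)
    (hp : |p| ≤ 1 / 100) :
    0 ≤ cothDer δ α * (1 - p ^ 2) + cothRe δ α * cothIm δ α * p := by
  obtain ⟨-, -, -, -, ⟨hk1, hk2⟩, -, -, -, -, hxy⟩ := kernel_bounds h h0 hδ
  have hL := one_sub_cos_pos h h0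
  have h1 := abs_le.1 (abs_mul_le_of_le hxy hp)
  have hp2 : p ^ 2 ≤ 1 / 10000 := by
    rw [← sq_abs]; nlinarith [abs_nonneg p]
  have h2 : 0 ≤ (cothDer δ α * (1 - p ^ 2) + cothRe δ α * cothIm δ α * p) * (1 - cos α) := by
    have : 0.49 * 0.9 ≤ (cothDer δ α * (1 - cos α)) * (1 - p ^ 2) := by
      apply mul_le_mul hk1 (by linarith) (by norm_num) (by linarith)
    nlinarith [h1.1]
  exact nonneg_of_mul_nonneg_left h2 hL

lemma contour_eq (δ α p : ℝ) : contour δ α p =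
    exp (-δ) * (sinh δ * (cothDer δ α * (1 - p ^ 2) + cothRe δ α * cothIm δ α * p)
      - cos α * p ^ 2 / 2) := by
  unfold contour kerZ kerV kerW
  ring

lemma abs_expNeg_mul_cos_le {δ α p : ℝ} (h : |α| ≤ π) (h0 : α ≠ 0) (hδ : |δ| ≤ |α| / 100)
    (hp : |p| ≤ 1 / 100) : |exp (-δ) * (cos α * p ^ 2 / 2)| ≤ 1 / 100 := by
  obtain ⟨-, -, ⟨hE1, hE2⟩, -⟩ := kernel_bounds h h0 hδ
  have hE : |exp (-δ)| ≤ 1.05 := by rw [abs_of_pos (exp_pos _)]; exact hE2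
  have hp2 : |p ^ 2 / 2| ≤ 1 / 200 := by
    rw [abs_of_nonneg (by positivity), ← sq_abs]; nlinarith [abs_nonneg p]
  have := abs_mul_le_of_le hE (abs_mul_le_of_le (abs_cos_le_one α) hp2)
  rw [← mul_div_assoc] at this
  linarith

lemma neg_le_contour {δ α p : ℝ} (h : |α| ≤ π) (h0 : α ≠ 0) (hδ : |δ| ≤ |α| / 100)
    (hp : |p| ≤ 1 / 100) (hd : 0 ≤ δ) : -(1 / 100) ≤ contour δ α p := by
  rw [contour_eq]
  have h1 := abs_sinh_mul_cothDer_nonneg h h0 hδ hp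
  have h2 := abs_le.1 (abs_expNeg_mul_cos_le h h0 hδ hp)
  have h3 : 0 ≤ exp (-δ) * (sinh δ * (cothDer δ α * (1 - p ^ 2) + cothRe δ α * cothIm δ α * p)) :=
    mul_nonneg (exp_pos _).le (mul_nonneg (sinh_nonneg_iff.2 hd) h1)
  linarith [h2.2]

lemma contour_le {δ α p : ℝ} (h : |α| ≤ π) (h0 : α ≠ 0) (hδ : |δ| ≤ |α| / 100)
    (hp : |p| ≤ 1 / 100) (hd : δ ≤ 0) : contour δ α p ≤ 1 / 100 := by
  rw [contour_eq]
  have h1 := abs_sinh_mul_cothDer_nonneg h h0 hδ hp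
  have h2 := abs_le.1 (abs_expNeg_mul_cos_le h h0 hδ hp)
  have h3 : exp (-δ) * (sinh δ * (cothDer δ α * (1 - p ^ 2) + cothRe δ α * cothIm δ α * p)) ≤ 0 :=
    mul_nonpos_of_nonneg_of_nonpos (exp_pos _).le
      (mul_nonpos_of_nonpos_of_nonneg (sinh_nonpos_iff.2 hd) h1)
  linarith [h2.1]

lemma abs_le_pi_of_mem {κ α : ℝ} (hκ : 0 < κ) (hα : α ∈ Icc κ π) :
    α ≠ 0 ∧ |α| ≤ π ∧ -α ≠ 0 ∧ |-α| ≤ π := by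
  have h0 := hκ.trans_le hα.1
  rw [abs_neg, abs_of_pos h0]
  exact ⟨h0.ne', hα.2, by linarith, hα.2⟩

/-- At a maximum δ ≥ 0 for every α, so only the bounded remainder can be negative. It contributes at
most π/50 in absolute value. -/
lemma neg_one_le_contourInt_of_max (hu : IsC2Profile u u1 u2) (hu1 : ∀ s, |u1 s| ≤ 1 / 100) {s κ : ℝ}
    (hs : ∀ x, u x ≤ u s) (h0 : 0 < κ) (hπ : κ ≤ π) : -1 ≤ contourInt u u1 κ s := by
  have key : ∀ α, α ≠ 0 → |α| ≤ π → -(1 / 100) ≤ contourFun u u1 s α := fun α h0 h1 =>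
    neg_le_contour h1 h0 (hu.abs_difference_le hu1 s α) (hu1 _) (by linarith [hs (s - α)])
  have := intervalIntegral.integral_mono_on (μ := volume) (f := fun _ => -(1 / 50)) hπ (by simp)
    (intervalIntegrable_contourFun hu s h0 hπ) (fun α hα => by
      obtain ⟨k1, k2, k3, k4⟩ := abs_le_pi_of_mem h0 hα
      linarith [key α k1 k2, key (-α) k3 k4])
  simp only [intervalIntegral.integral_const, smul_eq_mul] at this
  unfold contourInt
  nlinarith [pi_lt_d2]

lemma contourInt_le_one_of_min (hu : IsC2Profile u u1 u2) (hu1 : ∀ s, |u1 s| ≤ 1 / 100) {s κ : ℝ}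
    (hs : ∀ x, u s ≤ u x) (h0 : 0 < κ) (hπ : κ ≤ π) : contourInt u u1 κ s ≤ 1 := by
  have key : ∀ α, α ≠ 0 → |α| ≤ π → contourFun u u1 s α ≤ 1 / 100 := fun α h0 h1 =>
    contour_le h1 h0 (hu.abs_difference_le hu1 s α) (hu1 _) (by linarith [hs (s - α)])
  have := intervalIntegral.integral_mono_on (μ := volume) (g := fun _ => 1 / 50) hπ
    (intervalIntegrable_contourFun hu s h0 hπ) (by simp) (fun α hα => by
      obtain ⟨k1, k2, k3, k4⟩ := abs_le_pi_of_mem h0 hα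
      linarith [key α k1 k2, key (-α) k3 k4])
  simp only [intervalIntegral.integral_const, smul_eq_mul] at this
  unfold contourInt
  nlinarith [pi_lt_d2]

/-- The `δ`-derivative of the contour integrand is coercive. -/
lemma mul_sub_le_contour_sub {d0 d1 α p : ℝ} (h : |α| ≤ π) (h0 : α ≠ 0) (h1 : |d0| ≤ |α| / 100)
    (h2 : |d1| ≤ |α| / 100) (hp : |p| ≤ 1 / 100) (hd : d0 ≤ d1) :
    0.39 * (d1 - d0) ≤ (contour d1 α p - contour d0 α p) * (1 - cos α) := by
  have hL := one_sub_cos_pos h h0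
  have hder : ∀ x, HasDerivAt (fun d => contour d α p * (1 - cos α))
      ((kerVδ x α + p * kerWδ x α - p ^ 2 * kerZδ x α) * (1 - cos α)) x := by
    intro x
    have hx := hasDerivAt_id x
    have ha := hasDerivAt_const x α
    have hn := (den_pos x h h0).ne'
    have := ((((hasDerivAt_kerV hx ha hn).add ((hasDerivAt_kerW hx ha hn).const_mul p)).sub
      ((hasDerivAt_kerZ hx ha hn).const_mul (p ^ 2))).mul_const (1 - cos α))
    refine HasDerivAt.congr_deriv this ?_
    simp only [id]
    ring
  have := Convex.mul_sub_le_image_sub_of_le_deriv (convex_Icc d0 d1)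
    (f := fun d => contour d α p * (1 - cos α)) (C := 0.39)
    (fun x _ => (hder x).continuousAt.continuousWithinAt)
    (fun x _ => (hder x).differentiableAt.differentiableWithinAt) (fun x hx => ?_) d0
    (left_mem_Icc.2 hd) d1 (right_mem_Icc.2 hd) hd
  · linarith
  · rw [interior_Icc] at hx
    rw [(hder x).deriv]
    have hxα : |x| ≤ |α| / 100 := abs_le.2 ⟨by linarith [(abs_le.1 h1).1, hx.1],
      by linarith [(abs_le.1 h2).2, hx.2]⟩
    have b1 := (kerVδ_bounds h h0 hxα).1
    have b2 := abs_le.1 (abs_mul_le_of_le hp (abs_kerWδ_le h h0 hxα))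
    have b3 := abs_le.1 (abs_mul_le_of_le (abs_mul_le_of_le hp hp) (abs_kerZδ_le h h0 hxα))
    nlinarith [b2.1, b3.2]

/-- The boundary term of the difference of two contour integrals. -/
def diffBoundary (u u1 v v1 : ℝ → ℝ) (ε s α : ℝ) : ℝ :=
  ((v s - u s) - (v (s - α) - u (s - α))) *
    (kerW (u s - u (s - α)) α
      - (v1 (s - α) + u1 (s - α) + ((v s - u s) - (v (s - α) - u (s - α))) / ε)
        * kerZ (u s - u (s - α)) α)

/-- With η = (v - u)(s) - (v - u)(s - α) ≥ 0, changing δ in the integrand yields at least 0.39 η /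
(1 - cos α). Changing p yields terms with factor η' = v' - u', which are absorbed in a total
derivative. Since η' (u' + v') would leave η (u'' + v''), the correction η/ε is added inside
`diffBoundary`: it replaces this by η (u'' + v'' - 2 (v' - u')/ε). For v = u(· + ε) this is η times
a trapezoidal-rule error, small for small ε without any bound on u''. -/
lemma hasDerivAt_diffBoundary (hu : IsC2Profile u u1 u2) (hv : IsC2Profile v v1 v2)
    (hu1 : ∀ s, |u1 s| ≤ 1 / 100) (hv1 : ∀ s, |v1 s| ≤ 1 / 100) {ε : ℝ}
    (hg : ∀ s, |(v s - u s) / ε| ≤ 1 / 100)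
    (he : ∀ s, |v2 s + u2 s - 2 * ((v1 s - u1 s) / ε)| ≤ 1 / 20) {s : ℝ}
    (hs : ∀ x, v x - u x ≤ v s - u s) {α : ℝ} (h0 : α ≠ 0) (h : |α| ≤ π) :
    ∃ b, HasDerivAt (diffBoundary u u1 v v1 ε s) b α ∧
      b ≤ contourFun v v1 s α - contourFun u u1 s α := by
  have hL := one_sub_cos_pos h h0
  have hd0 := hu.abs_difference_le hu1 s α
  have hd1 := hv.abs_difference_le hv1 s α
  have hη0 : 0 ≤ (v s - u s) - (v (s - α) - u (s - α)) := by linarith [hs (s - α)]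
  have dδ : HasDerivAt (fun β => u s - u (s - β)) (u1 (s - α)) α :=
    ((hu.hasDerivAt_sub s α).const_sub (u s)).congr_deriv (by ring)
  have dη : HasDerivAt (fun β => (v s - u s) - (v (s - β) - u (s - β)))
      (v1 (s - α) - u1 (s - α)) α :=
    (((hv.hasDerivAt_sub s α).sub (hu.hasDerivAt_sub s α)).const_sub (v s - u s)).congr_deriv
      (by ring)
  have hn := (den_pos (u s - u (s - α)) h h0).ne'
  have dW := hasDerivAt_kerW dδ (hasDerivAt_id α) hn
  have dZ := hasDerivAt_kerZ dδ (hasDerivAt_id α) hn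
  have dp := ((hv.hasDerivAt_sub1 s α).add (hu.hasDerivAt_sub1 s α)).add (dη.div_const ε)
  refine ⟨_, dη.mul (dW.sub (dp.mul dZ)), ?_⟩
  have hq := hg s
  have hq' := hg (s - α)
  have heα := he (s - α)
  have hp0 := hu1 (s - α)
  have hp1 := hv1 (s - α)
  have main := mul_sub_le_contour_sub h h0 hd0 hd1 hp1 (by linarith)
  have bWδ := abs_kerWδ_le h h0 hd0
  have bWα := abs_le.1 (abs_kerWα_le h h0 hd0)
  have bZδ := abs_kerZδ_le h h0 hd0
  have bZα := abs_kerZα_le h h0 hd0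
  have bZ := abs_kerZ_mul_le h h0 hd0
  have eη : v s - v (s - α) - (u s - u (s - α)) = (v s - u s) - (v (s - α) - u (s - α)) := by ring
  rw [eη] at main
  have eηε : ((v s - u s) - (v (s - α) - u (s - α))) / ε = (v s - u s) / ε
      - (v (s - α) - u (s - α)) / ε := by ring
  have hηε : |((v s - u s) - (v (s - α) - u (s - α))) / ε| ≤ 1 / 50 := by
    rw [eηε]
    exact (abs_sub _ _).trans (by linarith)
  have econ : contourFun v v1 s α - contourFun u u1 s α =
      (contour (v s - v (s - α)) α (v1 (s - α)) - contour (u s - u (s - α)) α (v1 (s - α)))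
      + ((v1 (s - α) - u1 (s - α)) * kerW (u s - u (s - α)) α
        - (v1 (s - α) ^ 2 - u1 (s - α) ^ 2) * kerZ (u s - u (s - α)) α) := by
    unfold contourFun contour
    ring
  rw [econ]
  simp only [Pi.add_apply, id, mul_one]
  set δ := u s - u (s - α)
  set η := (v s - u s) - (v (s - α) - u (s - α))
  set p0 := u1 (s - α)
  set p1 := v1 (s - α)
  have bZL : |kerZ δ α * (1 - cos α)| ≤ 3.15 := by
    have e1 : kerZ δ α * (1 - cos α) = (kerZ δ α * α) * ((1 - cos α) / α) := by field_simp
    rw [e1]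
    refine (abs_mul_le_of_le bZ (B := 1.575) ?_).trans (by norm_num)
    rw [abs_div, abs_of_pos hL, div_le_iff₀ (abs_pos.2 h0)]
    have := one_sub_sq_div_two_le_cos (x := α)
    have h3 := sq_abs α
    nlinarith [abs_nonneg α, pi_lt_d2]
  have t1 := abs_le.1 (abs_mul_le_of_le hp0 bWδ)
  have t2 := abs_le.1 (abs_mul_le_of_le heα bZL)
  have t3 : |p1 + p0 + η / ε| ≤ 1 / 25 := by
    refine (abs_add_le _ _).trans ?_
    have := abs_add_le p1 p0
    linarith
  have t4 := abs_le.1 (abs_mul_le_of_le t3 ((abs_add_le _ _).trans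
    (add_le_add (abs_mul_le_of_le hp0 bZδ) bZα)))
  have fin : 0 ≤ η * (0.39 - (p0 * (kerWδ δ α * (1 - cos α)) + kerWα δ α * (1 - cos α))
      - (v2 (s - α) + u2 (s - α) - 2 * ((p1 - p0) / ε)) * (kerZ δ α * (1 - cos α))
      + (p1 + p0 + η / ε) * (p0 * (kerZδ δ α * (1 - cos α)) + kerZα δ α * (1 - cos α))) := by
    apply mul_nonneg hη0
    linarith [t1.2, bWα.2, t2.2, t4.1]
  refine le_of_mul_le_mul_right (a := 1 - cos α) ?_ hL
  linear_combination main + fin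

lemma diffBoundary_pi (hu : IsC2Profile u u1 u2) (hv : IsC2Profile v v1 v2) (ε s : ℝ) :
    diffBoundary u u1 v v1 ε s π = diffBoundary u u1 v v1 ε s (-π) := by
  have e : s - -π = s - π + 2 * π := by ring
  unfold diffBoundary
  rw [e, hu.per, hv.per, hu.per1, hv.per1]
  simp [kerW, kerZ, kerV, cothDer, cothRe, cothIm, den]

lemma contourInt_sub_ge (hu : IsC2Profile u u1 u2) (hv : IsC2Profile v v1 v2)
    (hu1 : ∀ s, |u1 s| ≤ 1 / 100) (hv1 : ∀ s, |v1 s| ≤ 1 / 100) {ε : ℝ}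
    (hg : ∀ s, |(v s - u s) / ε| ≤ 1 / 100)
    (he : ∀ s, |v2 s + u2 s - 2 * ((v1 s - u1 s) / ε)| ≤ 1 / 20) {s : ℝ}
    (hs : ∀ x, v x - u x ≤ v s - u s) {κ : ℝ} (h0 : 0 < κ) (hπ : κ ≤ π) :
    -(diffBoundary u u1 v v1 ε s κ - diffBoundary u u1 v v1 ε s (-κ)) ≤
      contourInt v v1 κ s - contourInt u u1 κ s := by
  -- The derivative b is only known through an upper bound and need not be integrable. The
  -- inequality form of the fundamental theorem, used below, requires only the dominating function
  -- to be integrable.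
  have hex : ∀ α, ∃ b, α ≠ 0 → |α| ≤ π → HasDerivAt (diffBoundary u u1 v v1 ε s) b α ∧
      b ≤ contourFun v v1 s α - contourFun u u1 s α := by
    intro α
    by_cases h : α ≠ 0 ∧ |α| ≤ π
    · obtain ⟨b, hb⟩ := hasDerivAt_diffBoundary hu hv hu1 hv1 hg he hs h.1 h.2
      exact ⟨b, fun _ _ => hb⟩
    · exact ⟨0, fun h1 h2 => absurd ⟨h1, h2⟩ h⟩
  choose b hb using hex
  have hder : ∀ α ∈ Icc κ π, HasDerivAt (fun α => diffBoundary u u1 v v1 ε s α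
      - diffBoundary u u1 v v1 ε s (-α)) (b α + b (-α)) α := by
    intro α hα
    obtain ⟨k1, k2, k3, k4⟩ := abs_le_pi_of_mem h0 hα
    exact ((hb α k1 k2).1.sub ((hb (-α) k3 k4).1.comp α (hasDerivAt_neg α))).congr_deriv (by ring)
  have i1 := intervalIntegrable_contourFun hu s h0 hπ
  have i2 := intervalIntegrable_contourFun hv s h0 hπ
  have := intervalIntegral.sub_le_integral_of_hasDeriv_right_of_le hπ
    (fun α hα => (hder α hα).continuousAt.continuousWithinAt)
    (fun α hα => (hder α (Ioo_subset_Icc_self hα)).hasDerivWithinAt)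
    (φ := fun α => (contourFun v v1 s α + contourFun v v1 s (-α))
      - (contourFun u u1 s α + contourFun u u1 s (-α)))
    ((intervalIntegrable_iff_integrableOn_Icc_of_le hπ).1 (i2.sub i1)) (fun α hα => by
      obtain ⟨k1, k2, k3, k4⟩ := abs_le_pi_of_mem h0 (Ioo_subset_Icc_self hα)
      linarith [(hb α k1 k2).2, (hb (-α) k3 k4).2])
  rw [intervalIntegral.integral_sub i2 i1, diffBoundary_pi hu hv, sub_self] at this
  unfold contourInt
  linarith

lemma abs_diffBoundary_le (hu : IsC2Profile u u1 u2)
    (hu1 : ∀ s, |u1 s| ≤ 1 / 100) (hv1 : ∀ s, |v1 s| ≤ 1 / 100) {ε : ℝ}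
    (hg : ∀ s, |(v s - u s) / ε| ≤ 1 / 100) (s : ℝ) {α : ℝ} (h0 : α ≠ 0) (h : |α| ≤ π) :
    |diffBoundary u u1 v v1 ε s α| ≤
      2 * |α⁻¹ * ((v (s - α) - u (s - α)) - (v s - u s))| := by
  have hd0 := hu.abs_difference_le hu1 s α
  have bW := abs_kerW_mul_le h h0 hd0
  have bZ := abs_kerZ_mul_le h h0 hd0
  have t3 : |v1 (s - α) + u1 (s - α) + ((v s - u s) - (v (s - α) - u (s - α))) / ε| ≤ 1 / 25 := by
    refine (abs_add_le _ _).trans ?_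
    have t1 := abs_add_le (v1 (s - α)) (u1 (s - α))
    have t2 := hu1 (s - α)
    have t4 := hv1 (s - α)
    have t5 : |((v s - u s) - (v (s - α) - u (s - α))) / ε| ≤ 1 / 50 := by
      rw [sub_div]
      exact (abs_sub _ _).trans (by linarith [hg s, hg (s - α)])
    linarith
  have e : diffBoundary u u1 v v1 ε s α =
      (kerW (u s - u (s - α)) α * α
      - (v1 (s - α) + u1 (s - α) + ((v s - u s) - (v (s - α) - u (s - α))) / ε)
        * (kerZ (u s - u (s - α)) α * α)) * -(α⁻¹ * ((v (s - α) - u (s - α)) - (v s - u s))) := by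
    unfold diffBoundary
    generalize ((v s - u s) - (v (s - α) - u (s - α))) / ε = q
    field_simp
    ring
  rw [e]
  refine abs_mul_le_of_le ((abs_sub _ _).trans ?_) (abs_neg _).le
  have := abs_mul_le_of_le t3 bZ
  linarith

/-- The contour operator obeys a comparison principle for differences of two profiles. -/
lemma le_of_tendsto_contourInt (hu : IsC2Profile u u1 u2) (hv : IsC2Profile v v1 v2)
    (hu1 : ∀ s, |u1 s| ≤ 1 / 100) (hv1 : ∀ s, |v1 s| ≤ 1 / 100) {ε : ℝ}
    (hg : ∀ s, |(v s - u s) / ε| ≤ 1 / 100)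
    (he : ∀ s, |v2 s + u2 s - 2 * ((v1 s - u1 s) / ε)| ≤ 1 / 20) {s : ℝ}
    (hs : ∀ x, v x - u x ≤ v s - u s) {a b : ℝ}
    (ha : Tendsto (fun κ => contourInt u u1 κ s) (𝓝[>] 0) (𝓝 a))
    (hb : Tendsto (fun κ => contourInt v v1 κ s) (𝓝[>] 0) (𝓝 b)) : a ≤ b := by
  have hdg : HasDerivAt (fun x => v x - u x) (v1 s - u1 s) s := (hv.d1 s).sub (hu.d1 s)
  -- At the maximum of v - u its derivative vanishes, hence η = o(α). As the kernels are O(1/α),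
  -- both boundary terms tend to zero with κ.
  have hz : v1 s - u1 s = 0 := IsLocalMax.hasDerivAt_eq_zero (Eventually.of_forall hs) hdg
  have hd : HasDerivAt (fun α => v (s - α) - u (s - α)) 0 0 := by
    have := HasDerivAt.comp_const_sub s 0 (f := fun x => v x - u x) (f' := 0)
      (by rw [sub_zero]; rwa [hz] at hdg)
    simpa using this
  rw [hasDerivAt_iff_tendsto_slope_zero] at hd
  simp only [zero_add, smul_eq_mul, sub_zero] at hd
  have hp : Tendsto (fun κ : ℝ => 2 * |κ⁻¹ * ((v (s - κ) - u (s - κ)) - (v s - u s))|) (𝓝[>] 0) (𝓝 0) := by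
    have := (hd.mono_left (nhdsWithin_mono (0 : ℝ) (s := Ioi 0) (fun x (hx : 0 < x) => hx.ne'))).abs.const_mul 2
    simpa using this
  have hneg : Tendsto (fun κ : ℝ => -κ) (𝓝[>] 0) (𝓝[≠] 0) := by
    refine tendsto_nhdsWithin_iff.2 ⟨?_, ?_⟩
    · have : Tendsto (fun κ : ℝ => -κ) (𝓝 0) (𝓝 (-0)) := continuous_neg.tendsto 0
      rw [neg_zero] at this
      exact this.mono_left nhdsWithin_le_nhds
    · filter_upwards [self_mem_nhdsWithin] with κ (hκ : 0 < κ)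
      exact neg_ne_zero.2 hκ.ne'
  have hn : Tendsto (fun κ : ℝ => 2 * |(-κ)⁻¹ * ((v (s - -κ) - u (s - -κ)) - (v s - u s))|)
      (𝓝[>] 0) (𝓝 0) := by
    have := (hd.comp hneg).abs.const_mul 2
    simpa using this
  have hlim := (hb.sub ha).add (hp.add hn)
  rw [add_zero, add_zero] at hlim
  have : 0 ≤ b - a := by
    refine ge_of_tendsto hlim ?_
    filter_upwards [self_mem_nhdsWithin, Ioo_mem_nhdsGT pi_pos] with κ (hκ : 0 < κ) hκπ
    have k := contourInt_sub_ge hu hv hu1 hv1 hg he hs hκ hκπ.2.le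
    have k1 := abs_le.1 (abs_diffBoundary_le hu hu1 hv1 hg s (α := κ) hκ.ne'
      (by rw [abs_of_pos hκ]; exact hκπ.2.le))
    have k2 := abs_le.1 (abs_diffBoundary_le hu hu1 hv1 hg s (α := -κ) (by linarith)
      (by rw [abs_neg, abs_of_pos hκ]; exact hκπ.2.le))
    linarith [k1.2, k2.1]
  linarith

/-! ### Continuity and interchange of parametric integrals. -/

section parametric

lemma continuousOn_intervalIntegral {X : Type*} [TopologicalSpace X]
    {S : Set X} {F : X → ℝ → ℝ} {a b : ℝ} (hab : a ≤ b)
    (hF : ContinuousOn (fun z : X × ℝ => F z.1 z.2) (S ×ˢ Icc a b)) :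
    ContinuousOn (fun x => ∫ y in a..b, F x y) S := by
  rw [continuousOn_iff_continuous_domRestrict]
  -- Projecting the integration variable onto [a, b] extends the integrand continuously without
  -- changing the integral.
  have h1 : Continuous (fun z : S × ℝ => F z.1 (projIcc a b hab z.2)) := by
    refine hF.comp_continuous (f := fun z : S × ℝ => ((z.1 : X), (projIcc a b hab z.2 : ℝ))) ?_ ?_
    · fun_prop
    · intro z
      exact ⟨z.1.2, (projIcc a b hab z.2).2⟩
  have h2 := intervalIntegral.continuous_parametric_intervalIntegral_of_continuous' (μ := volume)
    (f := fun (x : S) y => F x (projIcc a b hab y)) h1 a b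
  convert h2 using 2 with x
  refine intervalIntegral.integral_congr fun y hy => ?_
  rw [uIcc_of_le hab] at hy
  simp only [projIcc_of_mem hab hy]

lemma intervalIntegral_swap {F : ℝ → ℝ → ℝ} {a b c d : ℝ} (hab : a ≤ b) (hcd : c ≤ d)
    (hF : ContinuousOn (fun z : ℝ × ℝ => F z.1 z.2) (Icc a b ×ˢ Icc c d)) :
    ∫ x in a..b, ∫ y in c..d, F x y = ∫ y in c..d, ∫ x in a..b, F x y := by
  simp only [intervalIntegral.integral_of_le hab, intervalIntegral.integral_of_le hcd]
  refine integral_integral_swap ?_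
  rw [Measure.prod_restrict]
  exact (hF.integrableOn_compact (isCompact_Icc.prod isCompact_Icc)).mono_set
    (prod_mono Ioc_subset_Icc_self Ioc_subset_Icc_self)

end parametric

/-! ### The energy inequality and its coercive kernel. -/

section energy

/-- The `s`-derivative of the contour integrand, where `r = u''(s - α)`. -/
def contourDeriv (δ α p q r : ℝ) : ℝ :=
  (q - p) * (kerVδ δ α + p * kerWδ δ α - p ^ 2 * kerZδ δ α) + r * (kerW δ α - 2 * p * kerZ δ α)

lemma continuousOn_contourDeriv {X : Type*} [TopologicalSpace X] {S : Set X} {d a p q r : X → ℝ}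
    (hd : ContinuousOn d S) (ha : ContinuousOn a S) (hp : ContinuousOn p S) (hq : ContinuousOn q S)
    (hr : ContinuousOn r S) (h : ∀ z ∈ S, den (d z) (a z) ≠ 0) :
    ContinuousOn (fun z => contourDeriv (d z) (a z) (p z) (q z) (r z)) S := by
  unfold contourDeriv kerZδ kerVδ kerWδ kerZ kerV kerW cothDer cothRe cothIm
  unfold den at *
  fun_prop (disch := assumption)

variable {u u1 u2 : ℝ → ℝ}

def contourDerivFun (u u1 u2 : ℝ → ℝ) (s α : ℝ) : ℝ :=
  contourDeriv (u s - u (s - α)) α (u1 (s - α)) (u1 s) (u2 (s - α))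

def linKerFun (u u1 : ℝ → ℝ) (s α : ℝ) : ℝ :=
  linKer (u s - u (s - α)) α (u1 (s - α)) (u1 s)

/-- The boundary term of the integration by parts in α that removes u''(s - α) from the
differentiated equation; what remains is u'(s) - u'(s - α) times `linKer`. -/
def energyBoundary (u u1 : ℝ → ℝ) (s α : ℝ) : ℝ :=
  (u1 s - u1 (s - α)) * (kerW (u s - u (s - α)) α
    - (u1 (s - α) + u1 s) * kerZ (u s - u (s - α)) α)

lemma hasDerivAt_contourFun (hu : IsC2Profile u u1 u2) (s : ℝ) {α : ℝ} (h0 : α ≠ 0) (h : |α| ≤ π) :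
    HasDerivAt (fun s => contourFun u u1 s α) (contourDerivFun u u1 u2 s α) s := by
  have hn := (den_pos (u s - u (s - α)) h h0).ne'
  have dδ : HasDerivAt (fun s => u s - u (s - α)) (u1 s - u1 (s - α)) s :=
    (hu.d1 s).sub ((hu.d1 (s - α)).comp_sub_const s α)
  have dp : HasDerivAt (fun s => u1 (s - α)) (u2 (s - α)) s := (hu.d2 (s - α)).comp_sub_const s α
  have dα := hasDerivAt_const s α
  have := ((hasDerivAt_kerV dδ dα hn).add (dp.mul (hasDerivAt_kerW dδ dα hn))).sub
    ((dp.pow 2).mul (hasDerivAt_kerZ dδ dα hn))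
  refine HasDerivAt.congr_deriv this ?_
  unfold contourDerivFun contourDeriv
  simp only [Pi.pow_apply]
  push_cast
  ring

lemma hasDerivAt_energyBoundary (hu : IsC2Profile u u1 u2) (s : ℝ) {α : ℝ} (h0 : α ≠ 0)
    (h : |α| ≤ π) : HasDerivAt (energyBoundary u u1 s)
      (contourDerivFun u u1 u2 s α - (u1 s - u1 (s - α)) * linKerFun u u1 s α) α := by
  have hn := (den_pos (u s - u (s - α)) h h0).ne'
  have dδ : HasDerivAt (fun β => u s - u (s - β)) (u1 (s - α)) α :=
    ((hu.hasDerivAt_sub s α).const_sub (u s)).congr_deriv (by ring)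
  have dp := hu.hasDerivAt_sub1 s α
  have dα := hasDerivAt_id α
  have := (dp.const_sub (u1 s)).mul ((hasDerivAt_kerW dδ dα hn).sub
    ((dp.add_const (u1 s)).mul (hasDerivAt_kerZ dδ dα hn)))
  refine HasDerivAt.congr_deriv this ?_
  unfold contourDerivFun contourDeriv linKerFun linKer
  simp only [id, Pi.sub_apply, Pi.mul_apply]
  ring

lemma energyBoundary_pi (hu : IsC2Profile u u1 u2) (s : ℝ) :
    energyBoundary u u1 s π = energyBoundary u u1 s (-π) := by
  have e : s - -π = s - π + 2 * π := by ring
  unfold energyBoundary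
  rw [e, hu.per, hu.per1]
  simp [kerW, kerZ, kerV, cothDer, cothRe, cothIm, den]

lemma den_ne_zero_of_mem {κ : ℝ} (hκ : 0 < κ) {d : ℝ × ℝ → ℝ} (S : Set ℝ) :
    (∀ z ∈ S ×ˢ Icc κ π, den (d z) z.2 ≠ 0) ∧ ∀ z ∈ S ×ˢ Icc κ π, den (d z) (-z.2) ≠ 0 := by
  constructor
  · intro z hz
    obtain ⟨k1, k2, -, -⟩ := abs_le_pi_of_mem hκ hz.2
    exact (den_pos _ k2 k1).ne'
  · intro z hz
    obtain ⟨-, -, k3, k4⟩ := abs_le_pi_of_mem hκ hz.2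
    exact (den_pos _ k4 k3).ne'

lemma continuousOn_contourFun₂ (hu : IsC2Profile u u1 u2) {κ : ℝ} (hκ : 0 < κ) (S : Set ℝ) :
    ContinuousOn (fun z : ℝ × ℝ => contourFun u u1 z.1 z.2 + contourFun u u1 z.1 (-z.2))
      (S ×ˢ Icc κ π) := by
  have h0 := hu.cont
  have h1 := hu.cont1
  exact (continuousOn_contour (by fun_prop) (by fun_prop) (by fun_prop)
    (den_ne_zero_of_mem hκ S).1).add
    (continuousOn_contour (by fun_prop) (by fun_prop) (by fun_prop) (den_ne_zero_of_mem hκ S).2)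

lemma continuousOn_contourDerivFun₂ (hu : IsC2Profile u u1 u2) {κ : ℝ} (hκ : 0 < κ) (S : Set ℝ) :
    ContinuousOn (fun z : ℝ × ℝ => contourDerivFun u u1 u2 z.1 z.2 + contourDerivFun u u1 u2 z.1 (-z.2))
      (S ×ˢ Icc κ π) := by
  have h0 := hu.cont
  have h1 := hu.cont1
  have h2 := hu.cont2
  exact (continuousOn_contourDeriv (by fun_prop) (by fun_prop) (by fun_prop) (by fun_prop)
    (by fun_prop) (den_ne_zero_of_mem hκ S).1).add
    (continuousOn_contourDeriv (by fun_prop) (by fun_prop) (by fun_prop) (by fun_prop)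
    (by fun_prop) (den_ne_zero_of_mem hκ S).2)

/-- The dissipation density, before symmetrization. -/
def linFun (u u1 : ℝ → ℝ) (s α : ℝ) : ℝ := (u1 s - u1 (s - α)) * linKerFun u u1 s α

lemma continuousOn_linFun₂ (hu : IsC2Profile u u1 u2) {κ : ℝ} (hκ : 0 < κ) (S : Set ℝ) :
    ContinuousOn (fun z : ℝ × ℝ => linFun u u1 z.1 z.2) (S ×ˢ Icc κ π) ∧
    ContinuousOn (fun z : ℝ × ℝ => linFun u u1 z.1 (-z.2)) (S ×ˢ Icc κ π) := by
  have h0 := hu.cont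
  have h1 := hu.cont1
  constructor
  · exact ContinuousOn.mul (by fun_prop) (continuousOn_linKer (by fun_prop) (by fun_prop)
      (by fun_prop) (by fun_prop) (den_ne_zero_of_mem hκ S).1)
  · exact ContinuousOn.mul (by fun_prop) (continuousOn_linKer (by fun_prop) (by fun_prop)
      (by fun_prop) (by fun_prop) (den_ne_zero_of_mem hκ S).2)

lemma continuousOn_slice {F : ℝ × ℝ → ℝ} {κ : ℝ} (h : ContinuousOn F (univ ×ˢ Icc κ π)) (s : ℝ) :
    ContinuousOn (fun α => F (s, α)) (Icc κ π) :=
  h.comp (by fun_prop) fun α hα => ⟨mem_univ _, hα⟩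

lemma continuous_slice {F : ℝ × ℝ → ℝ} {κ α : ℝ} (h : ContinuousOn F (univ ×ˢ Icc κ π))
    (hα : α ∈ Icc κ π) : Continuous fun s => F (s, α) :=
  h.comp_continuous (by fun_prop) fun s => ⟨mem_univ _, hα⟩

lemma intervalIntegrable_of_continuousOn_Icc {F : ℝ → ℝ} {a b : ℝ} (hab : a ≤ b)
    (h : ContinuousOn F (Icc a b)) : IntervalIntegrable F volume a b :=
  ContinuousOn.intervalIntegrable (by rwa [uIcc_of_le hab])

/-- Integration by parts in `s` and then in `α`. -/
lemma integral_mul_contourInt (hu : IsC2Profile u u1 u2) {κ : ℝ} (hκ : 0 < κ) (hπ : κ ≤ π) :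
    ∫ s in (-π)..π, u2 s * contourInt u u1 κ s =
      -(∫ α in κ..π, ∫ s in (-π)..π, u1 s * (linFun u u1 s α + linFun u u1 s (-α)))
      + ∫ s in (-π)..π, u1 s * (energyBoundary u u1 s κ - energyBoundary u u1 s (-κ)) := by
  have c1 := hu.cont1
  have c2 := hu.cont2
  have hππ : -π ≤ π := by linarith [pi_pos]
  have k0 := continuousOn_contourFun₂ hu hκ univ
  have k1 := continuousOn_contourDerivFun₂ hu hκ univ
  have k2 := (continuousOn_linFun₂ hu hκ univ).1.add (continuousOn_linFun₂ hu hκ univ).2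
  have c1' : ContinuousOn (fun z : ℝ × ℝ => u1 z.1) (univ ×ˢ Icc κ π) := by fun_prop
  have c2' : ContinuousOn (fun z : ℝ × ℝ => u2 z.1) (univ ×ˢ Icc κ π) := by fun_prop
  have hsub : Icc (-π) π ×ˢ Icc κ π ⊆ univ ×ˢ Icc κ π := prod_mono (subset_univ _) le_rfl
  have step1 : ∫ s in (-π)..π, u2 s * contourInt u u1 κ s =
      ∫ α in κ..π, ∫ s in (-π)..π, u2 s * (contourFun u u1 s α + contourFun u u1 s (-α)) := by
    unfold contourInt
    simp_rw [← intervalIntegral.integral_const_mul]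
    exact intervalIntegral_swap hππ hπ ((c2'.mul k0).mono hsub)
  have step2 : ∀ α ∈ uIcc κ π,
      ∫ s in (-π)..π, u2 s * (contourFun u u1 s α + contourFun u u1 s (-α)) =
      -∫ s in (-π)..π, u1 s * (contourDerivFun u u1 u2 s α + contourDerivFun u u1 u2 s (-α)) := by
    intro α hα
    rw [uIcc_of_le hπ] at hα
    obtain ⟨a1, a2, a3, a4⟩ := abs_le_pi_of_mem hκ hα
    have ibp := intervalIntegral.integral_mul_deriv_eq_deriv_mul (a := -π) (b := π)
      (u := u1) (u' := u2) (v := fun s => contourFun u u1 s α + contourFun u u1 s (-α))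
      (v' := fun s => contourDerivFun u u1 u2 s α + contourDerivFun u u1 u2 s (-α))
      (fun s _ => hu.d2 s)
      (fun s _ => (hasDerivAt_contourFun hu s a1 a2).add (hasDerivAt_contourFun hu s a3 a4))
      (c2.intervalIntegrable _ _) ((continuous_slice k1 hα).intervalIntegrable _ _)
    have p : ∀ β, contourFun u u1 (-π) β = contourFun u u1 π β := by
      intro β
      have h1 := hu.per (-π)
      have h2 := hu.per (-π - β)
      have h3 := hu.per1 (-π - β)
      rw [show -π + 2 * π = π by ring] at h1
      rw [show -π - β + 2 * π = π - β by ring] at h2 h3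
      unfold contourFun
      rw [h1, h2, h3]
    have p1 : u1 (-π) = u1 π := by
      have h1 := hu.per1 (-π)
      rw [show -π + 2 * π = π by ring] at h1
      exact h1.symm
    simp only [p, p1, sub_self] at ibp
    linarith
  have step3 : ∀ s, ∫ α in κ..π, (contourDerivFun u u1 u2 s α + contourDerivFun u u1 u2 s (-α)) =
      (∫ α in κ..π, (linFun u u1 s α + linFun u u1 s (-α)))
        - (energyBoundary u u1 s κ - energyBoundary u u1 s (-κ)) := by
    intro s
    have i1 : IntervalIntegrable (fun α => contourDerivFun u u1 u2 s α
        + contourDerivFun u u1 u2 s (-α)) volume κ π :=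
      intervalIntegrable_of_continuousOn_Icc hπ (continuousOn_slice k1 s)
    have i2 : IntervalIntegrable (fun α => linFun u u1 s α + linFun u u1 s (-α)) volume κ π :=
      intervalIntegrable_of_continuousOn_Icc hπ (continuousOn_slice k2 s)
    have := intervalIntegral.integral_eq_sub_of_hasDerivAt (a := κ) (b := π)
      (f := fun α => energyBoundary u u1 s α - energyBoundary u u1 s (-α)) (fun α hα => by
        rw [uIcc_of_le hπ] at hα
        obtain ⟨a1, a2, a3, a4⟩ := abs_le_pi_of_mem hκ hα
        refine ((hasDerivAt_energyBoundary hu s a1 a2).sub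
          ((hasDerivAt_energyBoundary hu s a3 a4).comp α (hasDerivAt_neg α))).congr_deriv
          (g' := (contourDerivFun u u1 u2 s α + contourDerivFun u u1 u2 s (-α))
            - (linFun u u1 s α + linFun u u1 s (-α))) ?_
        unfold linFun
        ring) (i1.sub i2)
    rw [intervalIntegral.integral_sub i1 i2, energyBoundary_pi hu, sub_self] at this
    linarith
  have cI : Continuous fun s => ∫ α in κ..π, (linFun u u1 s α + linFun u u1 s (-α)) := by
    rw [← continuousOn_univ]
    exact continuousOn_intervalIntegral hπ
      (F := fun s α => linFun u u1 s α + linFun u u1 s (-α)) k2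
  have cD : Continuous fun s => ∫ α in κ..π,
      (contourDerivFun u u1 u2 s α + contourDerivFun u u1 u2 s (-α)) := by
    rw [← continuousOn_univ]
    exact continuousOn_intervalIntegral hπ
      (F := fun s α => contourDerivFun u u1 u2 s α + contourDerivFun u u1 u2 s (-α)) k1
  -- Continuity of the boundary term is read off from the identity just proved.
  have cB : Continuous fun s => energyBoundary u u1 s κ - energyBoundary u u1 s (-κ) := by
    have : (fun s => energyBoundary u u1 s κ - energyBoundary u u1 s (-κ)) = fun s =>
        (∫ α in κ..π, (linFun u u1 s α + linFun u u1 s (-α)))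
        - ∫ α in κ..π, (contourDerivFun u u1 u2 s α + contourDerivFun u u1 u2 s (-α)) := by
      ext s
      linarith [step3 s]
    rw [this]
    exact cI.sub cD
  rw [step1, intervalIntegral.integral_congr step2, intervalIntegral.integral_neg,
    ← intervalIntegral_swap hππ hπ ((c1'.mul k1).mono hsub),
    ← intervalIntegral_swap hππ hπ ((c1'.mul k2).mono hsub)]
  simp_rw [intervalIntegral.integral_const_mul, step3, mul_sub (u1 _) (∫ _ in κ..π, _)]
  have j1 : IntervalIntegrable (fun s => u1 s * ∫ α in κ..π, (linFun u u1 s α + linFun u u1 s (-α)))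
    volume (-π) π := (c1.mul cI).intervalIntegrable _ _
  have j2 : IntervalIntegrable (fun s => u1 s * (energyBoundary u u1 s κ - energyBoundary u u1 s (-κ)))
    volume (-π) π := (c1.mul cB).intervalIntegrable _ _
  rw [intervalIntegral.integral_sub j1 j2]
  ring

/-- The symmetrized dissipation density. -/
def symDissipation (u u1 : ℝ → ℝ) (s α : ℝ) : ℝ :=
  (u1 s - u1 (s - α)) * (u1 s * linKer (u s - u (s - α)) α (u1 (s - α)) (u1 s)
    - u1 (s - α) * linKer (-(u s - u (s - α))) (-α) (u1 s) (u1 (s - α)))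

lemma integral_shift {E : Type*} [NormedAddCommGroup E] [NormedSpace ℝ E] {F : ℝ → E} (hF : Function.Periodic F (2 * π)) (α : ℝ) :
    ∫ s in (-π)..π, F (s - α) = ∫ s in (-π)..π, F s := by
  rw [intervalIntegral.integral_comp_sub_right]
  have := hF.intervalIntegral_add_eq (-π - α) (-π)
  rw [show π - α = -π - α + 2 * π by ring, this, show -π + 2 * π = π by ring]

/-- Translating s by α in the half with -α exchanges the two points: δ and α change sign, p and q
are swapped. Both halves then concern the same pair of points. -/
lemma integral_linFun_eq (hu : IsC2Profile u u1 u2) {κ α : ℝ} (hκ : 0 < κ) (hα : α ∈ Icc κ π) :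
    ∫ s in (-π)..π, u1 s * (linFun u u1 s α + linFun u u1 s (-α)) =
      ∫ s in (-π)..π, symDissipation u u1 s α := by
  have c1 := hu.cont1
  have k1 := continuous_slice (continuousOn_linFun₂ hu hκ univ).1 hα
  have k2 := continuous_slice (continuousOn_linFun₂ hu hκ univ).2 hα
  simp only at k1 k2
  have per : Function.Periodic (fun s => u1 s * linFun u u1 s (-α)) (2 * π) := by
    intro s
    have e : s + 2 * π - -α = s - -α + 2 * π := by ring
    unfold linFun linKerFun
    simp only [e, hu.per s, hu.per1 s, hu.per (s - -α), hu.per1 (s - -α)]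
  simp_rw [mul_add]
  have j1 : IntervalIntegrable (fun s => u1 s * linFun u u1 s α) volume (-π) π :=
    (c1.mul k1).intervalIntegrable _ _
  have j2 : Continuous fun s => u1 s * linFun u u1 s (-α) := c1.mul k2
  have j3 : IntervalIntegrable (fun s => u1 (s - α) * linFun u u1 (s - α) (-α)) volume (-π) π :=
    (j2.comp (continuous_sub_right α)).intervalIntegrable _ _
  rw [intervalIntegral.integral_add j1 (j2.intervalIntegrable _ _), ← integral_shift per α,
    ← intervalIntegral.integral_add j1 j3]
  congr 1 with s
  unfold linFun linKerFun symDissipation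
  rw [sub_neg_eq_add, sub_add_cancel, neg_sub]
  ring

/-- With K, K' the kernels at the pair and at the swapped pair, the density is (q - p)² (K + K')/2 +
(q - p) ((q + p)/2) (K - K'). The first part is coercive by `le_linKer`. In the second, K - K' =
O(1/α) and |p|, |q| ≤ 1/100, so Young's inequality costs only 0.01 of the coercivity and a constant.
-/
lemma le_symDissipation (hu : IsC2Profile u u1 u2) (hu1 : ∀ s, |u1 s| ≤ 1 / 100) (s : ℝ) {α : ℝ}
    (h0 : α ≠ 0) (h : |α| ≤ π) :
    0.29 * ((u1 s - u1 (s - α)) ^ 2 / (1 - cos α)) - 1 ≤ symDissipation u u1 s α := by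
  have hL := one_sub_cos_pos h h0
  have hd := hu.abs_difference_le hu1 s α
  have hd' : |-(u s - u (s - α))| ≤ |(-α)| / 100 := by rwa [abs_neg, abs_neg]
  have hp := hu1 (s - α)
  have hq := hu1 s
  have b1 := le_linKer h h0 hd hp hq
  have b2 := le_linKer (α := -α) (by rwa [abs_neg]) (by simpa) hd' hq hp
  have b3 := abs_linKer_sub_neg_le h h0 hd hp hq
  rw [cos_neg] at b2
  unfold symDissipation
  set δ := u s - u (s - α)
  set p := u1 (s - α)
  set q := u1 s
  set K := linKer δ α p q
  set K' := linKer (-δ) (-α) q p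
  have e : (q - p) * (q * K - p * K') = (q - p) ^ 2 * (K + K') / 2
      + (q - p) * ((q + p) / 2) * (K - K') := by ring
  have b4 : (q - p) ^ 2 * (0.3 / (1 - cos α)) ≤ (q - p) ^ 2 * (K + K') / 2 := by
    have : 0.3 / (1 - cos α) ≤ (K + K') / 2 := by
      rw [div_le_iff₀ hL]; linarith
    calc _ ≤ (q - p) ^ 2 * ((K + K') / 2) := by gcongr
      _ = _ := by ring
  have b5 : |(q - p) * ((q + p) / 2) * (K - K')| ≤ 0.01 * ((q - p) ^ 2 / (1 - cos α)) + 1 := by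
    have e1 : (q - p) * ((q + p) / 2) * (K - K') = ((q - p) * α⁻¹) * (((q + p) / 2) * ((K - K') * α)) := by
      field_simp
    have h1 : |(q + p) / 2| ≤ 1 / 100 := by
      rw [abs_div, abs_two]; have := abs_add_le q p; linarith
    have h2 := abs_mul_le_of_le h1 b3
    rw [e1]
    refine (abs_mul_le_of_le le_rfl h2).trans ?_
    have h3 : ((q - p) * α⁻¹) ^ 2 ≤ (q - p) ^ 2 / (1 - cos α) := by
      rw [mul_pow, div_eq_mul_inv, inv_pow]
      have : (1 - cos α) ≤ α ^ 2 := by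
        have := one_sub_sq_div_two_le_cos (x := α)
        nlinarith [sq_nonneg α]
      gcongr
    have h4 := sq_abs ((q - p) * α⁻¹)
    nlinarith [sq_nonneg (|(q - p) * α⁻¹| - 1)]
  have b6 := abs_le.1 b5
  rw [e]
  have e3 : (q - p) ^ 2 * (0.3 / (1 - cos α)) = 0.3 * ((q - p) ^ 2 / (1 - cos α)) := by ring
  linarith [b6.1]

end energy

variable {u u1 u2 : ℝ → ℝ}

/-- The dissipation, a truncation of the square of the `H^{1/2}` seminorm of `g`. -/
def dissipation (g : ℝ → ℝ) (κ : ℝ) : ℝ :=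
  ∫ α in κ..π, ∫ s in (-π)..π, (g s - g (s - α)) ^ 2 / (1 - cos α)

lemma abs_kerW_add_neg_le {δ α : ℝ} (h : |α| ≤ π) (h0 : α ≠ 0) (hδ : |δ| ≤ |α| / 100) :
    |kerW δ α + kerW (-δ) (-α)| ≤ 1 := by
  obtain ⟨-, -, -, -, -, -, -, ⟨hSx1, hSx2⟩, hSy, -⟩ := kernel_bounds h h0 hδ
  have e : kerW δ α + kerW (-δ) (-α) = (sinh δ * cothRe δ α) * (-2 * (sinh δ * cothIm δ α)) := by
    unfold kerW
    simp only [cothRe_neg, cothIm_neg, sinh_neg, neg_neg]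
    rw [← cosh_add_sinh δ, ← cosh_sub_sinh δ]
    ring
  rw [e]
  refine (abs_mul_le_of_le (A := 0.001) (by rw [abs_le]; constructor <;> linarith)
    (abs_mul_le_of_le (show |(-2 : ℝ)| ≤ 2 by norm_num) hSy)).trans (by norm_num)

lemma abs_kerZ_add_neg_le {δ α : ℝ} (h : |α| ≤ π) (h0 : α ≠ 0) (hδ : |δ| ≤ |α| / 100) :
    |kerZ δ α + kerZ (-δ) (-α)| ≤ 2 := by
  obtain ⟨⟨hC1, hC2⟩, -, -, hSa, ⟨hk1, hk2⟩, -⟩ := kernel_bounds h h0 hδ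
  have hL := one_sub_cos_pos h h0
  have e : kerZ δ α + kerZ (-δ) (-α) = cos α * cosh δ - 2 * (sinh δ ^ 2 * cothDer δ α) := by
    unfold kerZ kerV
    simp only [cothDer_neg, sinh_neg, neg_neg, cos_neg]
    rw [← cosh_add_sinh δ, ← cosh_sub_sinh δ]
    ring
  have hk0 : 0 ≤ cothDer δ α := by
    by_contra! hh
    have := mul_neg_of_neg_of_pos hh hL
    linarith
  have h1 : sinh δ ^ 2 * cothDer δ α ≤ 0.01 := by
    have hα2 : 0 < α ^ 2 := by positivity
    have h2 : (sinh δ * α) ^ 2 ≤ (0.06 * (1 - cos α)) ^ 2 :=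
      sq_le_sq' (by linarith [(abs_le.1 hSa).1]) (abs_le.1 hSa).2
    refine le_of_mul_le_mul_right (a := α ^ 2) ?_ hα2
    have h3 := one_sub_sq_div_two_le_cos (x := α)
    calc sinh δ ^ 2 * cothDer δ α * α ^ 2 = (sinh δ * α) ^ 2 * cothDer δ α := by ring
      _ ≤ (0.06 * (1 - cos α)) ^ 2 * cothDer δ α := by gcongr
      _ = 0.0036 * (1 - cos α) * (cothDer δ α * (1 - cos α)) := by ring
      _ ≤ 0.0036 * (1 - cos α) * 0.51 := by gcongr
      _ ≤ 0.01 * α ^ 2 := by nlinarith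
  have h2 : 0 ≤ sinh δ ^ 2 * cothDer δ α := by positivity
  have h3 := abs_le.1 (abs_mul_le_of_le (abs_cos_le_one α)
    (show |cosh δ| ≤ 1.001 by rw [abs_of_pos (cosh_pos _)]; exact hC2))
  rw [e, abs_le]
  constructor <;> linarith [h3.1, h3.2]

/-- Each boundary term is only O(1). After translating s in the one at -κ, the two combine into (q -
p) = O(κ) times a bounded quantity: the sums `kerW` δ α + `kerW` (-δ) (-α), and likewise for `kerZ`,
have no 1/α singularity. -/
lemma abs_boundary_integral_le (hu : IsC2Profile u u1 u2) (hu1 : ∀ s, |u1 s| ≤ 1 / 100) {K : ℝ}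
    (hK : ∀ s, |u2 s| ≤ K) {κ : ℝ} (hκ : 0 < κ) (hπ : κ ≤ π) :
    |∫ s in (-π)..π, u1 s * (energyBoundary u u1 s κ - energyBoundary u u1 s (-κ))| ≤
      7 * K * (2 * K + 1) * κ := by
  have hK0 : 0 ≤ K := (abs_nonneg _).trans (hK 0)
  have c0 := hu.cont
  have c1 := hu.cont1
  obtain ⟨a1, a2, a3, a4⟩ := abs_le_pi_of_mem hκ (⟨le_rfl, hπ⟩ : κ ∈ Icc κ π)
  have cont : ∀ α : ℝ, α ≠ 0 → |α| ≤ π → Continuous fun s => u1 s * energyBoundary u u1 s α := by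
    intro α h0 h1
    have hn : ∀ s, cosh (u s - u (s - α)) - cos α ≠ 0 := fun s => (den_pos _ h1 h0).ne'
    unfold energyBoundary kerZ kerW kerV cothDer cothRe cothIm den
    fun_prop (disch := assumption)
  have i1 := (cont κ a1 a2).intervalIntegrable (-π) π (μ := volume)
  have k2 := cont (-κ) a3 a4
  have i3 : IntervalIntegrable (fun s => u1 (s - κ) * energyBoundary u u1 (s - κ) (-κ)) volume (-π) π :=
    (k2.comp (continuous_sub_right κ)).intervalIntegrable _ _
  have per : Function.Periodic (fun s => u1 s * energyBoundary u u1 s (-κ)) (2 * π) := by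
    intro s
    have e : s + 2 * π - -κ = s - -κ + 2 * π := by ring
    unfold energyBoundary
    simp only [e, hu.per s, hu.per1 s, hu.per (s - -κ), hu.per1 (s - -κ)]
  simp_rw [mul_sub]
  rw [intervalIntegral.integral_sub i1 (k2.intervalIntegrable _ _), ← integral_shift per κ,
    ← intervalIntegral.integral_sub i1 i3, ← norm_eq_abs]
  refine (intervalIntegral.norm_integral_le_of_norm_le_const (C := K * κ * (2 * K + 1))
    (fun s _ => ?_)).trans ?_
  · have hδ := hu.abs_difference_le hu1 s κ
    have bW := abs_kerW_mul_le a2 a1 hδ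
    have bZ := abs_kerZ_mul_le a2 a1 hδ
    have bWW := abs_kerW_add_neg_le a2 a1 hδ
    have bZZ := abs_kerZ_add_neg_le a2 a1 hδ
    have hp := hu1 (s - κ)
    have hq := hu1 s
    have hη := hu.abs_sub_le1 hK s (s - κ)
    rw [sub_sub_cancel, abs_of_pos hκ] at hη
    unfold energyBoundary
    rw [sub_neg_eq_add, sub_add_cancel]
    rw [show u (s - κ) - u s = -(u s - u (s - κ)) by ring]
    rw [norm_eq_abs]
    set δ := u s - u (s - κ)
    set p := u1 (s - κ)
    set q := u1 s
    have e : q * ((q - p) * (kerW δ κ - (p + q) * kerZ δ κ))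
        - p * ((p - q) * (kerW (-δ) (-κ) - (q + p) * kerZ (-δ) (-κ))) =
        (q - p) * ((((q - p) * κ⁻¹) * (kerW δ κ * κ) + p * (kerW δ κ + kerW (-δ) (-κ)))
          - (p + q) * (((q - p) * κ⁻¹) * (kerZ δ κ * κ) + p * (kerZ δ κ + kerZ (-δ) (-κ)))) := by
      field_simp
      ring
    rw [e]
    have hηκ : |(q - p) * κ⁻¹| ≤ K := by
      rw [abs_mul, abs_of_pos (inv_pos.2 hκ), ← div_eq_mul_inv, div_le_iff₀ hκ]
      exact hη
    have t1 := (abs_add_le (((q - p) * κ⁻¹) * (kerW δ κ * κ)) (p * (kerW δ κ + kerW (-δ) (-κ)))).trans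
      (add_le_add (abs_mul_le_of_le hηκ bW) (abs_mul_le_of_le hp bWW))
    have t2 := (abs_add_le (((q - p) * κ⁻¹) * (kerZ δ κ * κ)) (p * (kerZ δ κ + kerZ (-δ) (-κ)))).trans
      (add_le_add (abs_mul_le_of_le hηκ bZ) (abs_mul_le_of_le hp bZZ))
    have t3 := abs_mul_le_of_le ((abs_add_le p q).trans (add_le_add hp hq)) t2
    exact abs_mul_le_of_le hη ((abs_sub _ _).trans (by linarith))
  · rw [sub_neg_eq_add, abs_of_pos (by linarith [pi_pos])]
    have h1 : 0 ≤ K * κ * (2 * K + 1) := by positivity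
    nlinarith [pi_lt_d2]

lemma continuousOn_dissipation_density {g : ℝ → ℝ} (hg : Continuous g) {κ : ℝ} (hκ : 0 < κ)
    (S : Set ℝ) :
    ContinuousOn (fun z : ℝ × ℝ => (g z.2 - g (z.2 - z.1)) ^ 2 / (1 - cos z.1)) (Icc κ π ×ˢ S) := by
  have hn : ∀ z ∈ Icc κ π ×ˢ S, 1 - cos z.1 ≠ 0 := by
    intro z hz
    obtain ⟨k1, k2, -, -⟩ := abs_le_pi_of_mem hκ hz.1
    exact (one_sub_cos_pos k2 k1).ne'
  fun_prop (disch := assumption)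

/-- The energy inequality for the truncated contour equation. -/
lemma integral_mul_contourInt_le (hu : IsC2Profile u u1 u2) (hu1 : ∀ s, |u1 s| ≤ 1 / 100) {K : ℝ}
    (hK : ∀ s, |u2 s| ≤ K) {κ : ℝ} (hκ : 0 < κ) (hπ : κ ≤ π) :
    ∫ s in (-π)..π, u2 s * contourInt u u1 κ s ≤
      -(0.29 * dissipation u1 κ) + 20 + 7 * K * (2 * K + 1) * κ := by
  have c0 := hu.cont
  have c1 := hu.cont1
  have hππ : -π ≤ π := by linarith [pi_pos]
  have b1 := abs_le.1 (abs_boundary_integral_le hu hu1 hK hκ hπ)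
  have k1 := continuousOn_dissipation_density c1 hκ (Icc (-π) π)
  have hn : ∀ z ∈ Icc κ π ×ˢ Icc (-π) π, den (u z.2 - u (z.2 - z.1)) z.1 ≠ 0 ∧
      den (-(u z.2 - u (z.2 - z.1))) (-z.1) ≠ 0 := by
    intro z hz
    obtain ⟨a1, a2, a3, a4⟩ := abs_le_pi_of_mem hκ hz.1
    exact ⟨(den_pos _ a2 a1).ne', (den_pos _ a4 a3).ne'⟩
  have k2 : ContinuousOn (fun z : ℝ × ℝ => symDissipation u u1 z.2 z.1) (Icc κ π ×ˢ Icc (-π) π) :=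
    ContinuousOn.mul (by fun_prop) (ContinuousOn.sub (ContinuousOn.mul (by fun_prop)
      (continuousOn_linKer (by fun_prop) (by fun_prop) (by fun_prop) (by fun_prop)
        fun z hz => (hn z hz).1)) (ContinuousOn.mul (by fun_prop)
      (continuousOn_linKer (by fun_prop) (by fun_prop) (by fun_prop) (by fun_prop)
        fun z hz => (hn z hz).2)))
  have slice : ∀ {F : ℝ × ℝ → ℝ}, ContinuousOn F (Icc κ π ×ˢ Icc (-π) π) → ∀ α ∈ Icc κ π,
      IntervalIntegrable (fun s => F (α, s)) volume (-π) π := fun hF α hα =>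
    intervalIntegrable_of_continuousOn_Icc hππ (hF.comp (by fun_prop) fun s hs => ⟨hα, hs⟩)
  have i1 : IntervalIntegrable (fun α => ∫ s in (-π)..π, (u1 s - u1 (s - α)) ^ 2 / (1 - cos α))
      volume κ π := intervalIntegrable_of_continuousOn_Icc hπ (continuousOn_intervalIntegral hππ
        (F := fun α s => (u1 s - u1 (s - α)) ^ 2 / (1 - cos α)) k1)
  have i2 : IntervalIntegrable (fun α => ∫ s in (-π)..π, symDissipation u u1 s α)
      volume κ π := intervalIntegrable_of_continuousOn_Icc hπ (continuousOn_intervalIntegral hππ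
        (F := fun α s => symDissipation u u1 s α) k2)
  -- The loss of 1 per point in the density integrates to at most 2π² ≤ 20.
  have main : 0.29 * dissipation u1 κ - 20 ≤
      ∫ α in κ..π, ∫ s in (-π)..π, u1 s * (linFun u u1 s α + linFun u u1 s (-α)) := by
    have e1 : ∫ α in κ..π, ∫ s in (-π)..π, u1 s * (linFun u u1 s α + linFun u u1 s (-α)) =
        ∫ α in κ..π, ∫ s in (-π)..π, symDissipation u u1 s α :=
      intervalIntegral.integral_congr fun α hα =>
        integral_linFun_eq hu hκ (by rwa [uIcc_of_le hπ] at hα)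
    rw [e1]
    have h1 : ∀ α ∈ Icc κ π, 0.29 * (∫ s in (-π)..π, (u1 s - u1 (s - α)) ^ 2 / (1 - cos α)) - 2 * π ≤
        ∫ s in (-π)..π, symDissipation u u1 s α := by
      intro α hα
      obtain ⟨a1, a2, -, -⟩ := abs_le_pi_of_mem hκ hα
      have j1 := slice k1 α hα
      have j2 := slice k2 α hα
      have := intervalIntegral.integral_mono_on hππ ((j1.const_mul 0.29).sub
        (intervalIntegrable_const (c := (1 : ℝ)))) j2 (fun s _ => le_symDissipation hu hu1 s a1 a2)
      rw [intervalIntegral.integral_sub (j1.const_mul _) intervalIntegrable_const,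
        intervalIntegral.integral_const_mul, intervalIntegral.integral_const] at this
      simp only [smul_eq_mul] at this
      linarith
    have h2 := intervalIntegral.integral_mono_on hπ ((i1.const_mul 0.29).sub
      (intervalIntegrable_const (c := 2 * π))) i2 h1
    rw [intervalIntegral.integral_sub (i1.const_mul _) intervalIntegrable_const,
      intervalIntegral.integral_const_mul, intervalIntegral.integral_const] at h2
    simp only [smul_eq_mul] at h2
    unfold dissipation
    nlinarith [pi_lt_d2, pi_pos]
  rw [integral_mul_contourInt hu hκ hπ]
  linarith [b1.2]

/-! ### Fourier analysis: the dissipation controls the H^{1/2} seminorm. -/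

/-- The Fourier coefficients on the circle, of a real function. -/
def coeff (f : ℝ → ℝ) (k : ℤ) : ℂ :=
  fourierCoeffOn (neg_lt_self Real.pi_pos) (fun s => (f s : ℂ)) k

lemma fourier_eq_exp (k : ℤ) (x : ℝ) :
    fourier (-k) (x : AddCircle (π - -π)) = Complex.exp (-((k * x : ℝ) * Complex.I)) := by
  rw [fourier_coe_apply]
  congr 1
  have : (π : ℂ) ≠ 0 := by exact_mod_cast pi_ne_zero
  push_cast
  field_simp
  ring

lemma coeff_eq_integral (f : ℝ → ℝ) (k : ℤ) :
    coeff f k = (1 / (2 * π) : ℝ) • ∫ x in (-π)..π, Complex.exp (-((k * x : ℝ) * Complex.I)) * f x := by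
  rw [coeff, fourierCoeffOn_eq_integral, show π - -π = 2 * π by ring]
  congr 1
  refine intervalIntegral.integral_congr fun x _ => ?_
  have := fourier_eq_exp k x
  rw [show π - -π = 2 * π by ring] at this
  simp only [smul_eq_mul, this]

lemma coeff_sub_translate {g : ℝ → ℝ} (hg : Continuous g) (hp : Function.Periodic g (2 * π)) (k : ℤ)
    (α : ℝ) : coeff (fun s => g s - g (s - α)) k =
      (1 - Complex.exp (-((k * α : ℝ) * Complex.I))) * coeff g k := by
  simp only [coeff_eq_integral]
  have per : Function.Periodic (fun x : ℝ => Complex.exp (-((k * x : ℝ) * Complex.I)) * g x) (2 * π) := by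
    intro x
    simp only [hp x]
    congr 1
    have : -(((k * (x + 2 * π) : ℝ) : ℂ) * Complex.I) =
        -((k * x : ℝ) * Complex.I) + (-k : ℤ) * (2 * π * Complex.I) := by
      push_cast; ring
    rw [this, Complex.exp_add, Complex.exp_int_mul_two_pi_mul_I, mul_one]
  have e2 : ∫ x in (-π)..π, Complex.exp (-((k * x : ℝ) * Complex.I)) * ((g x - g (x - α) : ℝ) : ℂ) =
      (∫ x in (-π)..π, Complex.exp (-((k * x : ℝ) * Complex.I)) * g x)
      - Complex.exp (-((k * α : ℝ) * Complex.I)) *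
        ∫ x in (-π)..π, Complex.exp (-((k * x : ℝ) * Complex.I)) * g x := by
    conv_rhs => rw [← integral_shift per α]
    conv_rhs => enter [1]; rw [integral_shift per α]
    rw [← intervalIntegral.integral_const_mul, ← intervalIntegral.integral_sub
      (Continuous.intervalIntegrable (by fun_prop) _ _)
      (Continuous.intervalIntegrable (by fun_prop) _ _)]
    refine intervalIntegral.integral_congr fun x _ => ?_
    have : Complex.exp (-((k * x : ℝ) * Complex.I)) = Complex.exp (-((k * α : ℝ) * Complex.I)) *
        Complex.exp (-((k * (x - α) : ℝ) * Complex.I)) := by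
      rw [← Complex.exp_add]
      congr 1
      push_cast
      ring
    rw [← mul_assoc, ← this]
    push_cast
    ring
  rw [e2, Complex.real_smul, Complex.real_smul]
  ring

lemma norm_one_sub_exp_sq (x : ℝ) : ‖1 - Complex.exp (-((x : ℝ) * Complex.I))‖ ^ 2 = 2 * (1 - cos x) := by
  rw [show -((x : ℂ) * Complex.I) = ((-x : ℝ) : ℂ) * Complex.I by push_cast; ring,
    Complex.exp_mul_I, ← Complex.ofReal_cos, ← Complex.ofReal_sin, cos_neg, sin_neg,
    ← Complex.normSq_eq_norm_sq, Complex.normSq_apply]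
  simp only [Complex.sub_re, Complex.sub_im, Complex.add_re, Complex.add_im, Complex.one_re, Complex.one_im,
    Complex.mul_re, Complex.mul_im, Complex.ofReal_re, Complex.ofReal_im, Complex.I_re, Complex.I_im]
  nlinarith [sin_sq_add_cos_sq x]

lemma coeff_deriv {f f1 : ℝ → ℝ} (hf : ∀ s, HasDerivAt f (f1 s) s) (hp : Function.Periodic f (2 * π))
    (hf1 : Continuous f1) (k : ℤ) : ‖coeff f1 k‖ = |(k : ℝ)| * ‖coeff f k‖ := by
  have hfc : Continuous f := continuous_iff_continuousAt.2 fun s => (hf s).continuousAt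
  have e := intervalIntegral.integral_mul_deriv_eq_deriv_mul (a := -π) (b := π)
    (u := fun x : ℝ => Complex.exp (-((k * x : ℝ) * Complex.I)))
    (u' := fun x : ℝ => Complex.exp (-((k * x : ℝ) * Complex.I)) * -(k * Complex.I))
    (v := fun x => (f x : ℂ)) (v' := fun x => (f1 x : ℂ))
    (fun x _ => by
      have h1 : HasDerivAt (fun x : ℝ => -(((k * x : ℝ) : ℂ) * Complex.I)) (-(k * Complex.I)) x := by
        have := (((hasDerivAt_id x).const_mul (k : ℝ)).ofReal_comp.mul_const Complex.I).neg
        refine HasDerivAt.congr_deriv this ?_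
        push_cast
        ring
      exact h1.cexp)
    (fun x _ => (hf x).ofReal_comp)
    (Continuous.intervalIntegrable (by fun_prop) _ _) (Continuous.intervalIntegrable (by fun_prop) _ _)
  have hb : f π = f (-π) := by
    have := hp (-π); rwa [show -π + 2 * π = π by ring] at this
  have he : Complex.exp (-((k * π : ℝ) * Complex.I)) = Complex.exp (-((k * (-π) : ℝ) * Complex.I)) := by
    have : -(((k * π : ℝ) : ℂ) * Complex.I) =
        -((k * (-π) : ℝ) * Complex.I) + (-k : ℤ) * (2 * π * Complex.I) := by
      push_cast; ring
    rw [this, Complex.exp_add, Complex.exp_int_mul_two_pi_mul_I, mul_one]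
  rw [hb, he, sub_self, zero_sub] at e
  have e3 : ∫ x in (-π)..π, Complex.exp (-((k * x : ℝ) * Complex.I)) * -(k * Complex.I) * f x =
      -(k * Complex.I) * ∫ x in (-π)..π, Complex.exp (-((k * x : ℝ) * Complex.I)) * f x := by
    rw [← intervalIntegral.integral_const_mul]
    refine intervalIntegral.integral_congr fun x _ => ?_
    ring
  rw [coeff_eq_integral, coeff_eq_integral, e, e3, norm_smul, norm_smul, norm_neg, norm_mul, norm_neg,
    norm_mul, Complex.norm_I, Complex.norm_intCast]
  ring

lemma sum_norm_coeff_sq_le {g : ℝ → ℝ} (hg : Continuous g) (S : Finset ℤ) :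
    ∑ k ∈ S, ‖coeff g k‖ ^ 2 ≤ 1 / (2 * π) * ∫ s in (-π)..π, g s ^ 2 := by
  have hL : MemLp (fun s => (g s : ℂ)) 2 (volume.restrict (Ioc (-π) π)) := by
    have : Continuous fun s => (g s : ℂ) := by fun_prop
    obtain ⟨C, hC⟩ := (isCompact_Icc (a := -π) (b := π)).exists_bound_of_continuousOn this.continuousOn
    exact MemLp.of_bound this.aestronglyMeasurable C
      ((ae_restrict_iff' measurableSet_Ioc).2 (ae_of_all _ fun x hx => hC x (Ioc_subset_Icc_self hx)))
  have h := hasSum_sq_fourierCoeffOn (neg_lt_self pi_pos) hL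
  have h2 := sum_le_hasSum S (fun k _ => sq_nonneg _) h
  refine h2.trans (le_of_eq ?_)
  rw [smul_eq_mul, show π - -π = 2 * π by ring, one_div]
  congr 1
  refine intervalIntegral.integral_congr fun x _ => ?_
  simp

/-- Only the window π/(2|k|) ≤ α ≤ π/|k| is used: there cos (kα) ≤ 0 and 1 - cos α ≤ α²/2, so the
integrand is at least 4k²/π². The condition on κ says that the truncation does not cut this window.
-/
lemma le_integral_weight {k : ℤ} {κ : ℝ} (hk : k ≠ 0) (hκ : 0 < κ) (h : κ * (2 * |(k : ℝ)|) ≤ π) :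
    2 * |(k : ℝ)| / π ≤ ∫ α in κ..π, 2 * (1 - cos (k * α)) / (1 - cos α) := by
  have hk1 : 1 ≤ |(k : ℝ)| := by exact_mod_cast Int.one_le_abs hk
  set m := |(k : ℝ)| with hm
  have hm0 : 0 < m := by linarith
  have h1 : κ ≤ π / (2 * m) := by rwa [le_div_iff₀ (by positivity)]
  have h2 : π / (2 * m) ≤ π / m := by
    apply div_le_div_of_nonneg_left pi_pos.le hm0; linarith
  have h3 : π / m ≤ π := div_le_self pi_pos.le hk1
  have hcont : ContinuousOn (fun α => 2 * (1 - cos (k * α)) / (1 - cos α)) (Icc κ π) := by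
    have hn : ∀ α ∈ Icc κ π, 1 - cos α ≠ 0 := by
      intro α hα
      obtain ⟨k1, k2, -, -⟩ := abs_le_pi_of_mem hκ hα
      exact (one_sub_cos_pos k2 k1).ne'
    fun_prop (disch := assumption)
  have hint : ∀ {a b}, κ ≤ a → a ≤ b → b ≤ π → IntervalIntegrable
      (fun α => 2 * (1 - cos (k * α)) / (1 - cos α)) volume a b := fun ha hab hb =>
    intervalIntegrable_of_continuousOn_Icc hab (hcont.mono (Icc_subset_Icc ha hb))
  have hnn : ∀ α, 0 ≤ 2 * (1 - cos (k * α)) / (1 - cos α) := fun α =>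
    div_nonneg (by linarith [cos_le_one (k * α)]) (by linarith [cos_le_one α])
  have i1 := hint le_rfl h1 (h2.trans h3)
  have i2 := hint h1 h2 h3
  have i3 := hint (h1.trans h2) h3 le_rfl
  rw [← intervalIntegral.integral_add_adjacent_intervals (i1.trans i2) i3,
    ← intervalIntegral.integral_add_adjacent_intervals i1 i2]
  have n1 := intervalIntegral.integral_nonneg (μ := volume) h1 (fun α _ => hnn α)
  have n3 := intervalIntegral.integral_nonneg (μ := volume) h3 (fun α _ => hnn α)
  have mid : ∀ α ∈ Icc (π / (2 * m)) (π / m), 4 * m ^ 2 / π ^ 2 ≤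
      2 * (1 - cos (k * α)) / (1 - cos α) := by
    intro α hα
    have hα0 : 0 < α := lt_of_lt_of_le (by positivity) hα.1
    have hL := one_sub_cos_pos (α := α) (by rw [abs_of_pos hα0]; exact hα.2.trans h3) hα0.ne'
    have hc : cos (k * α) ≤ 0 := by
      rw [← cos_abs, abs_mul, abs_of_pos hα0, ← hm]
      apply cos_nonpos_of_pi_div_two_le_of_le
      · have := (div_le_iff₀ (by positivity)).1 hα.1
        linarith
      · have := (le_div_iff₀ hm0).1 hα.2
        linarith [pi_pos]
    rw [div_le_div_iff₀ (by positivity) hL]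
    have e1 : 1 - cos α ≤ α ^ 2 / 2 := by linarith [one_sub_sq_div_two_le_cos (x := α)]
    have e2 : (m * α) ^ 2 ≤ π ^ 2 := by
      have := (le_div_iff₀ hm0).1 hα.2
      gcongr
      linarith
    have e3 : 4 * m ^ 2 * (1 - cos α) ≤ 4 * m ^ 2 * (α ^ 2 / 2) := by gcongr
    nlinarith [sq_nonneg π]
  have n2 := intervalIntegral.integral_mono_on h2 (intervalIntegrable_const (c := 4 * m ^ 2 / π ^ 2))
    i2 mid
  rw [intervalIntegral.integral_const, smul_eq_mul] at n2
  have e : (π / m - π / (2 * m)) * (4 * m ^ 2 / π ^ 2) = 2 * m / π := by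
    have := pi_ne_zero
    field_simp
    ring
  linarith

/-- Bessel's inequality for g - g(· - α) at each α, integrated in α, gives the weights of
`le_integral_weight`. The value κ = π/(2n) is the largest admissible for all |k| ≤ n. -/
lemma sum_abs_mul_norm_coeff_sq_le {g : ℝ → ℝ} (hg : Continuous g)
    (hp : Function.Periodic g (2 * π)) {n : ℕ} (hn : 0 < n) :
    ∑ k ∈ Finset.Icc (-(n : ℤ)) n, |(k : ℝ)| * ‖coeff g k‖ ^ 2 ≤ dissipation g (π / (2 * n)) := by
  set κ := π / (2 * n) with hκdef
  have hn' : (1 : ℝ) ≤ n := by exact_mod_cast hn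
  have hκ : 0 < κ := by have := pi_pos; positivity
  have hππ : -π ≤ π := by linarith [pi_pos]
  have hκπ : κ ≤ π := div_le_self pi_pos.le (by linarith)
  have cont : ∀ k : ℤ, ContinuousOn (fun α => 2 * (1 - cos (k * α)) / (1 - cos α)) (Icc κ π) := by
    intro k
    have hn : ∀ α ∈ Icc κ π, 1 - cos α ≠ 0 := by
      intro α hα
      obtain ⟨k1, k2, -, -⟩ := abs_le_pi_of_mem hκ hα
      exact (one_sub_cos_pos k2 k1).ne'
    fun_prop (disch := assumption)
  have i1 : ∀ k : ℤ, IntervalIntegrable (fun α => 2 * (1 - cos (k * α)) / (1 - cos α)) volume κ π :=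
    fun k => intervalIntegrable_of_continuousOn_Icc hκπ (cont k)
  have i2 : IntervalIntegrable (fun α => ∫ s in (-π)..π, (g s - g (s - α)) ^ 2 / (1 - cos α))
      volume κ π := intervalIntegrable_of_continuousOn_Icc hκπ (continuousOn_intervalIntegral hππ
        (F := fun α s => (g s - g (s - α)) ^ 2 / (1 - cos α))
        (continuousOn_dissipation_density hg hκ (Icc (-π) π)))
  have point : ∀ α ∈ Icc κ π, ∑ k ∈ Finset.Icc (-(n : ℤ)) n,
      ‖coeff g k‖ ^ 2 * (2 * (1 - cos (k * α)) / (1 - cos α)) ≤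
      1 / (2 * π) * ∫ s in (-π)..π, (g s - g (s - α)) ^ 2 / (1 - cos α) := by
    intro α hα
    obtain ⟨k1, k2, -, -⟩ := abs_le_pi_of_mem hκ hα
    have hL := one_sub_cos_pos k2 k1
    have h1 := sum_norm_coeff_sq_le (g := fun s => g s - g (s - α)) (by fun_prop)
      (Finset.Icc (-(n : ℤ)) n)
    simp_rw [coeff_sub_translate hg hp, norm_mul, mul_pow, norm_one_sub_exp_sq] at h1
    rw [intervalIntegral.integral_div]
    calc _ = (∑ k ∈ Finset.Icc (-(n : ℤ)) n, 2 * (1 - cos (k * α)) * ‖coeff g k‖ ^ 2) / (1 - cos α) := by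
          rw [Finset.sum_div]
          refine Finset.sum_congr rfl fun k _ => ?_
          ring
      _ ≤ (1 / (2 * π) * ∫ s in (-π)..π, (g s - g (s - α)) ^ 2) / (1 - cos α) := by gcongr
      _ = _ := by ring
  have h2 := intervalIntegral.integral_mono_on hκπ
    (IntervalIntegrable.sum (Finset.Icc (-(n : ℤ)) n) fun k _ => (i1 k).const_mul (‖coeff g k‖ ^ 2))
    (i2.const_mul (1 / (2 * π))) (fun α hα => by simpa using point α hα)
  rw [intervalIntegral.integral_const_mul] at h2
  have h3 : ∑ k ∈ Finset.Icc (-(n : ℤ)) n, ‖coeff g k‖ ^ 2 * (2 * |(k : ℝ)| / π) ≤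
      1 / (2 * π) * dissipation g κ := by
    refine le_trans ?_ h2
    simp only [Finset.sum_apply]
    rw [intervalIntegral.integral_finsetSum (fun k _ => (i1 k).const_mul (‖coeff g k‖ ^ 2))]
    refine Finset.sum_le_sum fun k hk => ?_
    rw [intervalIntegral.integral_const_mul]
    refine mul_le_mul_of_nonneg_left ?_ (sq_nonneg _)
    rcases eq_or_ne k 0 with rfl | hk0
    · simp
    · refine le_integral_weight hk0 hκ ?_
      have hkn : |(k : ℝ)| ≤ n := by
        rw [Finset.mem_Icc] at hk
        rw [abs_le]
        exact ⟨by exact_mod_cast hk.1, by exact_mod_cast hk.2⟩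
      calc κ * (2 * |(k : ℝ)|) ≤ κ * (2 * n) := by gcongr
        _ = π := by rw [hκdef]; field_simp
  have h4 : ∑ k ∈ Finset.Icc (-(n : ℤ)) n, ‖coeff g k‖ ^ 2 * (2 * |(k : ℝ)| / π) =
      4 * (1 / (2 * π)) * ∑ k ∈ Finset.Icc (-(n : ℤ)) n, |(k : ℝ)| * ‖coeff g k‖ ^ 2 := by
    rw [Finset.mul_sum]
    refine Finset.sum_congr rfl fun k _ => ?_
    ring
  have h5 : 0 ≤ ∑ k ∈ Finset.Icc (-(n : ℤ)) n, |(k : ℝ)| * ‖coeff g k‖ ^ 2 :=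
    Finset.sum_nonneg fun k _ => by positivity
  have hπ0 : 0 < 1 / (2 * π) := by have := pi_pos; positivity
  refine le_of_mul_le_mul_left (a := 1 / (2 * π)) ?_ hπ0
  nlinarith [mul_nonneg hπ0.le h5]

/-- For integers k one has (1 + k²)^{3/2} ≤ 1 + 3|k|³, and the derivative accounts for two of the
three powers of |k|. -/
lemma norm_besselCoeff_sq_le {f f1 f2 : ℝ → ℝ} (hf : IsC2Profile f f1 f2) (k : ℤ) :
    ‖besselCoeff (3 / 2) f k‖ ^ 2 ≤ ‖coeff f k‖ ^ 2 + 3 * (|(k : ℝ)| * ‖coeff f1 k‖ ^ 2) := by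
  rw [coeff_deriv hf.d1 hf.per hf.cont1]
  change ‖((1 + (k : ℝ) ^ 2) ^ ((3 / 2 : ℝ) / 2) : ℝ) * coeff f k‖ ^ 2 ≤ _
  have hk : 0 < 1 + (k : ℝ) ^ 2 := by positivity
  rw [norm_mul, Complex.norm_real, norm_eq_abs, abs_of_pos (rpow_pos_of_pos hk _), mul_pow,
    ← rpow_natCast, ← rpow_mul hk.le]
  rcases eq_or_ne k 0 with rfl | hk0
  · simp
  have hk1 : 1 ≤ |(k : ℝ)| := by exact_mod_cast Int.one_le_abs hk0
  have e : (3 / 2 / 2 * ((2 : ℕ) : ℝ) : ℝ) = 1 + 1 / 2 := by norm_num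
  rw [e, rpow_add hk, rpow_one, ← sqrt_eq_rpow]
  have h1 : √(1 + (k : ℝ) ^ 2) ≤ 1.5 * |(k : ℝ)| := by
    rw [sqrt_le_left (by positivity)]
    nlinarith [sq_abs (k : ℝ)]
  have h2 : 1 + (k : ℝ) ^ 2 ≤ 2 * |(k : ℝ)| ^ 2 := by nlinarith [sq_abs (k : ℝ)]
  have h3 : (1 + (k : ℝ) ^ 2) * √(1 + (k : ℝ) ^ 2) ≤ 2 * |(k : ℝ)| ^ 2 * (1.5 * |(k : ℝ)|) :=
    mul_le_mul h2 h1 (sqrt_nonneg _) (by positivity)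
  have h4 : 0 ≤ ‖coeff f k‖ ^ 2 := sq_nonneg _
  nlinarith

lemma sum_norm_besselCoeff_sq_le {f f1 f2 : ℝ → ℝ} (hf : IsC2Profile f f1 f2) {n : ℕ} (hn : 0 < n) :
    ∑ k ∈ Finset.Icc (-(n : ℤ)) n, ‖besselCoeff (3 / 2) f k‖ ^ 2 ≤
      1 / (2 * π) * (∫ s in (-π)..π, f s ^ 2) + 3 * dissipation f1 (π / (2 * n)) := by
  refine (Finset.sum_le_sum fun k _ => norm_besselCoeff_sq_le hf k).trans ?_
  rw [Finset.sum_add_distrib, ← Finset.mul_sum]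
  exact add_le_add (sum_norm_coeff_sq_le hf.cont _)
    (mul_le_mul_of_nonneg_left (sum_abs_mul_norm_coeff_sq_le hf.cont1 hf.per1 hn) (by norm_num))

/-! ### The parabolic maximum principle and compactness in space-time. -/

lemma exists_mem_Icc_of_periodic {X : Type*} {f : ℝ → X} (hf : Function.Periodic f (2 * π)) (s : ℝ) :
    ∃ x ∈ Icc 0 (2 * π), f s = f x := by
  obtain ⟨x, hx, h⟩ := hf.exists_mem_Ico₀ (by positivity) s
  exact ⟨x, Ico_subset_Icc_self hx, h⟩

/-- A parabolic maximum principle on the circle: a bound for the time derivative at spatial maxima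
bounds the growth of the maximum. -/
lemma le_add_mul_of_deriv_le_at_max_Ioc {φ v : ℝ → ℝ → ℝ} {A C T : ℝ}
    (hc : ContinuousOn (fun z : ℝ × ℝ => φ z.1 z.2) (Icc 0 T ×ˢ univ))
    (hp : ∀ t ∈ Icc 0 T, Function.Periodic (φ t) (2 * π))
    (hd : ∀ t ∈ Ioc 0 T, ∀ s, HasDerivAt (fun τ => φ τ s) (v t s) t)
    (hv : ∀ t ∈ Ioc 0 T, ∀ s, (∀ x, φ t x ≤ φ t s) → v t s ≤ C)
    (hA : ∀ s, φ 0 s ≤ A) {t : ℝ} (ht : t ∈ Icc 0 T) (s : ℝ) : φ t s ≤ A + C * t := by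
  -- The extra slope makes the inequality strict, so that a maximum at a positive time is
  -- contradictory.
  suffices H : ∀ lam > 0, φ t s ≤ A + C * t + lam * t by
    refine le_of_forall_pos_le_add fun e he => ?_
    have h1 : 0 < t + 1 := by linarith [ht.1]
    refine (H (e / (t + 1)) (by positivity)).trans ?_
    have : e / (t + 1) * t ≤ e := by
      rw [div_mul_eq_mul_div, div_le_iff₀ h1]
      nlinarith
    linarith
  intro lam hlam
  have hK : IsCompact (Icc 0 T ×ˢ Icc 0 (2 * π)) := isCompact_Icc.prod isCompact_Icc
  obtain ⟨x, hx, hsx⟩ := exists_mem_Icc_of_periodic (hp t ht) s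
  have hψ : ContinuousOn (fun z : ℝ × ℝ => φ z.1 z.2 - (C + lam) * z.1) (Icc 0 T ×ˢ Icc 0 (2 * π)) :=
    (hc.mono (prod_mono_right (subset_univ _))).sub (by fun_prop)
  obtain ⟨⟨t', s'⟩, hm, hmax⟩ := hK.exists_isMaxOn ⟨(t, x), ht, hx⟩ hψ
  obtain ⟨ht', hs'⟩ := hm
  dsimp only at ht' hs'
  have hmax' : ∀ τ ∈ Icc 0 T, ∀ y, φ τ y - (C + lam) * τ ≤ φ t' s' - (C + lam) * t' := by
    intro τ hτ y
    obtain ⟨y', hy', e⟩ := exists_mem_Icc_of_periodic (hp τ hτ) y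
    rw [e]
    exact hmax (show (τ, y') ∈ Icc 0 T ×ˢ Icc 0 (2 * π) from ⟨hτ, hy'⟩)
  rcases ht'.1.eq_or_lt with h0 | h0
  · have h1 := hmax' t ht s
    rw [← h0] at h1
    have := hA s'
    linarith
  · exfalso
    have hv' := hv t' ⟨h0, ht'.2⟩ s' fun y => by linarith [hmax' t' ht' y]
    have hder : HasDerivAt (fun τ => φ τ s' - (C + lam) * τ) (v t' s' - (C + lam)) t' := by
      have := (hd t' ⟨h0, ht'.2⟩ s').sub ((hasDerivAt_id t').const_mul (C + lam))
      rw [mul_one] at this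
      exact this
    -- Only times up to t' are compared, so that t' may be the final time.
    have hloc : IsLocalMaxOn (fun τ => φ τ s' - (C + lam) * τ) (Icc 0 t') t' := by
      refine IsMaxOn.localize fun τ hτ => ?_
      exact hmax' τ ⟨hτ.1, hτ.2.trans ht'.2⟩ s'
    have := hloc.hasFDerivWithinAt_nonpos hder.hasFDerivAt.hasFDerivWithinAt
      (sub_mem_posTangentConeAt_of_segment_subset (x := t') (y := 0) (by
        rw [segment_symm, segment_eq_Icc h0.le]))
    simp only [ContinuousLinearMap.toSpanSingleton_apply, smul_eq_mul, zero_sub] at this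
    nlinarith

/-- An inequality between continuous functions extends to the end of a time interval. -/
lemma le_of_forall_Ico_le {f g : ℝ → ℝ} {a b : ℝ} (hab : a < b) (hf : ContinuousOn f (Icc a b))
    (hg : ContinuousOn g (Icc a b)) (h : ∀ t ∈ Ico a b, f t ≤ g t) : f b ≤ g b := by
  have hb : b ∈ Icc a b := right_mem_Icc.2 hab.le
  exact ContinuousWithinAt.closure_le (s := Ico a b) (by rwa [closure_Ico hab.ne])
    ((hf b hb).mono Ico_subset_Icc_self) ((hg b hb).mono Ico_subset_Icc_self) h

lemma continuousOn_time {φ : ℝ → ℝ → ℝ} {I : Set ℝ}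
    (hc : ContinuousOn (fun z : ℝ × ℝ => φ z.1 z.2) (I ×ˢ univ)) (s : ℝ) :
    ContinuousOn (fun t => φ t s) I :=
  hc.comp (f := fun t => (t, s)) (by fun_prop) fun _ ht => ⟨ht, mem_univ _⟩

/-- Since T may be the end of the existence interval, where no equation is assumed, the maximum
principle is applied up to each earlier time and the bound at T follows by continuity. -/
lemma le_add_mul_of_deriv_le_at_max {φ v : ℝ → ℝ → ℝ} {A C T : ℝ}
    (hc : ContinuousOn (fun z : ℝ × ℝ => φ z.1 z.2) (Icc 0 T ×ˢ univ))
    (hp : ∀ t ∈ Icc 0 T, Function.Periodic (φ t) (2 * π))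
    (hd : ∀ t ∈ Ioo 0 T, ∀ s, HasDerivAt (fun τ => φ τ s) (v t s) t)
    (hv : ∀ t ∈ Ioo 0 T, ∀ s, (∀ x, φ t x ≤ φ t s) → v t s ≤ C)
    (hA : ∀ s, φ 0 s ≤ A) {t : ℝ} (ht : t ∈ Icc 0 T) (s : ℝ) : φ t s ≤ A + C * t := by
  have key : ∀ t ∈ Ico 0 T, φ t s ≤ A + C * t := fun t ht => by
    have hsub : Icc 0 t ⊆ Icc 0 T := Icc_subset_Icc_right ht.2.le
    have hsub' : Ioc 0 t ⊆ Ioo 0 T := fun x hx => ⟨hx.1, hx.2.trans_lt ht.2⟩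
    exact le_add_mul_of_deriv_le_at_max_Ioc (hc.mono (prod_mono_left hsub))
      (fun t ht => hp t (hsub ht)) (fun t ht => hd t (hsub' ht)) (fun t ht => hv t (hsub' ht)) hA
      (right_mem_Icc.2 ht.1) s
  rcases ht.2.lt_or_eq with h | rfl
  · exact key t ⟨ht.1, h⟩
  rcases ht.1.eq_or_lt with h | h
  · rw [← h]
    linarith [hA s]
  · exact le_of_forall_Ico_le h (continuousOn_time hc s) (by fun_prop) key

lemma exists_abs_le_of_continuousOn_periodic {φ : ℝ → ℝ → ℝ} {T : ℝ}
    (hc : ContinuousOn (fun z : ℝ × ℝ => φ z.1 z.2) (Icc 0 T ×ˢ univ))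
    (hp : ∀ t ∈ Icc 0 T, Function.Periodic (φ t) (2 * π)) :
    ∃ K : ℝ, ∀ t ∈ Icc 0 T, ∀ s, |φ t s| ≤ K := by
  obtain ⟨K, hK⟩ := (isCompact_Icc.prod isCompact_Icc).exists_bound_of_continuousOn
    (hc.mono (prod_mono_right (subset_univ (Icc 0 (2 * π)))))
  refine ⟨K, fun t ht s => ?_⟩
  obtain ⟨x, hx, e⟩ := exists_mem_Icc_of_periodic (hp t ht) s
  rw [e]
  exact hK (t, x) ⟨ht, hx⟩

lemma exists_pos_le_of_continuousOn_periodic {φ : ℝ → ℝ → ℝ} {T : ℝ}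
    (hc : ContinuousOn (fun z : ℝ × ℝ => φ z.1 z.2) (Icc 0 T ×ˢ univ))
    (hp : ∀ t ∈ Icc 0 T, Function.Periodic (φ t) (2 * π)) (hpos : ∀ t ∈ Icc 0 T, ∀ s, 0 < φ t s) :
    ∃ m > 0, ∀ t ∈ Icc 0 T, ∀ s, m ≤ φ t s := by
  obtain ⟨K, hK⟩ := exists_abs_le_of_continuousOn_periodic (φ := fun t s => (φ t s)⁻¹)
    (hc.inv₀ fun z hz => (hpos z.1 hz.1 z.2).ne') (fun t ht s => by simp only [hp t ht s])
  refine ⟨(max K 1)⁻¹, by positivity, fun t ht s => ?_⟩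
  have h1 := hpos t ht s
  rw [inv_le_comm₀ (by positivity) h1]
  exact (le_abs_self _).trans ((hK t ht s).trans (le_max_left _ _))

lemma exists_modulus_of_continuousOn_periodic {φ : ℝ → ℝ → ℝ} {T : ℝ}
    (hc : ContinuousOn (fun z : ℝ × ℝ => φ z.1 z.2) (Icc 0 T ×ˢ univ))
    (hp : ∀ t ∈ Icc 0 T, Function.Periodic (φ t) (2 * π)) {η : ℝ} (hη : 0 < η) :
    ∃ ε > 0, ∀ t ∈ Icc 0 T, ∀ s a, |a| ≤ ε → |φ t (s + a) - φ t s| ≤ η := by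
  have hu := (isCompact_Icc.prod isCompact_Icc).uniformContinuousOn_of_continuous
    (hc.mono (prod_mono_right (subset_univ (Icc (-1) (2 * π + 1)))))
  obtain ⟨δ, hδ, H⟩ := Metric.uniformContinuousOn_iff.1 hu η hη
  refine ⟨min (δ / 2) 1, by positivity, fun t ht s a ha => ?_⟩
  have ha1 := ha.trans (min_le_left _ _)
  have ha2 := abs_le.1 (ha.trans (min_le_right _ _))
  obtain ⟨x, hx, e⟩ := exists_mem_Icc_of_periodic
    (f := fun s => (φ t (s + a), φ t s)) (fun s => by
      simp only [Prod.mk.injEq]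
      exact ⟨by rw [add_right_comm]; exact hp t ht _, hp t ht s⟩) s
  simp only [Prod.mk.injEq] at e
  rw [e.1, e.2]
  have := H (t, x + a) ⟨ht, by constructor <;> linarith [hx.1, hx.2, ha2.1, ha2.2]⟩ (t, x)
    ⟨ht, by constructor <;> linarith [hx.1, hx.2]⟩ (by
      rw [Prod.dist_eq]
      simp only [dist_self, dist_eq, add_sub_cancel_left]
      rw [max_lt_iff]
      exact ⟨hδ, by linarith⟩)
  exact this.le

/-! ### Solution paths and propagation of the amplitude and slope bounds. -/

/-- A time-dependent periodic `C²` profile on `[0, T]`, jointly continuous with its first two spatial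
derivatives. -/
structure IsC2Path (T : ℝ) (f f1 f2 : ℝ → ℝ → ℝ) : Prop where
  profile : ∀ t ∈ Icc 0 T, IsC2Profile (f t) (f1 t) (f2 t)
  continuousOn : ContinuousOn (fun z : ℝ × ℝ => f z.1 z.2) (Icc 0 T ×ˢ univ)
  continuousOn1 : ContinuousOn (fun z : ℝ × ℝ => f1 z.1 z.2) (Icc 0 T ×ˢ univ)
  continuousOn2 : ContinuousOn (fun z : ℝ × ℝ => f2 z.1 z.2) (Icc 0 T ×ˢ univ)

lemma IsC2Path.mono {T T' : ℝ} {f f1 f2 : ℝ → ℝ → ℝ} (h : IsC2Path T f f1 f2) (hT : T' ≤ T) :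
    IsC2Path T' f f1 f2 :=
  have hs : Icc 0 T' ⊆ Icc 0 T := Icc_subset_Icc_right hT
  ⟨fun t ht => h.profile t (hs ht), h.continuousOn.mono (prod_mono_left hs),
    h.continuousOn1.mono (prod_mono_left hs), h.continuousOn2.mono (prod_mono_left hs)⟩

lemma IsC2Path.log_one_add {T : ℝ} {f f1 f2 : ℝ → ℝ → ℝ} (h : IsC2Path T f f1 f2)
    (hpos : ∀ t ∈ Icc 0 T, ∀ s, 0 < 1 + f t s) :
    IsC2Path T (fun t s => log (1 + f t s)) (fun t s => f1 t s / (1 + f t s))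
      (fun t s => f2 t s / (1 + f t s) - (f1 t s / (1 + f t s)) ^ 2) := by
  have h0 := h.continuousOn
  have h1 := h.continuousOn1
  have h2 := h.continuousOn2
  have hn : ∀ z ∈ Icc 0 T ×ˢ (univ : Set ℝ), 1 + f z.1 z.2 ≠ 0 := fun z hz => (hpos z.1 hz.1 z.2).ne'
  refine ⟨fun t ht => (h.profile t ht).log_one_add (hpos t ht), ?_, ?_, ?_⟩
  · fun_prop (disch := assumption)
  · fun_prop (disch := assumption)
  · fun_prop (disch := assumption)

lemma IsC2Path.exists_profileBounds {T : ℝ} {f f1 f2 : ℝ → ℝ → ℝ} (h : IsC2Path T f f1 f2)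
    (hpos : ∀ t ∈ Icc 0 T, ∀ s, 0 < 1 + f t s) :
    ∃ M, ∀ t ∈ Icc 0 T, ProfileBounds M (f t) (f1 t) (f2 t) := by
  obtain ⟨m, hm0, hm⟩ := exists_pos_le_of_continuousOn_periodic (φ := fun t s => 1 + f t s)
    (continuousOn_const.add h.continuousOn) (fun t ht s => by simp only [(h.profile t ht).per s]) hpos
  obtain ⟨K0, hK0⟩ := exists_abs_le_of_continuousOn_periodic h.continuousOn
    (fun t ht => (h.profile t ht).per)
  obtain ⟨K1, hK1⟩ := exists_abs_le_of_continuousOn_periodic h.continuousOn1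
    (fun t ht => (h.profile t ht).per1)
  obtain ⟨K2, hK2⟩ := exists_abs_le_of_continuousOn_periodic h.continuousOn2
    (fun t ht => (h.profile t ht).per2)
  refine ⟨1 + 1 / m + |K0| + |K1| + |K2|, fun t ht => ?_⟩
  have p := one_div_pos.2 hm0
  have p0 := abs_nonneg K0
  have p1 := abs_nonneg K1
  have p2 := abs_nonneg K2
  refine ⟨by linarith, fun s => ?_, fun s => ?_, fun s => ?_, fun s => ?_⟩
  · calc (1 : ℝ) = 1 / m * m := by field_simp
      _ ≤ _ := mul_le_mul (by linarith) (hm t ht s) hm0.le (by positivity)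
  · linarith [(le_abs_self _).trans (hK0 t ht s), le_abs_self K0]
  · linarith [hK1 t ht s, le_abs_self K1]
  · linarith [hK2 t ht s, le_abs_self K2]

/-- This is the error of the trapezoidal rule for f'' on [s, s + ε], divided by ε/2; the modulus of
continuity of f'' controls it. -/
lemma IsC2Profile.abs_add_sub_slope_le {f f1 f2 : ℝ → ℝ} (h : IsC2Profile f f1 f2) {ε δ η : ℝ}
    (h0 : ε ≠ 0) (hε : |ε| ≤ δ) (hη : ∀ s a, |a| ≤ δ → |f2 (s + a) - f2 s| ≤ η) (s : ℝ) :
    |f2 (s + ε) + f2 s - 2 * ((f1 (s + ε) - f1 s) / ε)| ≤ 3 * η := by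
  have key : |(f1 (s + ε) - (s + ε) * f2 s) - (f1 s - s * f2 s)| ≤ η * |ε| := by
    have := Convex.norm_image_sub_le_of_norm_hasDerivWithin_le (s := uIcc s (s + ε))
      (f := fun x => f1 x - x * f2 s) (f' := fun x => f2 x - f2 s) (C := η)
      (fun x _ => by
        have := (h.d2 x).sub ((hasDerivAt_id x).mul_const (f2 s))
        rw [one_mul] at this
        exact this.hasDerivWithinAt)
      (fun x hx => by
        have h1 := hη s (x - s) (by
          have := abs_sub_left_of_mem_uIcc hx
          rw [add_sub_cancel_left] at this
          exact this.trans hε)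
        rwa [add_sub_cancel] at h1) (convex_uIcc _ _) left_mem_uIcc right_mem_uIcc
    rwa [add_sub_cancel_left, norm_eq_abs, norm_eq_abs] at this
  have e : f2 (s + ε) + f2 s - 2 * ((f1 (s + ε) - f1 s) / ε) = (f2 (s + ε) - f2 s)
      - 2 * (((f1 (s + ε) - (s + ε) * f2 s) - (f1 s - s * f2 s)) / ε) := by
    field_simp
    ring
  rw [e]
  have h1 := hη s ε hε
  have h2 : |((f1 (s + ε) - (s + ε) * f2 s) - (f1 s - s * f2 s)) / ε| ≤ η := by
    rw [abs_div, div_le_iff₀ (abs_pos.2 h0)]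
    exact key
  rw [abs_le] at *
  constructor <;> linarith [h1.1, h1.2, h2.1, h2.2]

lemma tendsto_contourInt {f f1 f2 : ℝ → ℝ} {M : ℝ} (hb : ProfileBounds M f f1 f2)
    (h : IsC2Profile f f1 f2) (s : ℝ) :
    Tendsto (fun κ => contourInt (fun s => log (1 + f s)) (fun s => f1 s / (1 + f s)) κ s) (𝓝[>] 0)
      (𝓝 (-(4 * π * logVelocity f s))) := by
  rw [tendsto_iff_norm_sub_tendsto_zero]
  have h0 : Tendsto (fun κ => 3200 * M ^ 10 * √κ) (𝓝[>] 0) (𝓝 0) := by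
    have : Tendsto (fun κ => 3200 * M ^ 10 * √κ) (𝓝 0) (𝓝 (3200 * M ^ 10 * √0)) :=
      Continuous.tendsto (by fun_prop) 0
    rw [sqrt_zero, mul_zero] at this
    exact this.mono_left nhdsWithin_le_nhds
  refine squeeze_zero' (Eventually.of_forall fun _ => norm_nonneg _) ?_ h0
  filter_upwards [Ioc_mem_nhdsGT pi_pos] with κ hκ
  have := abs_logVelocity_add_contourInt_le hb h s hκ.1 hκ.2
  rwa [norm_eq_abs, sub_neg_eq_add, add_comm]

/-- The contour equation on `[0, T]`, for a path of positive radius. -/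
structure IsSolutionPath (T : ℝ) (f f1 f2 : ℝ → ℝ → ℝ) : Prop extends IsC2Path T f f1 f2 where
  pos : ∀ t ∈ Icc 0 T, ∀ s, 0 < 1 + f t s
  hasDerivAt : ∀ t ∈ Ioo 0 T, ∀ s, HasDerivAt (fun τ => log (1 + f τ s)) (logVelocity (f t) s) t

namespace IsSolutionPath

variable {T : ℝ} {f f1 f2 : ℝ → ℝ → ℝ}

lemma logPath (h : IsSolutionPath T f f1 f2) :
    IsC2Path T (fun t s => log (1 + f t s)) (fun t s => f1 t s / (1 + f t s))
      (fun t s => f2 t s / (1 + f t s) - (f1 t s / (1 + f t s)) ^ 2) :=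
  h.toIsC2Path.log_one_add h.pos

/-- At a spatial maximum of u the truncated integrals are at least -1, so ∂ₜu ≤ 1/(4π); minima are
symmetric. The rate 1 is a generous replacement. -/
lemma abs_log_le (h : IsSolutionPath T f f1 f2)
    (hslope : ∀ t ∈ Icc 0 T, ∀ s, |f1 t s / (1 + f t s)| ≤ 1 / 100) {A : ℝ}
    (hA : ∀ s, |log (1 + f 0 s)| ≤ A) {t : ℝ} (ht : t ∈ Icc 0 T) (s : ℝ) :
    |log (1 + f t s)| ≤ A + t := by
  obtain ⟨M, hM⟩ := h.toIsC2Path.exists_profileBounds h.pos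
  have hπ := pi_gt_three
  have hu := h.logPath
  have lim := fun t (ht : t ∈ Ioo 0 T) s =>
    tendsto_contourInt (hM t (Ioo_subset_Icc_self ht)) (h.profile t (Ioo_subset_Icc_self ht)) s
  have near : ∀ᶠ κ in 𝓝[>] (0 : ℝ), κ ∈ Ioc 0 π := Ioc_mem_nhdsGT pi_pos
  have upper := le_add_mul_of_deriv_le_at_max (C := 1) hu.continuousOn
    (fun t ht => (hu.profile t ht).per) h.hasDerivAt (fun t ht s hs => by
      have := ge_of_tendsto (lim t ht s) (near.mono fun κ hκ =>
        neg_one_le_contourInt_of_max (hu.profile t (Ioo_subset_Icc_self ht))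
          (hslope t (Ioo_subset_Icc_self ht)) hs hκ.1 hκ.2)
      nlinarith) (fun s => (le_abs_self _).trans (hA s)) ht s
  have lower := le_add_mul_of_deriv_le_at_max (C := 1) (φ := fun t s => -log (1 + f t s))
    hu.continuousOn.neg (fun t ht s => congrArg Neg.neg ((hu.profile t ht).per s)) (fun t ht s => (h.hasDerivAt t ht s).neg)
    (fun t ht s hs => by
      have := le_of_tendsto (lim t ht s) (near.mono fun κ hκ =>
        contourInt_le_one_of_min (hu.profile t (Ioo_subset_Icc_self ht))
          (hslope t (Ioo_subset_Icc_self ht)) (fun x => neg_le_neg_iff.1 (hs x)) hκ.1 hκ.2)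
      nlinarith) (fun s => (neg_le_abs _).trans (hA s)) ht s
  rw [abs_le]
  constructor <;> linarith

/-- The maximum of u(· + ε) - u does not increase, by the comparison principle applied to u and its
translate. The admissible ε depends on the modulus of continuity of u'' on [0, T], which does no
harm, since ε tends to zero in `abs_slope_le`. -/
lemma translate_sub_le (h : IsSolutionPath T f f1 f2)
    (hslope : ∀ t ∈ Icc 0 T, ∀ s, |f1 t s / (1 + f t s)| ≤ 1 / 100) {m : ℝ}
    (hm : ∀ s, |f1 0 s / (1 + f 0 s)| ≤ m) {t : ℝ} (ht : t ∈ Icc 0 T) :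
    ∃ δ > 0, ∀ ε, ε ≠ 0 → |ε| ≤ δ → ∀ s, log (1 + f t (s + ε)) - log (1 + f t s) ≤ m * |ε| := by
  obtain ⟨M, hM⟩ := h.toIsC2Path.exists_profileBounds h.pos
  have hu := h.logPath
  -- Three times 1/60 is the tolerance 1/20 in the comparison principle.
  obtain ⟨δ, hδ, hmod⟩ := exists_modulus_of_continuousOn_periodic hu.continuousOn2
    (fun t ht => (hu.profile t ht).per2) (η := 1 / 60) (by norm_num)
  refine ⟨δ, hδ, fun ε h0 hε s => ?_⟩
  have lim := fun t (ht : t ∈ Ioo 0 T) s =>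
    tendsto_contourInt (hM t (Ioo_subset_Icc_self ht)) (h.profile t (Ioo_subset_Icc_self ht)) s
  have hcont : ContinuousOn (fun z : ℝ × ℝ => log (1 + f z.1 (z.2 + ε))) (Icc 0 T ×ˢ univ) :=
    hu.continuousOn.comp (f := fun z : ℝ × ℝ => (z.1, z.2 + ε)) (by fun_prop)
      fun z hz => ⟨hz.1, mem_univ _⟩
  have h00 : (0 : ℝ) ∈ Icc 0 T := ⟨le_rfl, ht.1.trans ht.2⟩
  have := le_add_mul_of_deriv_le_at_max (C := 0) (A := m * |ε|)
    (φ := fun t s => log (1 + f t (s + ε)) - log (1 + f t s))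
    (hcont.sub hu.continuousOn)
    (fun t ht s => by
      exact congrArg₂ (· - ·) (((hu.profile t ht).translate ε).per s) ((hu.profile t ht).per s))
    (fun t ht s => (h.hasDerivAt t ht (s + ε)).sub (h.hasDerivAt t ht s))
    (fun t ht s hs => by
      have ht' := Ioo_subset_Icc_self ht
      have hp := hu.profile t ht'
      have hv := hp.translate ε
      have hb := lim t ht (s + ε)
      have e : (fun κ => contourInt (fun s => log (1 + f t (s + ε)))
          (fun s => f1 t (s + ε) / (1 + f t (s + ε))) κ s) =
          fun κ => contourInt (fun s => log (1 + f t s)) (fun s => f1 t s / (1 + f t s)) κ (s + ε) := by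
        funext κ
        simp only [contourInt, contourFun]
        refine intervalIntegral.integral_congr fun α _ => ?_
        rw [show s - α + ε = s + ε - α by ring, show s - -α + ε = s + ε - -α by ring]
      have := le_of_tendsto_contourInt (ε := ε) hp hv (hslope t ht') (fun s => hslope t ht' _)
        (fun s => by
          rw [abs_div, div_le_iff₀ (abs_pos.2 h0)]
          have := hp.abs_sub_le (hslope t ht') (s + ε) s
          rwa [add_sub_cancel_left] at this)
        (fun s => by
          have := hp.abs_add_sub_slope_le h0 hε (hmod t ht') s
          norm_num at this ⊢
          exact this) hs (lim t ht s) (by rw [e]; exact hb)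
      nlinarith [pi_pos])
    (fun s => by
      have := (hu.profile 0 h00).abs_sub_le hm (s + ε) s
      rw [add_sub_cancel_left] at this
      exact (le_abs_self _).trans this) ht s
  linarith

lemma abs_slope_le (h : IsSolutionPath T f f1 f2)
    (hslope : ∀ t ∈ Icc 0 T, ∀ s, |f1 t s / (1 + f t s)| ≤ 1 / 100) {m : ℝ}
    (hm : ∀ s, |f1 0 s / (1 + f 0 s)| ≤ m) {t : ℝ} (ht : t ∈ Icc 0 T) (s : ℝ) :
    |f1 t s / (1 + f t s)| ≤ m := by
  obtain ⟨δ, hδ, H⟩ := h.translate_sub_le hslope hm ht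
  have hd := (h.logPath.profile t ht).d1 s
  rw [abs_le]
  constructor
  · refine ge_of_tendsto hd.tendsto_slope_zero_left ?_
    filter_upwards [Ico_mem_nhdsLT (neg_lt_zero.2 hδ)] with ε hε
    have := H ε hε.2.ne (by rw [abs_of_neg hε.2]; linarith [hε.1]) s
    rw [abs_of_neg hε.2] at this
    rw [smul_eq_mul, inv_mul_eq_div, le_div_iff_of_neg hε.2]
    linarith
  · refine le_of_tendsto hd.tendsto_slope_zero_right ?_
    filter_upwards [Ioc_mem_nhdsGT hδ] with ε hε
    have := H ε hε.1.ne' (by rw [abs_of_pos hε.1]; exact hε.2) s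
    rw [abs_of_pos hε.1] at this
    rwa [smul_eq_mul, inv_mul_eq_div, div_le_iff₀ hε.1]

end IsSolutionPath

/-- The smallness of the initial slope is propagated. -/
theorem isSolutionPath_of_small_slope {T : ℝ} {f f1 f2 : ℝ → ℝ → ℝ} (h : IsC2Path T f f1 f2)
    (hT : 0 < T)
    (hd : ∀ t ∈ Ioo 0 T, (∀ s, 0 < 1 + f t s) → ∀ s,
      HasDerivAt (fun τ => log (1 + f τ s)) (logVelocity (f t) s) t)
    (h0 : ∀ s, 0 < 1 + f 0 s) (hA : ∀ s, |log (1 + f 0 s)| ≤ 1)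
    (hm : ∀ s, |f1 0 s / (1 + f 0 s)| ≤ 1 / 200) :
    IsSolutionPath T f f1 f2 ∧ (∀ t ∈ Icc 0 T, ∀ s, |f1 t s / (1 + f t s)| ≤ 1 / 200) ∧
      ∀ t ∈ Icc 0 T, ∀ s, |log (1 + f t s)| ≤ 1 + t := by
  -- The bootstrap quantity (1 + f)/100 - |f'| is continuous and involves no division; its
  -- positivity encodes both 1 + f > 0 and |u'| < 1/100. As long as it holds, the slope bound
  -- improves to 1/200.
  have key : ∀ t ∈ Icc 0 T, (∀ τ ∈ Icc 0 t, ∀ s, 0 < 1 / 100 * (1 + f τ s) - |f1 τ s|) →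
      IsSolutionPath t f f1 f2 ∧ (∀ τ ∈ Icc 0 t, ∀ s, |f1 τ s / (1 + f τ s)| ≤ 1 / 200) ∧
      ∀ τ ∈ Icc 0 t, ∀ s, |log (1 + f τ s)| ≤ 1 + τ := by
    intro t ht hw
    have hp : ∀ τ ∈ Icc 0 t, ∀ s, 0 < 1 + f τ s := fun τ hτ s => by
      linarith [hw τ hτ s, abs_nonneg (f1 τ s)]
    have hsol : IsSolutionPath t f f1 f2 := ⟨h.mono ht.2, hp, fun τ hτ =>
      hd τ ⟨hτ.1, hτ.2.trans_le ht.2⟩ (hp τ (Ioo_subset_Icc_self hτ))⟩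
    have hsl : ∀ τ ∈ Icc 0 t, ∀ s, |f1 τ s / (1 + f τ s)| ≤ 1 / 100 := fun τ hτ s => by
      rw [abs_div, abs_of_pos (hp τ hτ s), div_le_iff₀ (hp τ hτ s)]
      linarith [hw τ hτ s]
    exact ⟨hsol, fun τ hτ s => hsol.abs_slope_le hsl hm hτ s, fun τ hτ s => hsol.abs_log_le hsl hA hτ s⟩
  suffices H : ∀ t ∈ Icc 0 T, ∀ s, 0 < 1 / 100 * (1 + f t s) - |f1 t s| from
    key T (right_mem_Icc.2 hT.le) H
  by_contra! hcon
  obtain ⟨t₁, ht₁, s₁, hs₁⟩ := hcon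
  have hcont : ContinuousOn (fun z : ℝ × ℝ => 1 / 100 * (1 + f z.1 z.2) - |f1 z.1 z.2|)
      (Icc 0 T ×ˢ univ) :=
    (continuousOn_const.mul (continuousOn_const.add h.continuousOn)).sub h.continuousOn1.abs
  have hK : IsCompact (Icc 0 T ×ˢ Icc 0 (2 * π)) := isCompact_Icc.prod isCompact_Icc
  have hB := (hK.of_isClosed_subset ((hcont.mono (prod_mono_right (subset_univ _))).preimage_isClosed_of_isClosed
    hK.isClosed (isClosed_Iic (a := (0 : ℝ)))) inter_subset_left).image continuous_fst
  have hmem : ∀ t ∈ Icc 0 T, ∀ s, 1 / 100 * (1 + f t s) - |f1 t s| ≤ 0 →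
      t ∈ Prod.fst '' (Icc 0 T ×ˢ Icc 0 (2 * π) ∩
        (fun z : ℝ × ℝ => 1 / 100 * (1 + f z.1 z.2) - |f1 z.1 z.2|) ⁻¹' Iic 0) := by
    intro t ht s hs
    obtain ⟨x, hx, e⟩ := exists_mem_Icc_of_periodic (f := fun s => (f t s, f1 t s)) (fun s => by
      simp only [(h.profile t ht).per s, (h.profile t ht).per1 s]) s
    simp only [Prod.mk.injEq] at e
    rw [e.1, e.2] at hs
    exact ⟨(t, x), ⟨⟨ht, hx⟩, hs⟩, rfl⟩
  -- By compactness there is a first time of failure.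
  obtain ⟨t₂, ⟨⟨t₃, s₂⟩, ⟨⟨ht₂, -⟩, hs₂⟩, rfl⟩, hleast⟩ := hB.exists_isLeast ⟨t₁, hmem t₁ ht₁ s₁ hs₁⟩
  dsimp only at ht₂ hleast
  have hs₂ : 1 / 100 * (1 + f t₃ s₂) - |f1 t₃ s₂| ≤ 0 := hs₂
  have hweak : ∀ τ ∈ Ico 0 t₃, ∀ s, 0 < 1 / 100 * (1 + f τ s) - |f1 τ s| := by
    intro τ hτ s
    by_contra! hle
    exact absurd (hleast (hmem τ ⟨hτ.1, hτ.2.le.trans ht₂.2⟩ s hle)) (not_le.2 hτ.2)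
  have hgood0 : ∀ s, |f1 0 s| ≤ 1 / 200 * (1 + f 0 s) := fun s => by
    have := hm s
    rwa [abs_div, abs_of_pos (h0 s), div_le_iff₀ (h0 s)] at this
  have hsub : Icc 0 t₃ ⊆ Icc 0 T := Icc_subset_Icc_right ht₂.2
  have c0 := (continuousOn_time h.continuousOn s₂).mono hsub
  have c1 := (continuousOn_time h.continuousOn1 s₂).mono hsub
  rcases ht₂.1.eq_or_lt with hz | hz
  · rw [← hz] at hs₂
    linarith [hgood0 s₂, h0 s₂]
  -- The improved slope bound alone would allow 1 + f = f' = 0 at the failure time; the amplitude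
  -- bound excludes this by a positive lower bound for 1 + f.
  have good : ∀ τ ∈ Ico 0 t₃, |f1 τ s₂| ≤ 1 / 200 * (1 + f τ s₂) ∧ exp (-(1 + T)) ≤ 1 + f τ s₂ := by
    intro τ hτ
    have hτT : τ ≤ T := hτ.2.le.trans ht₂.2
    obtain ⟨k1, k2, k3⟩ := key τ ⟨hτ.1, hτT⟩ fun x hx => hweak x ⟨hx.1, hx.2.trans_lt hτ.2⟩
    have hp := k1.pos τ (right_mem_Icc.2 hτ.1) s₂
    have h2 := k2 τ (right_mem_Icc.2 hτ.1) s₂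
    have h3 := (abs_le.1 (k3 τ (right_mem_Icc.2 hτ.1) s₂)).1
    rw [abs_div, abs_of_pos hp, div_le_iff₀ hp] at h2
    refine ⟨h2, ?_⟩
    rw [← le_log_iff_exp_le hp]
    linarith
  have g1 : |f1 t₃ s₂| ≤ 1 / 200 * (1 + f t₃ s₂) := le_of_forall_Ico_le hz c1.abs (continuousOn_const.mul (continuousOn_const.add c0))
    fun τ hτ => (good τ hτ).1
  have g2 : exp (-(1 + T)) ≤ 1 + f t₃ s₂ := le_of_forall_Ico_le hz continuousOn_const (continuousOn_const.add c0)
    fun τ hτ => (good τ hτ).2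
  have := exp_pos (-(1 + T))
  linarith

/-! ### The energy balance in time. -/

section velocity

variable {f f1 f2 : ℝ → ℝ} {M : ℝ}

lemma IsC2Profile.continuous_contourInt (h : IsC2Profile f f1 f2) {κ : ℝ} (hκ : 0 < κ) (hπ : κ ≤ π) :
    Continuous (contourInt f f1 κ) := by
  rw [← continuousOn_univ]
  have := continuousOn_contourFun₂ h hκ univ
  exact continuousOn_intervalIntegral hπ this

/-- The rate of convergence is uniform in s, so the velocity is a uniform limit of continuous
truncated integrals. -/
lemma continuous_logVelocity (hb : ProfileBounds M f f1 f2) (h : IsC2Profile f f1 f2) :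
    Continuous (logVelocity f) := by
  have hu := h.log_one_add hb.pos
  have lim : TendstoUniformly (fun κ s => -(contourInt (fun s => log (1 + f s))
      (fun s => f1 s / (1 + f s)) κ s) / (4 * π)) (logVelocity f) (𝓝[>] 0) := by
    rw [Metric.tendstoUniformly_iff]
    intro ε hε
    have h0 : Tendsto (fun κ => 3200 * M ^ 10 * √κ) (𝓝[>] 0) (𝓝 0) := by
      have : Tendsto (fun κ => 3200 * M ^ 10 * √κ) (𝓝 0) (𝓝 (3200 * M ^ 10 * √0)) :=
        Continuous.tendsto (by fun_prop) 0
      rw [sqrt_zero, mul_zero] at this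
      exact this.mono_left nhdsWithin_le_nhds
    filter_upwards [Ioc_mem_nhdsGT pi_pos, h0.eventually (gt_mem_nhds hε)] with κ hκ hκε s
    have h1 := (abs_logVelocity_add_contourInt_le hb h s hκ.1 hκ.2).trans_lt hκε
    have hπ := pi_gt_three
    rw [dist_eq, ← mul_lt_mul_iff_right₀ (show 0 < 4 * π by positivity)]
    rw [← abs_of_pos (show 0 < 4 * π by positivity), ← abs_mul, abs_of_pos (show 0 < 4 * π by positivity)]
    have e : 4 * π * (logVelocity f s - -(contourInt (fun s => log (1 + f s))
      (fun s => f1 s / (1 + f s)) κ s) / (4 * π)) = 4 * π * logVelocity f s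
        + contourInt (fun s => log (1 + f s)) (fun s => f1 s / (1 + f s)) κ s := by
      field_simp
      ring
    rw [e]
    nlinarith
  refine lim.continuous (Eventually.frequently ?_)
  filter_upwards [Ioc_mem_nhdsGT pi_pos] with κ hκ
  have := hu.continuous_contourInt hκ.1 hκ.2
  fun_prop

/-- At κ = π the truncated integral is empty, and the error bound becomes a bound on the velocity
itself. -/
lemma abs_logVelocity_le (hb : ProfileBounds M f f1 f2) (h : IsC2Profile f f1 f2) (s : ℝ) :
    |logVelocity f s| ≤ 3200 * M ^ 10 := by
  have h1 := abs_logVelocity_add_contourInt_le hb h s pi_pos le_rfl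
  rw [contourInt, intervalIntegral.integral_same, add_zero, abs_mul,
    abs_of_pos (show 0 < 4 * π by positivity)] at h1
  have h2 : √π ≤ 4 * π := by
    rw [sqrt_le_left (by positivity)]
    nlinarith [pi_gt_three]
  have h3 : 0 < 4 * π := by positivity
  have h4 : 0 ≤ 3200 * M ^ 10 := by positivity
  refine le_of_mul_le_mul_left (h1.trans ?_) h3
  nlinarith

end velocity

lemma dissipation_anti {g : ℝ → ℝ} (hg : Continuous g) {κ κ₀ : ℝ} (hκ : 0 < κ) (h : κ ≤ κ₀) (hπ : κ₀ ≤ π) :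
    dissipation g κ₀ ≤ dissipation g κ := by
  have hc : ContinuousOn (fun α => ∫ s in (-π)..π, (g s - g (s - α)) ^ 2 / (1 - cos α)) (Icc κ π) :=
    continuousOn_intervalIntegral (by linarith [pi_pos]) (continuousOn_dissipation_density hg hκ _)
  refine intervalIntegral.integral_mono_interval h hπ le_rfl ?_
    (intervalIntegrable_of_continuousOn_Icc (h.trans hπ) hc)
  filter_upwards with α
  exact intervalIntegral.integral_nonneg (by linarith [pi_pos]) fun s _ =>
    div_nonneg (sq_nonneg _) (by linarith [cos_le_one α])

lemma IsC2Path.continuousOn_dissipation {T : ℝ} {f f1 f2 : ℝ → ℝ → ℝ} (h : IsC2Path T f f1 f2)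
    {κ : ℝ} (hκ : 0 < κ) (hπ : κ ≤ π) :
    ContinuousOn (fun t => dissipation (f1 t) κ) (Icc 0 T) := by
  refine continuousOn_intervalIntegral hπ ?_
  refine continuousOn_intervalIntegral (X := ℝ × ℝ) (F := fun z s => (f1 z.1 s - f1 z.1 (s - z.2)) ^ 2 /
    (1 - cos z.2)) (by linarith [pi_pos]) ?_
  have h1 : ContinuousOn (fun z : (ℝ × ℝ) × ℝ => f1 z.1.1 z.2) ((Icc 0 T ×ˢ Icc κ π) ×ˢ Icc (-π) π) :=
    h.continuousOn1.comp (f := fun z : (ℝ × ℝ) × ℝ => (z.1.1, z.2)) (by fun_prop)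
      fun z hz => ⟨hz.1.1, mem_univ _⟩
  have h2 : ContinuousOn (fun z : (ℝ × ℝ) × ℝ => f1 z.1.1 (z.2 - z.1.2))
      ((Icc 0 T ×ˢ Icc κ π) ×ˢ Icc (-π) π) :=
    h.continuousOn1.comp (f := fun z : (ℝ × ℝ) × ℝ => (z.1.1, z.2 - z.1.2)) (by fun_prop)
      fun z hz => ⟨hz.1.1, mem_univ _⟩
  have hn : ∀ z ∈ (Icc 0 T ×ˢ Icc κ π) ×ˢ Icc (-π) π, 1 - cos z.1.2 ≠ 0 := by
    intro z hz
    obtain ⟨k1, k2, -, -⟩ := abs_le_pi_of_mem hκ hz.1.2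
    exact (one_sub_cos_pos k2 k1).ne'
  exact ((h1.sub h2).pow 2).div (by fun_prop) hn

lemma IsC2Path.continuousOn_energy {T : ℝ} {f f1 f2 : ℝ → ℝ → ℝ} (h : IsC2Path T f f1 f2) :
    ContinuousOn (fun t => ∫ s in (-π)..π, f1 t s ^ 2) (Icc 0 T) :=
  continuousOn_intervalIntegral (by linarith [pi_pos])
    ((h.continuousOn1.mono (prod_mono_right (subset_univ _))).pow 2)

/-- The energy dissipation rate of a profile. -/
lemma integral_mul_logVelocity_ge {f f1 f2 u2 : ℝ → ℝ} {M : ℝ} (hb : ProfileBounds M f f1 f2)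
    (h : IsC2Profile f f1 f2)
    (hu : IsC2Profile (fun s => log (1 + f s)) (fun s => f1 s / (1 + f s)) u2)
    (hslope : ∀ s, |f1 s / (1 + f s)| ≤ 1 / 100) {κ : ℝ} (hκ : 0 < κ) (hπ : κ ≤ π) :
    -(2 * ∫ s in (-π)..π, u2 s * logVelocity f s) ≤
      1 / (2 * π) * (20 - 0.29 * dissipation (fun s => f1 s / (1 + f s)) κ) := by
  obtain ⟨K, hK⟩ := (isCompact_Icc (a := -π) (b := π)).exists_bound_of_continuousOn
    hu.cont2.continuousOn
  have hK' : ∀ s, |u2 s| ≤ |K| := fun s => by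
    obtain ⟨x, hx, e⟩ := hu.per2.exists_mem_Ico (by positivity) s (-π)
    rw [e]
    exact (hK x ⟨hx.1, by linarith [hx.2]⟩).trans (le_abs_self K)
  have hv := continuous_logVelocity hb h
  have hc2 := hu.cont2
  have hle : -π ≤ π := by linarith [pi_pos]
  -- The errors depend on the C² bounds K and M, so the cut-off x is sent to zero, while
  -- monotonicity keeps the dissipation at the fixed level κ.
  have step : ∀ x ∈ Ioc 0 κ, -(2 * ∫ s in (-π)..π, u2 s * logVelocity f s) ≤
      1 / (2 * π) * (20 - 0.29 * dissipation (fun s => f1 s / (1 + f s)) κ) +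
      1 / (2 * π) * (7 * |K| * (2 * |K| + 1) * x + 2 * π * |K| * (3200 * M ^ 10 * √x)) := by
    intro x hx
    have hxπ := hx.2.trans hπ
    have hI := hu.continuous_contourInt hx.1 hxπ
    have h1 := integral_mul_contourInt_le hu hslope hK' hx.1 hxπ
    have h2 := dissipation_anti hu.cont1 hx.1 hx.2 hπ
    have h3 : ‖∫ s in (-π)..π, u2 s * (4 * π * logVelocity f s +
        contourInt (fun s => log (1 + f s)) (fun s => f1 s / (1 + f s)) x s)‖ ≤
        |K| * (3200 * M ^ 10 * √x) * |π - -π| := by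
      refine intervalIntegral.norm_integral_le_of_norm_le_const fun s _ => ?_
      rw [norm_mul]
      exact mul_le_mul (hK' s) (abs_logVelocity_add_contourInt_le hb h s hx.1 hxπ) (norm_nonneg _)
        (abs_nonneg _)
    have h4 : ∫ s in (-π)..π, u2 s * (4 * π * logVelocity f s +
        contourInt (fun s => log (1 + f s)) (fun s => f1 s / (1 + f s)) x s) =
        4 * π * (∫ s in (-π)..π, u2 s * logVelocity f s) + ∫ s in (-π)..π, u2 s *
          contourInt (fun s => log (1 + f s)) (fun s => f1 s / (1 + f s)) x s := by
      rw [← intervalIntegral.integral_const_mul, ← intervalIntegral.integral_add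
        (Continuous.intervalIntegrable (by fun_prop) _ _)
        (Continuous.intervalIntegrable (by fun_prop) _ _)]
      refine intervalIntegral.integral_congr fun s _ => ?_
      ring
    rw [h4, show π - -π = 2 * π by ring, abs_of_pos (show 0 < 2 * π by positivity)] at h3
    have h5 := (abs_le.1 h3).1
    set J := ∫ s in (-π)..π, u2 s * logVelocity f s
    have h6 : -(2 * J) = 1 / (2 * π) * (-(4 * π * J)) := by
      have := pi_ne_zero
      field_simp
      ring
    rw [h6, ← mul_add]
    refine mul_le_mul_of_nonneg_left ?_ (by positivity)
    linarith
  have lim : Tendsto (fun x => 1 / (2 * π) * (20 - 0.29 * dissipation (fun s => f1 s / (1 + f s)) κ) +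
      1 / (2 * π) * (7 * |K| * (2 * |K| + 1) * x + 2 * π * |K| * (3200 * M ^ 10 * √x))) (𝓝[>] 0)
      (𝓝 (1 / (2 * π) * (20 - 0.29 * dissipation (fun s => f1 s / (1 + f s)) κ))) := by
    have : Tendsto (fun x => 1 / (2 * π) * (20 - 0.29 * dissipation (fun s => f1 s / (1 + f s)) κ) +
      1 / (2 * π) * (7 * |K| * (2 * |K| + 1) * x + 2 * π * |K| * (3200 * M ^ 10 * √x))) (𝓝 0) _ :=
      Continuous.tendsto (by fun_prop) 0
    simp only [sqrt_zero, mul_zero, add_zero] at this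
    exact this.mono_left nhdsWithin_le_nhds
  exact ge_of_tendsto lim (by filter_upwards [Ioc_mem_nhdsGT hκ] with x hx using step x hx)

namespace IsSolutionPath

variable {T : ℝ} {f f1 f2 : ℝ → ℝ → ℝ}

/-- The energy is differentiable in time. -/
lemma hasDerivAt_energy (h : IsSolutionPath T f f1 f2) {t : ℝ} (ht : t ∈ Ioo 0 T) :
    HasDerivAt (fun t => ∫ s in (-π)..π, (f1 t s / (1 + f t s)) ^ 2)
      (-(2 * ∫ s in (-π)..π, (f2 t s / (1 + f t s) - (f1 t s / (1 + f t s)) ^ 2) *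
        logVelocity (f t) s)) t := by
  obtain ⟨M, hM⟩ := h.toIsC2Path.exists_profileBounds h.pos
  have hu := h.logPath
  set u := fun t s => log (1 + f t s)
  set u1 := fun t s => f1 t s / (1 + f t s)
  set u2 := fun t s => f2 t s / (1 + f t s) - (f1 t s / (1 + f t s)) ^ 2
  obtain ⟨K, hK⟩ := exists_abs_le_of_continuousOn_periodic hu.continuousOn2
    (fun t ht => (hu.profile t ht).per2)
  set V := 3200 * M ^ 10
  have htI := Ioo_subset_Icc_self ht
  have hlip : ∀ τ ∈ Ioo 0 T, ∀ s, |u τ s - u t s| ≤ V * |τ - t| := by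
    intro τ hτ s
    have := Convex.norm_image_sub_le_of_norm_hasDerivWithin_le (s := Ioo 0 T) (C := V)
      (f := fun τ => u τ s) (f' := fun τ => logVelocity (f τ) s)
      (fun x hx => (h.hasDerivAt x hx s).hasDerivWithinAt)
      (fun x hx => abs_logVelocity_le (hM x (Ioo_subset_Icc_self hx))
        (h.profile x (Ioo_subset_Icc_self hx)) s) (convex_Ioo _ _) ht hτ
    exact this
  -- Nothing is known about ∂ₜu'. The difference u'(τ)² - u'(t)² is therefore factored and
  -- integrated by parts in s, so that only the difference quotient of u remains.
  have hslope : ∀ τ ∈ Ioo 0 T, slope (fun t => ∫ s in (-π)..π, u1 t s ^ 2) t τ =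
      ∫ s in (-π)..π, -((u2 τ s + u2 t s) * ((τ - t)⁻¹ * (u τ s - u t s))) := by
    intro τ hτ
    have p1 := hu.profile τ (Ioo_subset_Icc_self hτ)
    have p2 := hu.profile t htI
    have a1 := p1.cont1
    have a2 := p2.cont1
    have b1 := p1.cont2
    have b2 := p2.cont2
    have c1 := p1.cont
    have c2 := p2.cont
    have key := intervalIntegral.integral_mul_deriv_eq_deriv_mul (a := -π) (b := π)
      (u := fun s => u1 τ s + u1 t s) (v := fun s => u τ s - u t s)
      (u' := fun s => u2 τ s + u2 t s) (v' := fun s => u1 τ s - u1 t s)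
      (fun s _ => (p1.d2 s).add (p2.d2 s)) (fun s _ => (p1.d1 s).sub (p2.d1 s))
      (Continuous.intervalIntegrable (by fun_prop) _ _)
      (Continuous.intervalIntegrable (by fun_prop) _ _)
    have per : ∀ g : ℝ → ℝ, Function.Periodic g (2 * π) → g π = g (-π) := fun g hg => by
      have := hg (-π)
      rwa [show -π + 2 * π = π by ring] at this
    rw [per _ p1.per, per _ p2.per, per _ p1.per1, per _ p2.per1, sub_self, zero_sub] at key
    rw [slope_def_field, ← intervalIntegral.integral_sub
      (Continuous.intervalIntegrable (by fun_prop) _ _)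
      (Continuous.intervalIntegrable (by fun_prop) _ _)]
    have e1 : ∫ s in (-π)..π, (u1 τ s ^ 2 - u1 t s ^ 2) =
        ∫ s in (-π)..π, (u1 τ s + u1 t s) * (u1 τ s - u1 t s) :=
      intervalIntegral.integral_congr fun s _ => by ring
    have e2 : ∫ s in (-π)..π, -((u2 τ s + u2 t s) * ((τ - t)⁻¹ * (u τ s - u t s))) =
        (τ - t)⁻¹ * -∫ s in (-π)..π, (u2 τ s + u2 t s) * (u τ s - u t s) := by
      rw [← intervalIntegral.integral_neg, ← intervalIntegral.integral_const_mul]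
      exact intervalIntegral.integral_congr fun s _ => by ring
    rw [e1, key, e2, div_eq_inv_mul]
  have near : ∀ᶠ τ in 𝓝[≠] t, τ ∈ Ioo 0 T := nhdsWithin_le_nhds (Ioo_mem_nhds ht.1 ht.2)
  rw [hasDerivAt_iff_tendsto_slope, ← intervalIntegral.integral_const_mul,
    ← intervalIntegral.integral_neg]
  refine Tendsto.congr' (near.mono fun τ hτ => (hslope τ hτ).symm) ?_
  refine intervalIntegral.tendsto_integral_filter_of_dominated_convergence (fun _ => 2 * K * V) ?_ ?_
    intervalIntegrable_const ?_
  · filter_upwards [near] with τ hτ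
    have p1 := hu.profile τ (Ioo_subset_Icc_self hτ)
    have p2 := hu.profile t htI
    have b1 := p1.cont2
    have b2 := p2.cont2
    have c1 := p1.cont
    have c2 := p2.cont
    exact Continuous.aestronglyMeasurable (by fun_prop)
  · filter_upwards [near, self_mem_nhdsWithin] with τ hτ hne
    refine ae_of_all _ fun s _ => ?_
    have h1 := hK τ (Ioo_subset_Icc_self hτ) s
    have h2 := hK t htI s
    have h3 := hlip τ hτ s
    have h4 : 0 < |τ - t| := abs_pos.2 (sub_ne_zero.2 hne)
    rw [norm_neg, norm_mul, norm_mul, norm_inv, norm_eq_abs, norm_eq_abs, norm_eq_abs]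
    have h5 : |τ - t|⁻¹ * |u τ s - u t s| ≤ V := by
      rw [inv_mul_le_iff₀ h4]
      linarith
    refine mul_le_mul ((abs_add_le _ _).trans (by linarith)) h5 (by positivity) ?_
    linarith [(abs_nonneg _).trans h2]
  · refine ae_of_all _ fun s _ => ?_
    have h1 := (hasDerivAt_iff_tendsto_slope.1 (h.hasDerivAt t ht s))
    have h2 : Tendsto (fun τ => u2 τ s) (𝓝[≠] t) (𝓝 (u2 t s)) :=
      (((continuousOn_time hu.continuousOn2 s).continuousAt (Icc_mem_nhds ht.1 ht.2)).tendsto).mono_left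
        nhdsWithin_le_nhds
    have h3 := (((h2.add_const (u2 t s)).mul h1).neg)
    refine (h3.congr fun τ => ?_).trans (le_of_eq ?_)
    · rw [slope_def_field, div_eq_inv_mul]
    · congr 1
      ring

/-- The dissipation is controlled in time, uniformly in the truncation. -/
theorem integral_dissipation_le (h : IsSolutionPath T f f1 f2) (hT : 0 < T)
    (hslope : ∀ t ∈ Icc 0 T, ∀ s, |f1 t s / (1 + f t s)| ≤ 1 / 100) {κ : ℝ} (hκ : 0 < κ)
    (hπ : κ ≤ π) :
    ∫ t in 0..T, dissipation (fun s => f1 t s / (1 + f t s)) κ ≤ 100 * (1 + T) := by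
  obtain ⟨M, hM⟩ := h.toIsC2Path.exists_profileBounds h.pos
  have hu := h.logPath
  have hc := hu.continuousOn_dissipation hκ hπ
  have hi := intervalIntegrable_of_continuousOn_Icc hT.le hc
  have hφ : ContinuousOn (fun t => 1 / (2 * π) * (20 - 0.29 * dissipation (fun s => f1 t s / (1 + f t s)) κ))
      (Icc 0 T) := by fun_prop
  -- Only an integrable upper bound for the derivative of the energy is needed. The final energy is
  -- nonnegative and the initial one is at most 2π/10⁴.
  have key := intervalIntegral.sub_le_integral_of_hasDeriv_right_of_le hT.le hu.continuousOn_energy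
    (fun t ht => (h.hasDerivAt_energy ht).hasDerivWithinAt) (hφ.integrableOn_Icc) fun t ht => by
      have ht' := Ioo_subset_Icc_self ht
      exact integral_mul_logVelocity_ge (hM t ht') (h.profile t ht') (hu.profile t ht') (hslope t ht') hκ hπ
  rw [intervalIntegral.integral_const_mul, intervalIntegral.integral_sub intervalIntegrable_const
    (hi.const_mul _), intervalIntegral.integral_const, intervalIntegral.integral_const_mul] at key
  have h0 : 0 ≤ ∫ s in (-π)..π, (f1 T s / (1 + f T s)) ^ 2 :=
    intervalIntegral.integral_nonneg (by linarith [pi_pos]) fun s _ => sq_nonneg _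
  have h1 : ‖∫ s in (-π)..π, (f1 0 s / (1 + f 0 s)) ^ 2‖ ≤ (1 / 100) ^ 2 * |π - -π| := by
    refine intervalIntegral.norm_integral_le_of_norm_le_const fun s _ => ?_
    rw [norm_pow]
    exact pow_le_pow_left₀ (norm_nonneg _) (hslope 0 ⟨le_rfl, hT.le⟩ s) 2
  rw [show π - -π = 2 * π by ring, abs_of_pos (show 0 < 2 * π by positivity)] at h1
  have h2 := (le_abs_self _).trans h1
  set D := ∫ t in 0..T, dissipation (fun s => f1 t s / (1 + f t s)) κ
  have h3 : 2 * π * (1 / (2 * π) * ((T - 0) • 20 - 0.29 * D)) = 20 * T - 0.29 * D := by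
    have := pi_ne_zero
    rw [smul_eq_mul]
    field_simp
    ring
  have hp := pi_lt_four
  have hp0 := pi_pos
  have h4 : -(2 * π * ((1 / 100) ^ 2 * (2 * π))) ≤ 20 * T - 0.29 * D := by
    rw [← h3]
    have := mul_le_mul_of_nonneg_left (show -((1 / 100) ^ 2 * (2 * π)) ≤
      1 / (2 * π) * ((T - 0) • 20 - 0.29 * D) by linarith)
      (show 0 ≤ 2 * π by positivity)
    linarith
  nlinarith

end IsSolutionPath

/-! ### From bounds on partial sums to the Bochner space. -/

section bochner

variable {σ T B : ℝ} {u : ℝ → ℝ → ℝ}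

/-- A sum of nonnegative terms is the supremum of its finite partial sums, and every finite set of
frequencies lies in a symmetric window. -/
lemma lintegral_tsum_besselCoeff_le (hT : 0 < T)
    (hc : ∀ k, ContinuousOn (fun t => besselCoeff σ (u t) k) (Icc 0 T))
    (hB : ∀ n : ℕ, 0 < n →
      ∫ t in 0..T, ∑ k ∈ Finset.Icc (-(n : ℤ)) n, ‖besselCoeff σ (u t) k‖ ^ 2 ≤ B) :
    ∫⁻ t in Icc 0 T, ∑' k : ℤ, ‖besselCoeff σ (u t) k‖ₑ ^ 2 ≤ ENNReal.ofReal B := by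
  have hm : ∀ k, AEMeasurable (fun t => ‖besselCoeff σ (u t) k‖ₑ ^ 2) (volume.restrict (Icc 0 T)) :=
    fun k => ((hc k).aestronglyMeasurable measurableSet_Icc).enorm.pow_const 2
  rw [lintegral_tsum hm, ENNReal.tsum_eq_iSup_sum]
  refine iSup_le fun S => ?_
  obtain ⟨n, hn0, hn⟩ : ∃ n : ℕ, 0 < n ∧ S ⊆ Finset.Icc (-(n : ℤ)) n := by
    refine ⟨∑ k ∈ S, k.natAbs + 1, Nat.succ_pos _, fun k hk => ?_⟩
    have := Finset.single_le_sum (f := fun k : ℤ => k.natAbs) (fun _ _ => Nat.zero_le _) hk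
    rw [Finset.mem_Icc]
    omega
  refine (Finset.sum_le_sum_of_subset hn).trans ?_
  rw [← lintegral_finsetSum' _ fun k _ => hm k]
  have hcn : ContinuousOn (fun t => ∑ k ∈ Finset.Icc (-(n : ℤ)) n, ‖besselCoeff σ (u t) k‖ ^ 2)
      (Icc 0 T) := continuousOn_finsetSum _ fun k _ => (hc k).norm.pow 2
  have e : ∀ t, ∑ k ∈ Finset.Icc (-(n : ℤ)) n, ‖besselCoeff σ (u t) k‖ₑ ^ 2 =
      ENNReal.ofReal (∑ k ∈ Finset.Icc (-(n : ℤ)) n, ‖besselCoeff σ (u t) k‖ ^ 2) := fun t => by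
    rw [ENNReal.ofReal_sum_of_nonneg fun _ _ => sq_nonneg _]
    refine Finset.sum_congr rfl fun k _ => ?_
    rw [ENNReal.ofReal_pow (norm_nonneg _), ofReal_norm]
  simp only [e]
  rw [← ofReal_integral_eq_lintegral_ofReal hcn.integrableOn_Icc
    (ae_of_all _ fun t => Finset.sum_nonneg fun _ _ => sq_nonneg _), integral_Icc_eq_integral_Ioc,
    ← intervalIntegral.integral_of_le hT.le]
  exact ENNReal.ofReal_le_ofReal (hB n hn0)

lemma memℓp_of_tsum_ne_top {c : ℤ → ℂ} (h : ∑' k, ‖c k‖ₑ ^ 2 ≠ ∞) : Memℓp c 2 := by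
  refine memℓp_gen ?_
  refine (ENNReal.summable_toReal h).congr fun k => ?_
  simp

lemma enorm_sq_eq_tsum (F : lp (fun _ : ℤ => ℂ) 2) : ‖F‖ₑ ^ 2 = ∑' k, ‖F k‖ₑ ^ 2 := by
  have h := lp.hasSum_norm (p := 2) (by norm_num) F
  simp only [ENNReal.toReal_ofNat, rpow_ofNat] at h
  rw [← ofReal_norm, ← ENNReal.ofReal_pow (norm_nonneg _), ← h.tsum_eq,
    ENNReal.ofReal_tsum_of_nonneg (fun _ => sq_nonneg _) h.summable]
  refine tsum_congr fun k => ?_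
  rw [ENNReal.ofReal_pow (norm_nonneg _), ofReal_norm]

lemma sobolevNorm_sq (f : ℝ → ℝ) : sobolevNorm σ f ^ 2 = ∑' k : ℤ, ‖besselCoeff σ f k‖ₑ ^ 2 := by
  rw [sobolevNorm, ← ENNReal.rpow_natCast, ← ENNReal.rpow_mul]
  norm_num

/-- Uniform bounds on the truncated norms yield membership in the Bochner space. -/
theorem memL2Sobolev_of_forall_integral_le (hT : 0 < T) (hu : ∀ t ∈ Icc 0 T, Continuous (u t))
    (hc : ∀ k, ContinuousOn (fun t => besselCoeff σ (u t) k) (Icc 0 T))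
    (hB : ∀ n : ℕ, 0 < n →
      ∫ t in 0..T, ∑ k ∈ Finset.Icc (-(n : ℤ)) n, ‖besselCoeff σ (u t) k‖ ^ 2 ≤ B) :
    MemL2Sobolev σ T u ∧ l2SobolevNorm σ T u ≤ ENNReal.ofReal B ^ (1 / 2 : ℝ) := by
  classical
  have hI := lintegral_tsum_besselCoeff_le hT hc hB
  have hm : ∀ k, AEStronglyMeasurable (fun t => besselCoeff σ (u t) k) (volume.restrict (Icc 0 T)) :=
    fun k => (hc k).aestronglyMeasurable measurableSet_Icc
  have hfin : ∀ᵐ t ∂volume.restrict (Icc 0 T), Memℓp (besselCoeff σ (u t)) 2 := by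
    have := ae_lt_top' (AEMeasurable.tsum fun k => (hm k).enorm.pow_const 2)
      (hI.trans_lt ENNReal.ofReal_lt_top).ne
    filter_upwards [this] with t ht using memℓp_of_tsum_ne_top ht.ne
  refine ⟨⟨?_, fun t => if h : Memℓp (besselCoeff σ (u t)) 2 then ⟨besselCoeff σ (u t), h⟩ else 0,
    ⟨?_, ?_⟩, ?_⟩, ?_⟩
  · filter_upwards [hfin, ae_restrict_mem measurableSet_Icc] with t ht htI
    refine ⟨?_, ht⟩
    obtain ⟨C, hC⟩ := (isCompact_Icc (a := -π) (b := π)).exists_bound_of_continuousOn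
      (hu t htI).continuousOn
    have : IsFiniteMeasure circleMeasure := by rw [circleMeasure]; infer_instance
    exact MemLp.of_bound (hu t htI).aestronglyMeasurable C
      ((ae_restrict_iff' measurableSet_Ioc).2 (ae_of_all _ fun x hx => hC x (Ioc_subset_Icc_self hx)))
  -- Strong measurability of the ℓ²-valued map comes from its finite-frequency truncations, which
  -- converge almost everywhere.
  · refine aestronglyMeasurable_of_tendsto_ae (u := (atTop : Filter (Finset ℤ)))
      (f := fun S t => ∑ k ∈ S, lp.single (E := fun _ : ℤ => ℂ) 2 k (besselCoeff σ (u t) k))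
      (fun S => ?_) ?_
    · exact Finset.aestronglyMeasurable_fun_sum S fun k _ =>
        (lp.isometry_single (E := fun _ : ℤ => ℂ) (p := 2) k).continuous.comp_aestronglyMeasurable (hm k)
    · filter_upwards [hfin] with t ht
      rw [dif_pos ht]
      exact lp.hasSum_single (by norm_num) (⟨besselCoeff σ (u t), ht⟩ : lp (fun _ : ℤ => ℂ) 2)
  · rw [eLpNorm_lt_top_iff_lintegral_rpow_enorm_lt_top (by norm_num) (by norm_num)]
    refine lt_of_le_of_lt ?_ (hI.trans_lt ENNReal.ofReal_lt_top)
    refine lintegral_mono_ae ?_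
    filter_upwards [hfin] with t ht
    rw [dif_pos ht, ENNReal.toReal_ofNat, ENNReal.rpow_ofNat, enorm_sq_eq_tsum]
  · filter_upwards [hfin] with t ht k
    rw [dif_pos ht]
  · rw [l2SobolevNorm]
    simp only [sobolevNorm_sq]
    exact ENNReal.rpow_le_rpow hI (by norm_num)

end bochner

/-! ### Return from log (1 + h) to h, and the initial data. -/

lemma IsC2Path.continuousOn_besselCoeff {T : ℝ} {f f1 f2 : ℝ → ℝ → ℝ} (h : IsC2Path T f f1 f2)
    (σ : ℝ) (k : ℤ) : ContinuousOn (fun t => besselCoeff σ (f t) k) (Icc 0 T) := by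
  have hc : ContinuousOn (fun t => ∫ x in (-π)..π, Complex.exp (-((k * x : ℝ) * Complex.I)) * f t x)
      (Icc 0 T) := by
    rw [continuousOn_iff_continuous_domRestrict]
    have h1 : Continuous fun z : Icc 0 T × ℝ => Complex.exp (-((k * z.2 : ℝ) * Complex.I)) * f z.1 z.2 := by
      have : Continuous fun z : Icc 0 T × ℝ => f z.1 z.2 := h.continuousOn.comp_continuous (f := fun z : Icc 0 T × ℝ => ((z.1 : ℝ), z.2))
        (by fun_prop) fun z => ⟨z.1.2, mem_univ _⟩
      exact Continuous.mul (by fun_prop) (Complex.continuous_ofReal.comp this)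
    exact intervalIntegral.continuous_parametric_intervalIntegral_of_continuous' (μ := volume)
      (f := fun (t : Icc 0 T) x => Complex.exp (-((k * x : ℝ) * Complex.I)) * f t x) h1 (-π) π
  change ContinuousOn (fun t => _ * coeff (f t) k) _
  simp only [coeff_eq_integral]
  exact ContinuousOn.mul continuousOn_const (ContinuousOn.smul (f := fun _ => (1 / (2 * π) : ℝ)) continuousOn_const hc)

/-- For continuous g the set where |g| > c is open, so a null one is empty; closure and periodicity
then reach every point. -/
lemma abs_le_of_eLpNorm_top_le {g : ℝ → ℝ} (hg : Continuous g) (hp : Function.Periodic g (2 * π)) {c : ℝ}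
    (hc : 0 ≤ c) (h : eLpNorm g ∞ circleMeasure ≤ ENNReal.ofReal c) (s : ℝ) : |g s| ≤ c := by
  have h1 : ∀ᵐ x ∂circleMeasure, |g x| ≤ c := by
    filter_upwards [enorm_ae_le_eLpNormEssSup g circleMeasure] with x hx
    rw [← eLpNorm_exponent_top] at hx
    have := hx.trans h
    rwa [← ofReal_norm, ENNReal.ofReal_le_ofReal_iff hc] at this
  have h2 : ∀ x ∈ Ioo (-π) π, |g x| ≤ c := by
    have hU : IsOpen (Ioo (-π) π ∩ {x | c < |g x|}) :=
      isOpen_Ioo.inter (isOpen_lt continuous_const hg.abs)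
    have hz : volume (Ioo (-π) π ∩ {x | c < |g x|}) = 0 := by
      rw [circleMeasure, ae_restrict_iff' measurableSet_Ioc, ae_iff] at h1
      refine measure_mono_null (fun x hx => ?_) h1
      simp only [mem_ofPred_eq, not_forall, not_le]
      exact ⟨Ioo_subset_Ioc_self hx.1, hx.2⟩
    have hz := (hU.measure_eq_zero_iff volume).1 hz
    intro x hx
    by_contra! hlt
    exact (hz ▸ (⟨hx, hlt⟩ : x ∈ Ioo (-π) π ∩ {x | c < |g x|}) : x ∈ (∅ : Set ℝ))
  have h3 : ∀ x ∈ Icc (-π) π, |g x| ≤ c := by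
    rw [← closure_Ioo (by linarith [pi_pos])]
    exact fun x hx => le_on_closure h2 hg.abs.continuousOn continuousOn_const hx
  obtain ⟨x, hx, e⟩ := hp.exists_mem_Ico (by positivity) s (-π)
  rw [e]
  exact h3 x ⟨hx.1, by linarith [hx.2]⟩

lemma IsContinuousC2.isC2Path {I : Set ℝ} {h : ℝ → ℝ → ℝ} (hh : IsContinuousC2 I h) {T : ℝ}
    (hT : Icc 0 T ⊆ I) :
    IsC2Path T h (fun t => deriv (h t)) (fun t => iteratedDeriv 2 (h t)) := by
  have hc : ∀ k ≤ 2, ContinuousOn (fun z : ℝ × ℝ => iteratedDeriv k (h z.1) z.2) (Icc 0 T ×ˢ univ) := by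
    intro k hk z hz
    have hcont : Continuous (iteratedDeriv k (h z.1)) :=
      (hh.contDiff z.1 (hT hz.1)).continuous_iteratedDeriv k (by exact_mod_cast hk)
    have h1 : Tendsto Prod.fst (𝓝[Icc 0 T ×ˢ univ] z) (𝓝[I] z.1) :=
      tendsto_nhdsWithin_of_tendsto_nhds_of_eventually_within _
        (continuous_fst.continuousAt.tendsto.mono_left nhdsWithin_le_nhds)
        (eventually_mem_nhdsWithin.mono fun w hw => hT hw.1)
    refine tendsto_comp_of_locally_uniform_limit (F := fun w : ℝ × ℝ => iteratedDeriv k (h w.1))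
      (g := Prod.snd) hcont.continuousAt
      (continuous_snd.continuousAt.tendsto.mono_left nhdsWithin_le_nhds) fun U hU => ?_
    exact ⟨univ, univ_mem, (h1.eventually (hh.tendsto k hk z.1 (hT hz.1) U hU)).mono
      fun w hw y _ => hw y⟩
  have e0 := hc 0 (by norm_num)
  have e1 := hc 1 (by norm_num)
  simp only [iteratedDeriv_zero] at e0
  simp only [iteratedDeriv_one] at e1
  refine ⟨fun t ht => ?_, e0, e1, hc 2 le_rfl⟩
  have hcd := hh.contDiff t (hT ht)
  refine ⟨hh.periodic t (hT ht), fun s => (hcd.differentiable (by norm_num) s).hasDerivAt, fun s => ?_,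
    hcd.continuous_iteratedDeriv 2 le_rfl⟩
  have := hcd.differentiable_iteratedDeriv 1 (by norm_num) s
  rw [iteratedDeriv_one] at this
  rw [iteratedDeriv_succ, iteratedDeriv_one]
  exact this.hasDerivAt

lemma IsC2Solution.hasDerivAt_log {Tstar : EReal} {h₀ : ℝ → ℝ} {h : ℝ → ℝ → ℝ}
    (hh : IsC2Solution Tstar h₀ h) {t : ℝ} (ht : 0 < t) (ht' : (t : EReal) < Tstar)
    (hpos : ∀ s, 0 < 1 + h t s) (s : ℝ) :
    HasDerivAt (fun τ => log (1 + h τ s)) (logVelocity (h t) s) t := by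
  obtain ⟨v, hv, e⟩ := hh.equation t ht ht' s
  refine ((hv.const_add 1).log (hpos s).ne').congr_deriv ?_
  rw [logVelocity, ← e, add_sub_cancel_right]

lemma small_data_bounds {x y : ℝ} (hx : |x| ≤ 1 / 1000) (hy : |y| ≤ 1 / 1000) :
    0 < 1 + x ∧ |log (1 + x)| ≤ 1 ∧ |y / (1 + x)| ≤ 1 / 200 := by
  obtain ⟨h1, h2⟩ := abs_le.1 hx
  have hp : 0 < 1 + x := by linarith
  refine ⟨hp, ?_, ?_⟩
  · rw [abs_le]
    constructor
    · have := one_sub_inv_le_log_of_pos hp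
      have h3 : (1 + x)⁻¹ ≤ 2 := by
        rw [inv_le_comm₀ hp (by norm_num)]
        linarith
      linarith
    · linarith [log_le_sub_one_of_pos hp]
  · rw [abs_div, abs_of_pos hp, div_le_iff₀ hp]
    linarith

/-- The dissipation of `f` in terms of that of `log (1 + f)`. -/
lemma IsC2Profile.dissipation_le {f f1 f2 : ℝ → ℝ} (h : IsC2Profile f f1 f2) (hpos : ∀ s, 0 < 1 + f s)
    {A : ℝ} (hA : ∀ s, 1 + f s ≤ A) (hslope : ∀ s, |f1 s / (1 + f s)| ≤ 1 / 200) {κ : ℝ} (hκ : 0 < κ)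
    (hπ : κ ≤ π) :
    dissipation f1 κ ≤ 2 * A ^ 2 * dissipation (fun s => f1 s / (1 + f s)) κ + 20 * A ^ 2 := by
  have hu := h.log_one_add hpos
  set w := fun s => f1 s / (1 + f s) with hw
  have hA0 : 0 < A := (hpos 0).trans_le (hA 0)
  have ef : ∀ s, f1 s = (1 + f s) * w s := fun s => by
    have := (hpos s).ne'
    simp only [hw]
    field_simp
  have hf1 : ∀ s, |f1 s| ≤ A / 200 := fun s => by
    rw [ef, abs_mul, abs_of_pos (hpos s)]
    calc _ ≤ A * (1 / 200) := mul_le_mul (hA s) (hslope s) (abs_nonneg _) hA0.le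
      _ = _ := by ring
  have point : ∀ α ∈ Icc κ π, ∀ s, (f1 s - f1 (s - α)) ^ 2 / (1 - cos α) ≤
      2 * A ^ 2 * ((w s - w (s - α)) ^ 2 / (1 - cos α)) + A ^ 2 := by
    intro α hα s
    obtain ⟨k1, k2, -, -⟩ := abs_le_pi_of_mem hκ hα
    have hL := one_sub_cos_pos k2 k1
    have hL5 := sq_le_five_mul_one_sub_cos k2
    rw [mul_div_assoc', div_add' _ _ _ hL.ne']
    refine div_le_div_of_nonneg_right ?_ hL.le
    -- The product rule for f' = (1 + f) u': the second term is O(α), and its square is absorbed by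
    -- 1 - cos α.
    have e : f1 s - f1 (s - α) = (1 + f s) * (w s - w (s - α)) + (f s - f (s - α)) * w (s - α) := by
      rw [ef s, ef (s - α)]
      ring
    have h1 : |(1 + f s) * (w s - w (s - α))| ≤ A * |w s - w (s - α)| := by
      rw [abs_mul, abs_of_pos (hpos s)]
      exact mul_le_mul_of_nonneg_right (hA s) (abs_nonneg _)
    have h2 : |(f s - f (s - α)) * w (s - α)| ≤ A / 200 * |α| * (1 / 200) := by
      rw [abs_mul]
      refine mul_le_mul ?_ (hslope _) (abs_nonneg _) (by positivity)
      have := h.abs_sub_le hf1 s (s - α)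
      rwa [sub_sub_cancel] at this
    have h3 := pow_le_pow_left₀ (abs_nonneg _) h1 2
    have h4 := pow_le_pow_left₀ (abs_nonneg _) h2 2
    rw [sq_abs, mul_pow A, sq_abs] at h3
    rw [sq_abs, mul_pow (A / 200 * |α|), mul_pow (A / 200), sq_abs] at h4
    rw [e]
    have h5 : A ^ 2 * α ^ 2 ≤ A ^ 2 * (5 * (1 - cos α)) := mul_le_mul_of_nonneg_left hL5 (sq_nonneg _)
    have h6 : 0 ≤ A ^ 2 * α ^ 2 := by positivity
    nlinarith [sq_nonneg ((1 + f s) * (w s - w (s - α)) - (f s - f (s - α)) * w (s - α))]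
  have hle : -π ≤ π := by linarith [pi_pos]
  have d1 := continuousOn_dissipation_density h.cont1 hκ (Icc (-π) π)
  have d2 := continuousOn_dissipation_density hu.cont1 hκ (Icc (-π) π)
  have slice : ∀ g : ℝ → ℝ, ContinuousOn (fun z : ℝ × ℝ => (g z.2 - g (z.2 - z.1)) ^ 2 / (1 - cos z.1))
      (Icc κ π ×ˢ Icc (-π) π) → ∀ α ∈ Icc κ π,
      IntervalIntegrable (fun s => (g s - g (s - α)) ^ 2 / (1 - cos α)) volume (-π) π := by
    intro g hg α hα
    exact intervalIntegrable_of_continuousOn_Icc hle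
      (hg.comp (f := fun s => (α, s)) (by fun_prop) fun s hs => ⟨hα, hs⟩)
  have inner : ∀ α ∈ Icc κ π, ∫ s in (-π)..π, (f1 s - f1 (s - α)) ^ 2 / (1 - cos α) ≤
      2 * A ^ 2 * (∫ s in (-π)..π, (w s - w (s - α)) ^ 2 / (1 - cos α)) + A ^ 2 * (2 * π) := by
    intro α hα
    have i2 := (slice w d2 α hα).const_mul (2 * A ^ 2)
    have := intervalIntegral.integral_mono_on hle (slice f1 d1 α hα)
      (i2.add (intervalIntegrable_const (c := A ^ 2))) fun s _ => point α hα s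
    rw [intervalIntegral.integral_add i2 intervalIntegrable_const, intervalIntegral.integral_const_mul,
      intervalIntegral.integral_const, smul_eq_mul] at this
    linarith
  have c1 := intervalIntegrable_of_continuousOn_Icc hπ (continuousOn_intervalIntegral
    (F := fun α s => (f1 s - f1 (s - α)) ^ 2 / (1 - cos α)) hle d1)
  have c2 := (intervalIntegrable_of_continuousOn_Icc hπ (continuousOn_intervalIntegral
    (F := fun α s => (w s - w (s - α)) ^ 2 / (1 - cos α)) hle d2)).const_mul (2 * A ^ 2)
  have := intervalIntegral.integral_mono_on hπ c1
    (c2.add (intervalIntegrable_const (c := A ^ 2 * (2 * π)))) inner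
  rw [intervalIntegral.integral_add c2 intervalIntegrable_const, intervalIntegral.integral_const_mul,
    intervalIntegral.integral_const, smul_eq_mul] at this
  refine this.trans (add_le_add le_rfl ?_)
  have h1 : (π - κ) * (2 * π) ≤ 20 := by nlinarith [pi_pos, pi_lt_d2]
  nlinarith [sq_nonneg A]

/-- The truncated `L²H^{3/2}` norms of a solution path. -/
lemma IsSolutionPath.integral_sum_besselCoeff_le {T : ℝ} {f f1 f2 : ℝ → ℝ → ℝ}
    (h : IsSolutionPath T f f1 f2) (hT : 0 < T)
    (hslope : ∀ t ∈ Icc 0 T, ∀ s, |f1 t s / (1 + f t s)| ≤ 1 / 200)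
    (hlog : ∀ t ∈ Icc 0 T, ∀ s, |log (1 + f t s)| ≤ 1 + t) {n : ℕ} (hn : 0 < n) :
    ∫ t in 0..T, ∑ k ∈ Finset.Icc (-(n : ℤ)) n, ‖besselCoeff (3 / 2) (f t) k‖ ^ 2 ≤
      700 * exp (1 + T) ^ 2 * (1 + T) := by
  set A := exp (1 + T) with hAdef
  have hA1 : 1 ≤ A := one_le_exp (by linarith)
  have hκ : 0 < π / (2 * n) := by positivity
  have hπ : π / (2 * n) ≤ π := by
    have : (1 : ℝ) ≤ n := by exact_mod_cast hn
    exact div_le_self pi_pos.le (by linarith)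
  have hA : ∀ t ∈ Icc 0 T, ∀ s, 1 + f t s ≤ A := fun t ht s => by
    rw [hAdef, ← log_le_iff_le_exp (h.pos t ht s)]
    linarith [le_abs_self (log (1 + f t s)), hlog t ht s, ht.2]
  have hu := h.logPath
  have hsum : ∀ t ∈ Icc 0 T, ∑ k ∈ Finset.Icc (-(n : ℤ)) n, ‖besselCoeff (3 / 2) (f t) k‖ ^ 2 ≤
      6 * A ^ 2 * dissipation (fun s => f1 t s / (1 + f t s)) (π / (2 * n)) + 61 * A ^ 2 := by
    intro t ht
    have hp := h.profile t ht
    have h1 := sum_norm_besselCoeff_sq_le hp hn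
    have h2 := hp.dissipation_le (h.pos t ht) (hA t ht) (hslope t ht) hκ hπ
    have h3 : ‖∫ s in (-π)..π, f t s ^ 2‖ ≤ A ^ 2 * |π - -π| := by
      refine intervalIntegral.norm_integral_le_of_norm_le_const fun s _ => ?_
      rw [norm_pow]
      refine pow_le_pow_left₀ (norm_nonneg _) (abs_le.2 ⟨?_, ?_⟩) 2
      · linarith [h.pos t ht s]
      · linarith [hA t ht s]
    rw [show π - -π = 2 * π by ring, abs_of_pos (show 0 < 2 * π by positivity)] at h3
    have h4 : 1 / (2 * π) * ∫ s in (-π)..π, f t s ^ 2 ≤ A ^ 2 := by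
      rw [one_div_mul_eq_div, div_le_iff₀ (by positivity)]
      exact (le_abs_self _).trans h3
    linarith
  have hc := hu.continuousOn_dissipation hκ hπ
  have hd := (intervalIntegrable_of_continuousOn_Icc hT.le hc).const_mul (6 * A ^ 2)
  have hs : ContinuousOn (fun t => ∑ k ∈ Finset.Icc (-(n : ℤ)) n, ‖besselCoeff (3 / 2) (f t) k‖ ^ 2)
      (Icc 0 T) :=
    continuousOn_finsetSum _ fun k _ => (h.toIsC2Path.continuousOn_besselCoeff _ k).norm.pow 2
  have := intervalIntegral.integral_mono_on hT.le (intervalIntegrable_of_continuousOn_Icc hT.le hs)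
    (hd.add (intervalIntegrable_const (c := 61 * A ^ 2))) hsum
  rw [intervalIntegral.integral_add hd intervalIntegrable_const, intervalIntegral.integral_const_mul,
    intervalIntegral.integral_const, smul_eq_mul, sub_zero] at this
  have hD := h.integral_dissipation_le hT (fun t ht s => (hslope t ht s).trans (by norm_num)) hκ hπ
  have hD' := mul_le_mul_of_nonneg_left hD (show 0 ≤ 6 * A ^ 2 by positivity)
  -- The dissipation bound contributes 6 · 100 and the lower-order terms 61, which gives the
  -- constant 700.
  nlinarith [sq_nonneg A]

end NPeskin

end

theorem mainTheorem3 :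
    ∃ c₀ : ℝ, 0 < c₀ ∧ ∃ C : ℝ → ℝ, (∀ T : ℝ, 0 < C T) ∧
      ∀ (Tstar : EReal) (h₀ : ℝ → ℝ) (h : ℝ → ℝ → ℝ), 0 < Tstar →
        NPeskin.IsC2Solution Tstar h₀ h →
        NPeskin.lipschitzNorm h₀ < ENNReal.ofReal c₀ →
        ∀ T : ℝ, 0 < T → (T : EReal) ≤ Tstar →
          NPeskin.MemL2Sobolev (3 / 2) T h ∧
          NPeskin.l2SobolevNorm (3 / 2) T h ≤ ENNReal.ofReal (C T) := by
  open NPeskin in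
  -- The value 1/1000 makes the initial |u| at most 1 and the initial |u'| at most 1/200. The square
  -- root converts the bound on the squared norm, and |T| keeps C positive for negative T too.
  refine ⟨1 / 1000, by norm_num, fun T => √(700 * exp (1 + T) ^ 2 * (1 + |T|)),
    fun T => by positivity, ?_⟩
  intro Tstar h₀ h _ hsol hsmall T hT hTs
  have hsub : Icc 0 T ⊆ timeInterval Tstar := fun t ht =>
    ⟨ht.1, (EReal.coe_le_coe_iff.2 ht.2).trans hTs⟩
  have hpath := hsol.regular.isC2Path hsub
  have h0 := hpath.profile 0 ⟨le_rfl, hT.le⟩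
  rw [lipschitzNorm, ← hsol.initial] at hsmall
  have b0 := abs_le_of_eLpNorm_top_le h0.cont h0.per (by norm_num) (le_self_add.trans hsmall.le)
  have b1 := abs_le_of_eLpNorm_top_le h0.cont1 h0.per1 (by norm_num) (le_add_self.trans hsmall.le)
  have b := fun s => small_data_bounds (b0 s) (b1 s)
  obtain ⟨hp, hslope, hlog⟩ := isSolutionPath_of_small_slope hpath hT
    (fun t ht hpos s => hsol.hasDerivAt_log ht.1 ((EReal.coe_lt_coe_iff.2 ht.2).trans_le hTs) hpos s)
    (fun s => (b s).1) (fun s => (b s).2.1) (fun s => (b s).2.2)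
  have key := memL2Sobolev_of_forall_integral_le hT (fun t ht => (hpath.profile t ht).cont)
    (fun k => hpath.continuousOn_besselCoeff (3 / 2) k)
    (fun n hn => hp.integral_sum_besselCoeff_le hT hslope hlog hn)
  refine ⟨key.1, key.2.trans (le_of_eq ?_)⟩
  beta_reduce
  rw [sqrt_eq_rpow, ENNReal.ofReal_rpow_of_nonneg (by positivity) (by norm_num), abs_of_pos hT]
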